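/- All manifolds are smooth and finite-dimensional, without boundary. Let $\Gamma\rightrightarrows M$ be a Lie groupoid with source $s$ and target $t$ ($gh$ is defined when $s(g)=t(h)$), and let $A$ be an abelian Lie group. An *$A$-central extension* $A\to R\xrightarrow{\pi}\Gamma\rightrightarrows M$ is a Lie groupoid $R\rightrightarrows M$ with a groupoid homomorphism $\pi:R\to\Gamma$ over $\mathrm{id}_M$ and an action of $A$ on $R$ that makes $\pi$ a smooth locally trivial principal $A$-bundle and satisfies $(a r)(b r')=(ab)(rr')$ for all $a,b\in A$ and composable $r,r'$. We use the following notions for an $S^1$-central extension $R$ of $\Gamma$ and an integer $n\ge 1$. * *Powers.* For extensions $R,R'$, let $R\otimes R'=(R\times_\Gamma R')/S^1$, where $\lambda\in S^1$ acts by $(\lambda r,\lambda^{-1}r')$; $R^n=R\otimes\cdots\otimes R$ ($n$ factors). * *Covers.* For an open cover $(U_i)$ of $M$, $\Gamma[U_i]\rightrightarrows\coprod_i U_i$ is the Lie groupoid of triples $(i,g,j)$ with $g\in\Gamma$, $t(g)\in U_i$, $s(g)\in U_j$, and $(i,g,j)(j,h,k)=(i,gh,k)$; $R[U_i]$ is defined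 in the same way and is an $S^1$-central extension of $\Gamma[U_i]$. * *Twisted vector bundles.* A rank $n$ *twisted vector bundle* is a smooth complex vector bundle $J:E\to M$ of rank $n$ with a smooth left action of the groupoid $R$, in which each $r$ acts as a linear map $E_{s(r)}\to E_{t(r)}$, such that $(\lambda r)\cdot x=\lambda(r\cdot x)$ for all $\lambda\in S^1$, $r\in R$, $x\in E$ with $s(r)=J(x)$. * *Equivariant generalized homomorphisms.* Let $G$ be a Lie group with a homomorphism $j:S^1\to G$. An *$S^1$-equivariant generalized homomorphism* $R\to G$ is a smooth locally trivial (right) principal $G$-bundle $\tau:Z\to M$ with a smooth left action of the groupoid $R$ with respect to $\tau$ that commutes with the action of $G$, and a smooth fibre-preserving action of $S^1$ on $Z$, such that $(\lambda r)\cdot z\cdot g=r\cdot(\lambda z)\cdot g=r\cdot z\cdot(j(\lambda)g)$ for all $\lambda\in S^1$, $g\in G$, $r\in R$, $z\in Z$ with $s(r)=\tau(z)$. For $G=GL_n(\mathbb C)$, $j$ is the inclusion of the unitary scalars; for $G=S^1$, $j=\mathrm{id}$. * *Triviality.* $R$ is *trivial* if there is an $S^1$-equivariant generalized homomorphism $R\to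 S^1$, and *torsion* if $R^m$ is trivial for some $m\geq 1$. **Proposition.** Let $S^1\to R\to\Gamma\rightrightarrows M$ be an $S^1$-central extension of Lie groupoids and let $n\ge 1$. Consider the following properties: 1. (i) there exists a rank $n$ twisted vector bundle; 2. (ii) there exists an $S^1$-equivariant generalized homomorphism $R\to GL_n(\mathbb C)$; 3. (iii) there exist an open cover $(U_i)$ of $M$ and a smooth groupoid homomorphism $\psi:R[U_i]\to\mathbb C^*$ such that $\psi(\lambda r)=\lambda^n\psi(r)$ for all $\lambda\in S^1$ and $r\in R[U_i]$; 4. (iv) $R^n$ is a trivial extension; 5. (v) there exist an open cover $(U_i)$ of $M$ and a $\mu_n$-central extension $\mu_n\to R'\to\Gamma[U_i]\rightrightarrows\coprod_i U_i$, where $\mu_n\subset S^1$ is the group of $n$-th roots of unity, such that $R[U_i]$ is isomorphic, as an $S^1$-central extension of $\Gamma[U_i]$, to $R'\times_{\mu_n}S^1$, the quotient of $R'\times S^1$ by $(\zeta r,\lambda)\sim(r,\zeta\lambda)$, $\zeta\in\mu_n$. Then (i) $\Leftrightarrow$ (ii) $\Rightarrow$ (iii) $\Leftrightarrow$ (iv)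 $\Leftrightarrow$ (v). In particular, if a twisted vector bundle of rank $n$ exists, then $R$ is torsion. -/

import Mathlib

set_option linter.unusedSectionVars false
set_option linter.style.haveILetI false
set_option linter.unusedVariables false

open scoped Manifold ContDiff Topology
open TopologicalSpace

universe u v

/-- A smooth (`C^∞`) finite-dimensional manifold without boundary, as a bundled object. -/
structure SmoothMfd : Type (u + 1) where
  carrier : Type u
  E : Type u
  H : Type u
  [normedGroup : NormedAddCommGroup E]
  [normedSpace : NormedSpace ℝ E]
  [finDim : FiniteDimensional ℝ E]
  [topH : TopologicalSpace H]
  I : ModelWithCorners ℝ E H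
  [boundaryless : I.Boundaryless]
  [top : TopologicalSpace carrier]
  [charted : ChartedSpace H carrier]
  [isManifold : IsManifold I ∞ carrier]

attribute [instance] SmoothMfd.normedGroup SmoothMfd.normedSpace SmoothMfd.finDim SmoothMfd.topH
  SmoothMfd.boundaryless SmoothMfd.top SmoothMfd.charted SmoothMfd.isManifold

instance : CoeSort SmoothMfd.{u} (Type u) := ⟨SmoothMfd.carrier⟩

namespace SmoothMfd

/-- A map between manifolds is smooth. -/
def Smooth (X : SmoothMfd.{u}) (Y : SmoothMfd.{v}) (f : X → Y) : Prop :=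
  ContMDiff X.I Y.I ∞ f

/-- A map between manifolds is smooth on a subset (smooth in the usual sense if the subset is
open or is an embedded submanifold).  Its values outside the subset are irrelevant. -/
def SmoothOn (X : SmoothMfd.{u}) (Y : SmoothMfd.{v}) (f : X → Y) (S : Set X) : Prop :=
  ContMDiffOn X.I Y.I ∞ f S

/-- A smooth submersion: a smooth map with surjective differential at each point. -/
def Submersion (X : SmoothMfd.{u}) (Y : SmoothMfd.{v}) (f : X → Y) : Prop :=
  ContMDiff X.I Y.I ∞ f ∧ ∀ x, Function.Surjective (mfderiv X.I Y.I f x)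

/-- A smooth map from the subspace `{(x, y) | p (x, y)}` of `X × Y` to `Z`.  The value of `f`
outside the subspace is irrelevant. -/
def SmoothOn₂ (X Y Z : SmoothMfd.{u}) (p : X → Y → Prop) (f : X → Y → Z) : Prop :=
  ContMDiffOn (X.I.prod Y.I) Z.I ∞ (fun q : X × Y => f q.1 q.2) {q | p q.1 q.2}

section comp

/-- The pregroupoid of maps that are smooth on an open set. -/
def smoothPregroupoid (X : SmoothMfd.{u}) : Pregroupoid X where
  property f s := ContMDiffOn X.I X.I ∞ f s
  comp {f g u v} hf hg _ _ _ := hg.comp (hf.mono Set.inter_subset_left) (fun _ hx => hx.2)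
  id_mem := contMDiffOn_id
  locality {f u} _ h := by
    apply contMDiffOn_of_locally_contMDiffOn
    intro x hx
    obtain ⟨v, hv, hxv, h⟩ := h x hx
    exact ⟨v, hv, hxv, h⟩
  congr {f g u} _ hfg hf := hf.congr hfg

variable (X : SmoothMfd.{u}) (P : Type u) [TopologicalSpace P] [c : ChartedSpace X P]

theorem comp_isManifold (h : ∀ e ∈ atlas X P, ∀ e' ∈ atlas X P,
    ContMDiffOn X.I X.I ∞ (e.symm.trans e') (e.symm.trans e').source) :
    let _ := ChartedSpace.comp X.H X P
    IsManifold X.I ∞ P := by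
  intro _
  have hP : HasGroupoid P (smoothPregroupoid X).groupoid :=
    hasGroupoid_of_pregroupoid _ (fun he he' => h _ he _ he')
  have hg : HasGroupoid P (contDiffGroupoid ∞ X.I) := by
    refine StructureGroupoid.HasGroupoid.comp (smoothPregroupoid X).groupoid ?_
    intro e he
    rw [mem_groupoid_of_pregroupoid] at he
    rw [isLocalStructomorphOn_contDiffGroupoid_iff]
    exact he
  exact { hg with }

/-- A space `P` with an atlas of charts valued in the manifold `X` and smooth transition maps,
considered as a manifold. -/
def comp (h : ∀ e ∈ atlas X P, ∀ e' ∈ atlas X P,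
    ContMDiffOn X.I X.I ∞ (e.symm.trans e') (e.symm.trans e').source) : SmoothMfd.{u} :=
  letI := ChartedSpace.comp X.H X P
  haveI := comp_isManifold X P h
  { carrier := P, E := X.E, H := X.H, I := X.I }

variable {X P}

theorem comp_chart_aux (h : ∀ e ∈ atlas X P, ∀ e' ∈ atlas X P,
    ContMDiffOn X.I X.I ∞ (e.symm.trans e') (e.symm.trans e').source) (x : P) :
    let _ := ChartedSpace.comp X.H X P
    ContMDiffAt X.I X.I ∞ (chartAt X x) x ∧
      ContMDiffAt X.I X.I ∞ (chartAt X x).symm (chartAt X x x) := by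
  intro _
  have := comp_isManifold X P h
  let e0 := chartAt X x
  let c0 := chartAt X.H (e0 x)
  have hx0 : x ∈ e0.source := mem_chart_source X x
  have hxc : e0 x ∈ c0.source := mem_chart_source X.H (e0 x)
  have hc : chartAt X.H x = e0.trans c0 := rfl
  have h1 : ContMDiffAt X.I X.I ∞ (e0.trans c0) x := by
    rw [← hc]; exact contMDiffAt_of_mem_maximalAtlas (IsManifold.chart_mem_maximalAtlas x)
      (mem_chart_source X.H x)
  have h2 : ContMDiffAt X.I X.I ∞ (e0.trans c0).symm (c0 (e0 x)) := by
    rw [← hc]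
    refine contMDiffAt_symm_of_mem_maximalAtlas (IsManifold.chart_mem_maximalAtlas x) ?_
    exact (chartAt X.H x).map_source (mem_chart_source X.H x)
  have h3 : ContMDiffAt X.I X.I ∞ c0.symm (c0 (e0 x)) :=
    contMDiffAt_symm_of_mem_maximalAtlas (IsManifold.chart_mem_maximalAtlas (e0 x))
      (c0.map_source hxc)
  have h4 : ContMDiffAt X.I X.I ∞ c0 (e0 x) :=
    contMDiffAt_of_mem_maximalAtlas (IsManifold.chart_mem_maximalAtlas (e0 x)) hxc
  constructor
  · refine (ContMDiffAt.comp x h3 h1).congr_of_eventuallyEq ?_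
    have : (e0.trans c0).source ∈ 𝓝 x :=
      (e0.trans c0).open_source.mem_nhds (by simp [hx0, hxc])
    filter_upwards [this] with y hy
    simp only [mfld_simps] at hy
    simp [c0.left_inv hy.2, e0]
  · have := ContMDiffAt.comp (e0 x) h2 h4
    refine this.congr_of_eventuallyEq ?_
    filter_upwards [c0.open_source.mem_nhds hxc] with y hy
    simp [c0.left_inv hy, e0]

theorem comp_chart (h : ∀ e ∈ atlas X P, ∀ e' ∈ atlas X P,
    ContMDiffOn X.I X.I ∞ (e.symm.trans e') (e.symm.trans e').source)
    (e : OpenPartialHomeomorph P X) (he : e ∈ atlas X P) :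
    SmoothOn (comp X P h) X e e.source := by
  let _ := ChartedSpace.comp X.H X P
  change ContMDiffOn X.I X.I ∞ e e.source
  intro x hx
  have h1 := (comp_chart_aux h x).1
  have hx0 : x ∈ (chartAt X x).source := mem_chart_source X x
  have h2 := h _ (chart_mem_atlas X x) e he
  have h3 : ContMDiffAt X.I X.I ∞ ((chartAt X x).symm.trans e) (chartAt X x x) :=
    h2.contMDiffAt (((chartAt X x).symm.trans e).open_source.mem_nhds (by simp [hx, hx0]))
  refine ((ContMDiffAt.comp x h3 h1).congr_of_eventuallyEq ?_).contMDiffWithinAt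
  filter_upwards [(chartAt X x).open_source.mem_nhds hx0] with y hy
  simp [(chartAt X x).left_inv hy]

theorem comp_chart_symm (h : ∀ e ∈ atlas X P, ∀ e' ∈ atlas X P,
    ContMDiffOn X.I X.I ∞ (e.symm.trans e') (e.symm.trans e').source)
    (e : OpenPartialHomeomorph P X) (he : e ∈ atlas X P) :
    SmoothOn X (comp X P h) e.symm e.target := by
  let _ := ChartedSpace.comp X.H X P
  change ContMDiffOn X.I X.I ∞ e.symm e.target
  intro z hz
  obtain ⟨x, hx, rfl⟩ : ∃ x ∈ e.source, e x = z := ⟨e.symm z, e.map_target hz, e.right_inv hz⟩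
  have h1 := (comp_chart_aux h x).2
  have hx0 : x ∈ (chartAt X x).source := mem_chart_source X x
  have h2 := h e he _ (chart_mem_atlas X x)
  have hn : (e.symm.trans (chartAt X x)).source ∈ 𝓝 (e x) :=
    (e.symm.trans (chartAt X x)).open_source.mem_nhds (by simp [hx, hx0])
  have h3 : ContMDiffAt X.I X.I ∞ (e.symm.trans (chartAt X x)) (e x) := h2.contMDiffAt hn
  have h1' : ContMDiffAt X.I X.I ∞ (chartAt X x).symm ((e.symm.trans (chartAt X x)) (e x)) := by
    simpa [e.left_inv hx] using h1
  refine ((ContMDiffAt.comp (e x) h1' h3).congr_of_eventuallyEq ?_).contMDiffWithinAt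
  filter_upwards [hn] with y hy
  simp only [mfld_simps] at hy
  simp [(chartAt X x).left_inv hy.2]

end comp
end SmoothMfd

/-- A Lie groupoid `Γ ⇉ M`.  Arrows `g, h` are composable when `s g = t h`, and then
`mul g h : s h → t g`; the values of `mul` on non-composable pairs are irrelevant. -/
structure LieGroupoid (M : SmoothMfd.{u}) : Type (u + 1) where
  arr : SmoothMfd.{u}
  s : arr → M
  t : arr → M
  one : M → arr
  inv : arr → arr
  mul : arr → arr → arr
  s_submersion : arr.Submersion M s
  t_submersion : arr.Submersion M t
  one_smooth : M.Smooth arr one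
  inv_smooth : arr.Smooth arr inv
  mul_smooth : SmoothMfd.SmoothOn₂ arr arr arr (fun g h => s g = t h) mul
  s_one : ∀ x, s (one x) = x
  t_one : ∀ x, t (one x) = x
  s_inv : ∀ g, s (inv g) = t g
  t_inv : ∀ g, t (inv g) = s g
  s_mul : ∀ g h, s g = t h → s (mul g h) = s h
  t_mul : ∀ g h, s g = t h → t (mul g h) = t g
  one_mul : ∀ g, mul (one (t g)) g = g
  mul_one : ∀ g, mul g (one (s g)) = g
  inv_mul : ∀ g, mul (inv g) g = one (s g)
  mul_inv : ∀ g, mul g (inv g) = one (t g)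
  assoc : ∀ g h k, s g = t h → s h = t k → mul (mul g h) k = mul g (mul h k)

/-- `proj : P → B`, with the right action `act` of the Lie group `G`, is a smooth locally trivial
principal `G`-bundle: over some neighbourhood `U` of each point of `B` there is a smooth section
`σ` such that `U × G → proj⁻¹(U)`, `(x, g) ↦ σ(x) g`, is a diffeomorphism, the inverse being
`p ↦ (proj p, φ p)`. -/
structure IsPrincipalBundle {EG HG : Type} [NormedAddCommGroup EG] [NormedSpace ℝ EG]
    [TopologicalSpace HG] (IG : ModelWithCorners ℝ EG HG)
    (G : Type) [TopologicalSpace G] [ChartedSpace HG G] [Group G]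
    (P B : SmoothMfd.{u}) (proj : P → B) (act : P → G → P) : Prop where
  smooth_proj : P.Smooth B proj
  smooth_act : ContMDiff (P.I.prod IG) P.I ∞ (fun q : P × G => act q.1 q.2)
  act_one : ∀ p, act p 1 = p
  act_mul : ∀ p g h, act p (g * h) = act (act p g) h
  proj_act : ∀ p g, proj (act p g) = proj p
  locally_trivial : ∀ b, ∃ U : Set B, IsOpen U ∧ b ∈ U ∧ ∃ (σ : B → P) (φ : P → G),
    ContMDiffOn B.I P.I ∞ σ U ∧ ContMDiffOn P.I IG ∞ φ (proj ⁻¹' U) ∧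
    (∀ x ∈ U, proj (σ x) = x) ∧ (∀ x ∈ U, ∀ g, φ (act (σ x) g) = g) ∧
    ∀ p, proj p ∈ U → act (σ (proj p)) (φ p) = p

section Extensions

variable {EA HA : Type} [NormedAddCommGroup EA] [NormedSpace ℝ EA] [FiniteDimensional ℝ EA]
  [TopologicalSpace HA] (IA : ModelWithCorners ℝ EA HA) [IA.Boundaryless]
  (A : Type) [TopologicalSpace A] [ChartedSpace HA A] [CommGroup A] [LieGroup IA ∞ A]

/-- A central extension `A → R → Γ ⇉ M` of the Lie groupoid `Γ` by the abelian Lie group `A`. -/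
structure CentralExtension {M : SmoothMfd.{u}} (Γ : LieGroupoid M) : Type (u + 1) where
  R : LieGroupoid M
  π : R.arr → Γ.arr
  smul : A → R.arr → R.arr
  s_π : ∀ r, Γ.s (π r) = R.s r
  t_π : ∀ r, Γ.t (π r) = R.t r
  π_mul : ∀ r r', R.s r = R.t r' → π (R.mul r r') = Γ.mul (π r) (π r')
  principal : IsPrincipalBundle IA A R.arr Γ.arr π (fun r a => smul a r)
  smul_mul_smul : ∀ a b r r', R.s r = R.t r' →
    R.mul (smul a r) (smul b r') = smul (a * b) (R.mul r r')

/-- The product of a manifold with a Lie group, as a manifold. -/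
noncomputable abbrev SmoothMfd.prodGroup (X : SmoothMfd.{u}) : SmoothMfd.{u} :=
  { carrier := X × A, E := X.E × EA, H := ModelProd X.H HA, I := X.I.prod IA,
    isManifold := by
      have : IsManifold IA ∞ A := ContMDiffMul.toIsManifold
      infer_instance }

/-- Algebraic and local data from which a central extension of `Γ` by `A` is assembled: a set `P`
with the algebraic structure of a central extension, and set-theoretic local trivializations
`(γ, a) ↦ a • σ i γ` over open sets `U i` covering `Γ`, with inverse `p ↦ (π p, φ i p)`, in which the
structure maps are smooth. -/
structure ExtensionData {M : SmoothMfd.{u}} (Γ : LieGroupoid M) : Type (u + 1) where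
  P : Type u
  π : P → Γ.arr
  one : M → P
  inv : P → P
  mul : P → P → P
  smul : A → P → P
  π_one : ∀ x, π (one x) = Γ.one x
  π_inv : ∀ p, π (inv p) = Γ.inv (π p)
  π_mul : ∀ p q, Γ.s (π p) = Γ.t (π q) → π (mul p q) = Γ.mul (π p) (π q)
  π_smul : ∀ a p, π (smul a p) = π p
  one_mul : ∀ p, mul (one (Γ.t (π p))) p = p
  mul_one : ∀ p, mul p (one (Γ.s (π p))) = p
  inv_mul : ∀ p, mul (inv p) p = one (Γ.s (π p))
  mul_inv : ∀ p, mul p (inv p) = one (Γ.t (π p))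
  assoc : ∀ p q r, Γ.s (π p) = Γ.t (π q) → Γ.s (π q) = Γ.t (π r) →
    mul (mul p q) r = mul p (mul q r)
  one_smul : ∀ p, smul 1 p = p
  smul_smul : ∀ a b p, smul a (smul b p) = smul (a * b) p
  smul_mul_smul : ∀ a b p q, Γ.s (π p) = Γ.t (π q) →
    mul (smul a p) (smul b q) = smul (a * b) (mul p q)
  U : Γ.arr → Set Γ.arr
  σ : Γ.arr → Γ.arr → P
  φ : Γ.arr → P → A
  isOpen_U : ∀ i, IsOpen (U i)
  mem_U : ∀ i, i ∈ U i
  π_σ : ∀ i, ∀ γ ∈ U i, π (σ i γ) = γ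
  φ_smul_σ : ∀ i, ∀ γ ∈ U i, ∀ a, φ i (smul a (σ i γ)) = a
  φ_smul : ∀ i p, π p ∈ U i → smul (φ i p) (σ i (π p)) = p
  smooth_trans : ∀ i j, ContMDiffOn Γ.arr.I IA ∞ (fun γ => φ j (σ i γ)) (U i ∩ U j)
  smooth_one : ∀ i, ContMDiffOn M.I IA ∞ (fun x => φ i (one x)) (Γ.one ⁻¹' U i)
  smooth_inv : ∀ i j, ContMDiffOn Γ.arr.I IA ∞ (fun γ => φ j (inv (σ i γ)))
    (U i ∩ Γ.inv ⁻¹' U j)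
  smooth_mul : ∀ i j k, ContMDiffOn (Γ.arr.I.prod Γ.arr.I) IA ∞
    (fun q : Γ.arr × Γ.arr => φ k (mul (σ i q.1) (σ j q.2)))
    {q | Γ.s q.1 = Γ.t q.2 ∧ q.1 ∈ U i ∧ q.2 ∈ U j ∧ Γ.mul q.1 q.2 ∈ U k}

namespace ExtensionData

variable {IA A} {M : SmoothMfd.{u}} {Γ : LieGroupoid M} (D : ExtensionData IA A Γ)

theorem φ_smul_eq (i : Γ.arr) (p : D.P) (h : D.π p ∈ D.U i) (a : A) :
    D.φ i (D.smul a p) = a * D.φ i p := by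
  conv_lhs => rw [← D.φ_smul i p h, D.smul_smul]
  exact D.φ_smul_σ i _ h _

/-- The local trivialization of `P` over `U i`. -/
def triv (i : Γ.arr) : PartialEquiv D.P (Γ.arr × A) where
  toFun p := (D.π p, D.φ i p)
  invFun q := D.smul q.2 (D.σ i q.1)
  source := {p | D.π p ∈ D.U i}
  target := {q | q.1 ∈ D.U i}
  map_source' _ h := h
  map_target' q h := by
    change D.π (D.smul q.2 (D.σ i q.1)) ∈ D.U i
    rw [D.π_smul, D.π_σ i _ h]; exact h
  left_inv' p h := D.φ_smul i p h
  right_inv' q h := by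
    refine Prod.ext ?_ (D.φ_smul_σ i _ h _)
    change D.π (D.smul q.2 (D.σ i q.1)) = q.1
    rw [D.π_smul, D.π_σ i _ h]

theorem triv_trans_source (i j : Γ.arr) :
    ((D.triv i).symm.trans (D.triv j)).source = {q | q.1 ∈ D.U i ∩ D.U j} := by
  ext q
  simp only [triv, PartialEquiv.trans_source, PartialEquiv.symm_source, Set.mem_inter_iff,
    Set.mem_ofPred_eq, Set.mem_preimage, PartialEquiv.coe_symm_mk, D.π_smul]
  constructor
  · rintro ⟨h, h'⟩; rw [D.π_σ i _ h] at h'; exact ⟨h, h'⟩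
  · rintro ⟨h, h'⟩; rw [D.π_σ i _ h]; exact ⟨h, h'⟩

theorem triv_trans (i j : Γ.arr) :
    ContMDiffOn (Γ.arr.I.prod IA) (Γ.arr.I.prod IA) ∞
      (fun q : Γ.arr × A => (D.triv i).symm.trans (D.triv j) q)
      {q | q.1 ∈ D.U i ∩ D.U j} := by
  have h1 : ContMDiffOn (Γ.arr.I.prod IA) (Γ.arr.I.prod IA) ∞
      (fun q : Γ.arr × A => (q.1, q.2 * D.φ j (D.σ i q.1))) {q | q.1 ∈ D.U i ∩ D.U j} :=
    contMDiffOn_fst.prodMk (contMDiffOn_snd.mul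
      ((D.smooth_trans i j).comp contMDiffOn_fst (fun q h => h)))
  refine h1.congr ?_
  rintro q ⟨hi, hj⟩
  refine Prod.ext ?_ ?_
  · change D.π (D.smul q.2 (D.σ i q.1)) = q.1
    rw [D.π_smul, D.π_σ i _ hi]
  · change D.φ j (D.smul q.2 (D.σ i q.1)) = _
    rw [D.φ_smul_eq]
    rw [D.π_σ i _ hi]; exact hj

/-- The atlas of local trivializations. -/
def core : ChartedSpaceCore (SmoothMfd.prodGroup IA A Γ.arr) D.P where
  atlas := Set.range D.triv
  chartAt p := D.triv (D.π p)
  mem_chart_source p := D.mem_U (D.π p)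
  chart_mem_atlas p := ⟨D.π p, rfl⟩
  open_source := by
    rintro _ _ ⟨i, rfl⟩ ⟨j, rfl⟩
    rw [D.triv_trans_source]
    exact ((D.isOpen_U i).inter (D.isOpen_U j)).preimage continuous_fst
  continuousOn_toFun := by
    rintro _ _ ⟨i, rfl⟩ ⟨j, rfl⟩
    rw [D.triv_trans_source]
    exact (D.triv_trans i j).continuousOn

/-- The manifold structure on `P` in which all local trivializations are diffeomorphisms. -/
noncomputable def mfd : SmoothMfd.{u} :=
  letI := D.core.toTopologicalSpace
  letI := D.core.toChartedSpace
  SmoothMfd.comp (SmoothMfd.prodGroup IA A Γ.arr) D.P (by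
    intro e he e' he'
    obtain ⟨_, ⟨i, rfl⟩, rfl⟩ := Set.mem_iUnion₂.1 he
    obtain ⟨_, ⟨j, rfl⟩, rfl⟩ := Set.mem_iUnion₂.1 he'
    have h : ((D.core.openPartialHomeomorph (D.triv i) ⟨i, rfl⟩).symm.trans
        (D.core.openPartialHomeomorph (D.triv j) ⟨j, rfl⟩)).source = {q | q.1 ∈ D.U i ∩ D.U j} :=
      D.triv_trans_source i j
    rw [h]
    exact D.triv_trans i j)

theorem smooth_triv (i : Γ.arr) :
    D.mfd.SmoothOn (SmoothMfd.prodGroup IA A Γ.arr) (fun p => (D.π p, D.φ i p))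
      {p | D.π p ∈ D.U i} := by
  letI := D.core.toTopologicalSpace
  letI := D.core.toChartedSpace
  refine SmoothMfd.comp_chart _ (D.core.openPartialHomeomorph (D.triv i) ⟨i, rfl⟩) ?_
  exact Set.mem_iUnion₂.2 ⟨_, ⟨i, rfl⟩, rfl⟩

theorem smooth_triv_symm (i : Γ.arr) :
    (SmoothMfd.prodGroup IA A Γ.arr).SmoothOn D.mfd (fun q => D.smul q.2 (D.σ i q.1))
      {q | q.1 ∈ D.U i} := by
  letI := D.core.toTopologicalSpace
  letI := D.core.toChartedSpace
  refine SmoothMfd.comp_chart_symm _ (D.core.openPartialHomeomorph (D.triv i) ⟨i, rfl⟩) ?_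
  exact Set.mem_iUnion₂.2 ⟨_, ⟨i, rfl⟩, rfl⟩

theorem isOpen_dom (i : Γ.arr) : IsOpen {p : D.mfd | D.π p ∈ D.U i} :=
  D.core.open_source' ⟨i, rfl⟩

theorem smooth_φ (i : Γ.arr) :
    ContMDiffOn D.mfd.I IA ∞ (fun p : D.mfd => D.φ i p) {p | D.π p ∈ D.U i} :=
  contMDiff_snd.comp_contMDiffOn (D.smooth_triv i)

theorem smooth_π : D.mfd.Smooth Γ.arr D.π := by
  intro p
  have h : ContMDiffOn D.mfd.I Γ.arr.I ∞ (fun p : D.mfd => D.π p) {q | D.π q ∈ D.U (D.π p)} :=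
    contMDiff_fst.comp_contMDiffOn (D.smooth_triv (D.π p))
  exact h.contMDiffAt ((D.isOpen_dom _).mem_nhds (D.mem_U (D.π p)))

variable {EY HY Y : Type*} [NormedAddCommGroup EY] [NormedSpace ℝ EY] [TopologicalSpace HY]
  {IY : ModelWithCorners ℝ EY HY} [TopologicalSpace Y] [ChartedSpace HY Y]

theorem smooth_into {f : Y → D.mfd} {S : Set Y} {y : Y} (hy : y ∈ S) (i : Γ.arr)
    (hi : D.π (f y) ∈ D.U i)
    (hπ : ContMDiffWithinAt IY Γ.arr.I ∞ (fun y => D.π (f y)) S y)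
    (hφ : ContMDiffWithinAt IY IA ∞ (fun y => D.φ i (f y)) S y) :
    ContMDiffWithinAt IY D.mfd.I ∞ f S y := by
  let g : Γ.arr × A → D.mfd := fun q => D.smul q.2 (D.σ i q.1)
  have hi' : {q : Γ.arr × A | q.1 ∈ D.U i} ∈ 𝓝 (D.π (f y), D.φ i (f y)) :=
    ((D.isOpen_U i).preimage continuous_fst).mem_nhds hi
  have h1 : ContMDiffAt (Γ.arr.I.prod IA) D.mfd.I ∞ g (D.π (f y), D.φ i (f y)) :=
    ContMDiffOn.contMDiffAt (D.smooth_triv_symm i) hi'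
  have h2 := ContMDiffAt.comp_contMDiffWithinAt y h1 (hπ.prodMk hφ)
  refine h2.congr_of_eventuallyEq_of_mem ?_ hy
  have h3 : ∀ᶠ z in 𝓝[S] y, D.π (f z) ∈ D.U i :=
    hπ.continuousWithinAt ((D.isOpen_U i).mem_nhds hi)
  filter_upwards [h3] with z hz
  exact (D.φ_smul i (f z) hz).symm

theorem smooth_σ (i : Γ.arr) : Γ.arr.SmoothOn D.mfd (D.σ i) (D.U i) := by
  intro γ hγ
  refine D.smooth_into (f := fun x => D.σ i x) hγ i (by rwa [D.π_σ i _ hγ]) ?_ ?_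
  · exact contMDiffWithinAt_id.congr (fun x hx => D.π_σ i x hx) (D.π_σ i _ hγ)
  · have : ∀ x ∈ D.U i, D.φ i (D.σ i x) = 1 := fun x hx => by
      rw [← D.φ_smul_σ i x hx 1, D.one_smul]
    exact (contMDiffWithinAt_const (c := (1 : A))).congr this (this _ hγ)

theorem submersion (f : Γ.arr → M) (hf : Γ.arr.Submersion M f) :
    D.mfd.Submersion M (fun p => f (D.π p)) := by
  have hs : ContMDiff D.mfd.I M.I ∞ (fun p : D.mfd => f (D.π p)) := hf.1.comp D.smooth_π
  refine ⟨hs, fun p => ?_⟩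
  let i := D.π p
  have hi : i ∈ D.U i := D.mem_U i
  have hn : D.U i ∈ 𝓝 i := (D.isOpen_U i).mem_nhds hi
  let τ : Γ.arr → D.mfd := fun γ => D.smul (D.φ i p) (D.σ i γ)
  have hτp : τ i = p := D.φ_smul i p hi
  have hπτ : ∀ γ ∈ D.U i, D.π (τ γ) = γ := fun γ hγ => by
    simp only [τ, D.π_smul]; exact D.π_σ i _ hγ
  have hτ : ContMDiffAt Γ.arr.I D.mfd.I ∞ τ i := by
    refine ContMDiffWithinAt.contMDiffAt (s := D.U i) ?_ hn
    refine D.smooth_into hi i (by rw [hπτ _ hi]; exact hi) ?_ ?_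
    · exact contMDiffWithinAt_id.congr hπτ (hπτ _ hi)
    · have : ∀ x ∈ D.U i, D.φ i (τ x) = D.φ i p := fun x hx => D.φ_smul_σ i x hx _
      exact (contMDiffWithinAt_const (c := D.φ i p)).congr this (this _ hi)
  have hcomp : (fun γ => f (D.π (τ γ))) =ᶠ[𝓝 i] f := by
    filter_upwards [hn] with γ hγ
    rw [hπτ γ hγ]
  have hd : mfderiv Γ.arr.I M.I f i =
      (mfderiv D.mfd.I M.I (fun p : D.mfd => f (D.π p)) (τ i)).comp
        (mfderiv Γ.arr.I D.mfd.I τ i) := by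
    rw [← mfderiv_comp i ((hs _).mdifferentiableAt (by simp)) (hτ.mdifferentiableAt (by simp))]
    exact (Filter.EventuallyEq.mfderiv_eq hcomp).symm
  have hsurj : Function.Surjective
      (mfderiv D.mfd.I M.I (fun p : D.mfd => f (D.π p)) (τ i)) := by
    have h := hf.2 i
    rw [hd] at h
    intro v
    obtain ⟨w, hw⟩ := h v
    exact ⟨_, hw⟩
  rw [hτp] at hsurj
  exact hsurj

end ExtensionData
end Extensions

namespace ExtensionData
section
variable {EA HA : Type} [NormedAddCommGroup EA] [NormedSpace ℝ EA] [FiniteDimensional ℝ EA]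
  [TopologicalSpace HA] {IA : ModelWithCorners ℝ EA HA} [IA.Boundaryless]
  {A : Type} [TopologicalSpace A] [ChartedSpace HA A] [CommGroup A] [LieGroup IA ∞ A]
  {M : SmoothMfd.{u}} {Γ : LieGroupoid M} (D : ExtensionData IA A Γ)

theorem smooth_one' : M.Smooth D.mfd D.one := by
  intro x
  have hU : D.π (D.one x) ∈ D.U (Γ.one x) := by rw [D.π_one]; exact D.mem_U _
  have hn : Γ.one ⁻¹' D.U (Γ.one x) ∈ 𝓝 x :=
    ((D.isOpen_U _).preimage (ContMDiff.continuous Γ.one_smooth)).mem_nhds (D.mem_U _)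
  refine ContMDiffWithinAt.contMDiffAt (s := Set.univ) ?_ Filter.univ_mem
  refine D.smooth_into (f := fun x => D.one x) (Set.mem_univ _) (Γ.one x) hU ?_ ?_
  · simp only [D.π_one]; exact (Γ.one_smooth x).contMDiffWithinAt
  · exact ((D.smooth_one (Γ.one x)).contMDiffAt hn).contMDiffWithinAt

theorem inv_smul (a : A) (p : D.P) : D.inv (D.smul a p) = D.smul a⁻¹ (D.inv p) := by
  have hs : Γ.s (D.π (D.inv p)) = Γ.t (D.π p) := by rw [D.π_inv, Γ.s_inv]
  have ht : Γ.t (D.π (D.inv p)) = Γ.s (D.π p) := by rw [D.π_inv, Γ.t_inv]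
  have h1 : D.mul (D.smul a⁻¹ (D.inv p)) (D.smul a p) = D.one (Γ.s (D.π p)) := by
    rw [D.smul_mul_smul _ _ _ _ hs, D.inv_mul, inv_mul_cancel, D.one_smul]
  have hsi : Γ.s (D.π (D.inv (D.smul a p))) = Γ.t (D.π p) := by
    rw [D.π_inv, D.π_smul, Γ.s_inv]
  have hti : Γ.t (D.π (D.inv (D.smul a p))) = Γ.s (D.π p) := by
    rw [D.π_inv, D.π_smul, Γ.t_inv]
  have h2 := D.assoc (D.smul a⁻¹ (D.inv p)) (D.smul a p) (D.inv (D.smul a p))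
    (by rw [D.π_smul, D.π_smul, hs]) (by rw [hti, D.π_smul])
  rw [h1, D.mul_inv, ← hti, D.one_mul] at h2
  rw [h2, D.π_smul, ← hs, ← D.π_smul a⁻¹ (D.inv p), D.mul_one]

theorem smooth_inv' : D.mfd.Smooth D.mfd D.inv := by
  intro p
  let i := D.π p
  let j := Γ.inv i
  have hj : ∀ p : D.P, D.π (D.inv p) ∈ D.U (Γ.inv (D.π p)) := fun p => by
    rw [D.π_inv]; exact D.mem_U _
  have hπ : ContMDiff D.mfd.I Γ.arr.I ∞ (fun p : D.mfd => D.π p) := D.smooth_π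
  have hi : ContMDiff Γ.arr.I Γ.arr.I ∞ Γ.inv := Γ.inv_smooth
  refine ContMDiffWithinAt.contMDiffAt (s := Set.univ) ?_ Filter.univ_mem
  refine D.smooth_into (f := fun x : D.mfd => D.inv x) (Set.mem_univ _) j (hj p) ?_ ?_
  · exact (hi.comp hπ).contMDiffAt.contMDiffWithinAt.congr (fun q _ => D.π_inv q) (D.π_inv p)
  · have hV : IsOpen {q : D.mfd | D.π q ∈ D.U i ∩ Γ.inv ⁻¹' D.U j} :=
      ((D.isOpen_U i).inter ((D.isOpen_U j).preimage hi.continuous)).preimage hπ.continuous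
    have hp : p ∈ {q : D.mfd | D.π q ∈ D.U i ∩ Γ.inv ⁻¹' D.U j} := ⟨D.mem_U _, D.mem_U _⟩
    have h1 : ContMDiffOn D.mfd.I IA ∞
        (fun q : D.mfd => (D.φ i q)⁻¹ * D.φ j (D.inv (D.σ i (D.π q))))
        {q : D.mfd | D.π q ∈ D.U i ∩ Γ.inv ⁻¹' D.U j} :=
      ContMDiffOn.mul (((D.smooth_φ i).mono (fun q hq => hq.1)).inv)
        ((D.smooth_inv i j).comp hπ.contMDiffOn (fun q hq => hq))
    refine ((h1.congr ?_).contMDiffAt (hV.mem_nhds hp)).contMDiffWithinAt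
    intro q hq
    conv_lhs => rw [← D.φ_smul i q hq.1, inv_smul]
    refine D.φ_smul_eq j _ ?_ _
    rw [D.π_inv, D.π_σ i _ hq.1]
    exact hq.2

theorem smooth_mul' : SmoothMfd.SmoothOn₂ D.mfd D.mfd D.mfd
    (fun p q => Γ.s (D.π p) = Γ.t (D.π q)) D.mul := by
  rintro ⟨p, q⟩ hpq
  change Γ.s (D.π p) = Γ.t (D.π q) at hpq
  let i := D.π p
  let j := D.π q
  let k := Γ.mul i j
  let S : Set (D.mfd × D.mfd) := {x | Γ.s (D.π x.1) = Γ.t (D.π x.2)}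
  have hπ : ContMDiff D.mfd.I Γ.arr.I ∞ (fun p : D.mfd => D.π p) := D.smooth_π
  have hππ : ContMDiff (D.mfd.I.prod D.mfd.I) (Γ.arr.I.prod Γ.arr.I) ∞
      (fun x : D.mfd × D.mfd => ((D.π x.1, D.π x.2) : Γ.arr × Γ.arr)) :=
    (hπ.comp contMDiff_fst).prodMk (hπ.comp contMDiff_snd)
  have hm : ContMDiffOn (D.mfd.I.prod D.mfd.I) Γ.arr.I ∞
      (fun x : D.mfd × D.mfd => Γ.mul (D.π x.1) (D.π x.2)) S :=
    ContMDiffOn.comp Γ.mul_smooth hππ.contMDiffOn (fun x hx => hx)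
  have hS : (p, q) ∈ S := hpq
  refine D.smooth_into (f := fun x : D.mfd × D.mfd => D.mul x.1 x.2) (S := S) hS k ?_ ?_ ?_
  · rw [D.π_mul _ _ hpq]; exact D.mem_U _
  · exact (hm _ hS).congr (fun x hx => D.π_mul _ _ hx) (D.π_mul _ _ hpq)
  · let T : Set (D.mfd × D.mfd) := {x | Γ.s (D.π x.1) = Γ.t (D.π x.2) ∧ D.π x.1 ∈ D.U i ∧
      D.π x.2 ∈ D.U j ∧ Γ.mul (D.π x.1) (D.π x.2) ∈ D.U k}
    have hT : T ∈ 𝓝[S] (p, q) := by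
      have e1 : ∀ᶠ x in 𝓝[S] ((p, q) : D.mfd × D.mfd), D.π x.1 ∈ D.U i :=
        mem_nhdsWithin_of_mem_nhds (((D.isOpen_U i).preimage
          (hπ.continuous.comp continuous_fst)).mem_nhds (D.mem_U _))
      have e2 : ∀ᶠ x in 𝓝[S] ((p, q) : D.mfd × D.mfd), D.π x.2 ∈ D.U j :=
        mem_nhdsWithin_of_mem_nhds (((D.isOpen_U j).preimage
          (hπ.continuous.comp continuous_snd)).mem_nhds (D.mem_U _))
      have e3 : ∀ᶠ x in 𝓝[S] ((p, q) : D.mfd × D.mfd), Γ.mul (D.π x.1) (D.π x.2) ∈ D.U k :=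
        (hm _ hS).continuousWithinAt ((D.isOpen_U k).mem_nhds (D.mem_U _))
      filter_upwards [e1, e2, e3, self_mem_nhdsWithin] with x h1 h2 h3 h4
      exact ⟨h4, h1, h2, h3⟩
    have h1 : ContMDiffOn (D.mfd.I.prod D.mfd.I) IA ∞
        (fun x : D.mfd × D.mfd => D.φ i x.1 * D.φ j x.2 *
          D.φ k (D.mul (D.σ i (D.π x.1)) (D.σ j (D.π x.2)))) T := by
      refine ContMDiffOn.mul (ContMDiffOn.mul ?_ ?_) ?_
      · exact (D.smooth_φ i).comp contMDiffOn_fst (fun x hx => hx.2.1)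
      · exact (D.smooth_φ j).comp contMDiffOn_snd (fun x hx => hx.2.2.1)
      · exact (D.smooth_mul i j k).comp hππ.contMDiffOn (fun x hx => hx)
    have hmem : (p, q) ∈ T := ⟨hpq, D.mem_U _, D.mem_U _, D.mem_U _⟩
    refine ContMDiffWithinAt.mono_of_mem_nhdsWithin ((h1 _ hmem).congr ?_ ?_) hT
    all_goals
      first
      | intro x hx
      | (have hx := hmem; generalize (p, q) = x at hx ⊢)
      have hs : Γ.s (D.π (D.σ i (D.π x.1))) = Γ.t (D.π (D.σ j (D.π x.2))) := by
        rw [D.π_σ i _ hx.2.1, D.π_σ j _ hx.2.2.1, hx.1]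
      change D.φ k (D.mul x.1 x.2) = _
      conv_lhs => rw [← D.φ_smul i x.1 hx.2.1, ← D.φ_smul j x.2 hx.2.2.1,
        D.smul_mul_smul _ _ _ _ hs]
      refine D.φ_smul_eq k _ ?_ _
      rw [D.π_mul _ _ hs, D.π_σ i _ hx.2.1, D.π_σ j _ hx.2.2.1]
      exact hx.2.2.2

theorem smooth_smul : ContMDiff (D.mfd.I.prod IA) D.mfd.I ∞
    (fun q : D.mfd × A => (show D.mfd from D.smul q.2 q.1)) := by
  rintro ⟨p, a⟩
  let i := D.π p
  have hπ : ContMDiff D.mfd.I Γ.arr.I ∞ (fun p : D.mfd => D.π p) := D.smooth_π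
  refine ContMDiffWithinAt.contMDiffAt (s := Set.univ) ?_ Filter.univ_mem
  refine D.smooth_into (f := fun q : D.mfd × A => D.smul q.2 q.1) (Set.mem_univ _) i ?_ ?_ ?_
  · exact (D.π_smul a p).symm ▸ D.mem_U (D.π p)
  · exact (hπ.comp contMDiff_fst).contMDiffAt.contMDiffWithinAt.congr
      (fun q _ => D.π_smul q.2 q.1) (D.π_smul a p)
  · have hV : IsOpen {q : D.mfd × A | D.π q.1 ∈ D.U i} :=
      (D.isOpen_U i).preimage (hπ.continuous.comp continuous_fst)
    have h1 : ContMDiffOn (D.mfd.I.prod IA) IA ∞ (fun q : D.mfd × A => q.2 * D.φ i q.1)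
        {q : D.mfd × A | D.π q.1 ∈ D.U i} :=
      ContMDiffOn.mul contMDiffOn_snd ((D.smooth_φ i).comp contMDiffOn_fst (fun x hx => hx))
    refine ((h1.congr ?_).contMDiffAt (hV.mem_nhds ?_)).contMDiffWithinAt
    · intro q hq; exact D.φ_smul_eq i _ hq _
    · exact D.mem_U _

/-- The Lie groupoid structure on the total space. -/
noncomputable def toLieGroupoid : LieGroupoid M where
  arr := D.mfd
  s p := Γ.s (D.π p)
  t p := Γ.t (D.π p)
  one := D.one
  inv := D.inv
  mul := D.mul
  s_submersion := D.submersion Γ.s Γ.s_submersion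
  t_submersion := D.submersion Γ.t Γ.t_submersion
  one_smooth := D.smooth_one'
  inv_smooth := D.smooth_inv'
  mul_smooth := D.smooth_mul'
  s_one x := by rw [D.π_one, Γ.s_one]
  t_one x := by rw [D.π_one, Γ.t_one]
  s_inv p := (congrArg Γ.s (D.π_inv p)).trans (Γ.s_inv _)
  t_inv p := (congrArg Γ.t (D.π_inv p)).trans (Γ.t_inv _)
  s_mul p q h := by rw [D.π_mul p q h, Γ.s_mul _ _ h]
  t_mul p q h := by rw [D.π_mul p q h, Γ.t_mul _ _ h]
  one_mul := D.one_mul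
  mul_one := D.mul_one
  inv_mul := D.inv_mul
  mul_inv := D.mul_inv
  assoc := D.assoc

/-- The central extension assembled from the data. -/
noncomputable def toCentralExtension : CentralExtension IA A Γ where
  R := D.toLieGroupoid
  π := D.π
  smul := D.smul
  s_π _ := rfl
  t_π _ := rfl
  π_mul := D.π_mul
  smul_mul_smul := D.smul_mul_smul
  principal :=
    { smooth_proj := D.smooth_π
      smooth_act := D.smooth_smul
      act_one := D.one_smul
      act_mul := fun (p : D.P) a b => by
        change D.smul (a * b) p = D.smul b (D.smul a p)
        rw [D.smul_smul, mul_comm]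
      proj_act := fun p a => D.π_smul a p
      locally_trivial := fun γ => ⟨D.U γ, D.isOpen_U γ, D.mem_U γ, D.σ γ, D.φ γ, D.smooth_σ γ,
        D.smooth_φ γ, D.π_σ γ, D.φ_smul_σ γ, D.φ_smul γ⟩ }

end
end ExtensionData

section
variable {EA HA : Type} [NormedAddCommGroup EA] [NormedSpace ℝ EA] [FiniteDimensional ℝ EA]
  [TopologicalSpace HA] {IA : ModelWithCorners ℝ EA HA} [IA.Boundaryless]
  {A : Type} [TopologicalSpace A] [ChartedSpace HA A] [CommGroup A] [LieGroup IA ∞ A]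
  {M : SmoothMfd.{u}} {Γ : LieGroupoid M}

theorem LieGroupoid.one_of_idem (e : Γ.arr) (h : Γ.s e = Γ.t e) (he : Γ.mul e e = e) :
    e = Γ.one (Γ.s e) := by
  have h1 := Γ.assoc (Γ.inv e) e e (Γ.s_inv e) h
  rw [Γ.inv_mul, he, Γ.inv_mul, h, Γ.one_mul] at h1
  rw [h]; exact h1

theorem LieGroupoid.inv_unique (g h : Γ.arr) (hc : Γ.s h = Γ.t g)
    (h1 : Γ.mul h g = Γ.one (Γ.s g)) : h = Γ.inv g := by
  have h2 := Γ.assoc h g (Γ.inv g) hc (Γ.t_inv g).symm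
  rw [h1, Γ.mul_inv, ← hc, Γ.mul_one, ← Γ.t_inv, Γ.one_mul] at h2
  exact h2.symm

namespace CentralExtension
variable (R : CentralExtension IA A Γ)

theorem π_smul (a : A) (r : R.R.arr) : R.π (R.smul a r) = R.π r := R.principal.proj_act r a

theorem s_smul (a : A) (r : R.R.arr) : R.R.s (R.smul a r) = R.R.s r := by
  rw [← R.s_π, R.π_smul, R.s_π]

theorem t_smul (a : A) (r : R.R.arr) : R.R.t (R.smul a r) = R.R.t r := by
  rw [← R.t_π, R.π_smul, R.t_π]

theorem one_smul (r : R.R.arr) : R.smul 1 r = r := R.principal.act_one r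

theorem smul_smul (a b : A) (r : R.R.arr) : R.smul a (R.smul b r) = R.smul (a * b) r := by
  rw [mul_comm]; exact (R.principal.act_mul r b a).symm

theorem π_one (x : M) : R.π (R.R.one x) = Γ.one x := by
  have hst : R.R.s (R.R.one x) = R.R.t (R.R.one x) := by rw [R.R.s_one, R.R.t_one]
  have h1 : R.R.mul (R.R.one x) (R.R.one x) = R.R.one x := by
    have := R.R.one_mul (R.R.one x)
    rwa [R.R.t_one] at this
  have h2 := LieGroupoid.one_of_idem (R.π (R.R.one x)) (by rw [R.s_π, R.t_π, hst])
    (by rw [← R.π_mul _ _ hst, h1])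
  rwa [R.s_π, R.R.s_one] at h2

theorem π_inv (r : R.R.arr) : R.π (R.R.inv r) = Γ.inv (R.π r) := by
  apply LieGroupoid.inv_unique
  · rw [R.s_π, R.t_π, R.R.s_inv]
  · rw [← R.π_mul _ _ (R.R.s_inv r), R.R.inv_mul, R.π_one, R.s_π]

/-- The total space of a central extension with chosen local trivializations. -/
noncomputable def toData : ExtensionData IA A Γ :=
  let U := fun γ => (R.principal.locally_trivial γ).choose
  have hU := fun γ => (R.principal.locally_trivial γ).choose_spec
  let σ := fun γ => (hU γ).2.2.choose
  let φ := fun γ => (hU γ).2.2.choose_spec.choose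
  have h := fun γ => (hU γ).2.2.choose_spec.choose_spec
  have hπ : ContMDiff R.R.arr.I Γ.arr.I ∞ R.π := R.principal.smooth_proj
  { P := R.R.arr
    π := R.π
    one := R.R.one
    inv := R.R.inv
    mul := R.R.mul
    smul := R.smul
    π_one := R.π_one
    π_inv := R.π_inv
    π_mul := fun p q hpq => R.π_mul p q (by rw [← R.s_π, ← R.t_π, hpq])
    π_smul := R.π_smul
    one_mul := fun p => by rw [R.t_π, R.R.one_mul]
    mul_one := fun p => by rw [R.s_π, R.R.mul_one]
    inv_mul := fun p => by rw [R.s_π, R.R.inv_mul]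
    mul_inv := fun p => by rw [R.t_π, R.R.mul_inv]
    assoc := fun p q r => by rw [R.s_π, R.t_π, R.s_π, R.t_π]; exact R.R.assoc p q r
    one_smul := R.one_smul
    smul_smul := R.smul_smul
    smul_mul_smul := fun a b p q => by rw [R.s_π, R.t_π]; exact R.smul_mul_smul a b p q
    U := U
    σ := σ
    φ := φ
    isOpen_U := fun i => (hU i).1
    mem_U := fun i => (hU i).2.1
    π_σ := fun i => (h i).2.2.1
    φ_smul_σ := fun i => (h i).2.2.2.1
    φ_smul := fun i => (h i).2.2.2.2
    smooth_trans := fun i j => (h j).2.1.comp ((h i).1.mono Set.inter_subset_left)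
      (fun γ hγ => by change R.π (σ i γ) ∈ U j; rw [(h i).2.2.1 γ hγ.1]; exact hγ.2)
    smooth_one := fun i => (h i).2.1.comp (ContMDiff.contMDiffOn R.R.one_smooth)
      (fun x hx => by change R.π (R.R.one x) ∈ U i; rw [R.π_one]; exact hx)
    smooth_inv := fun i j => (h j).2.1.comp
      (ContMDiff.comp_contMDiffOn R.R.inv_smooth ((h i).1.mono Set.inter_subset_left))
      (fun γ hγ => by
        change R.π (R.R.inv (σ i γ)) ∈ U j
        rw [R.π_inv, (h i).2.2.1 γ hγ.1]; exact hγ.2)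
    smooth_mul := fun i j k => by
      have hc : ∀ q : Γ.arr × Γ.arr, Γ.s q.1 = Γ.t q.2 ∧ q.1 ∈ U i ∧ q.2 ∈ U j ∧
          Γ.mul q.1 q.2 ∈ U k → R.R.s (σ i q.1) = R.R.t (σ j q.2) := by
        rintro q ⟨h1, h2, h3, -⟩
        rw [← R.s_π, ← R.t_π, (h i).2.2.1 _ h2, (h j).2.2.1 _ h3, h1]
      refine (h k).2.1.comp (ContMDiffOn.comp (g := fun q : R.R.arr × R.R.arr =>
        R.R.mul q.1 q.2) R.R.mul_smooth (ContMDiffOn.prodMk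
          ((h i).1.comp contMDiffOn_fst (fun q hq => hq.2.1))
          ((h j).1.comp contMDiffOn_snd (fun q hq => hq.2.2.1))) hc) ?_
      intro q hq
      change R.π (R.R.mul (σ i q.1) (σ j q.2)) ∈ U k
      rw [R.π_mul _ _ (hc q hq), (h i).2.2.1 _ hq.2.1, (h j).2.2.1 _ hq.2.2.1]
      exact hq.2.2.2 }

end CentralExtension

namespace ExtensionData
variable (D D' : ExtensionData IA A Γ)

variable (Γ IA A) in
/-- Data for the strictly trivial central extension `Γ × A`. -/
def trivial : ExtensionData IA A Γ where
  P := Γ.arr × A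
  π := Prod.fst
  one x := (Γ.one x, 1)
  inv p := (Γ.inv p.1, p.2⁻¹)
  mul p q := (Γ.mul p.1 q.1, p.2 * q.2)
  smul a p := (p.1, a * p.2)
  π_one _ := rfl
  π_inv _ := rfl
  π_mul _ _ _ := rfl
  π_smul _ _ := rfl
  one_mul p := by simp [Γ.one_mul]
  mul_one p := by simp [Γ.mul_one]
  inv_mul p := by simp [Γ.inv_mul]
  mul_inv p := by simp [Γ.mul_inv]
  assoc p q r h h' := by simp [Γ.assoc _ _ _ h h', mul_assoc]
  one_smul p := by simp
  smul_smul a b p := by simp [mul_assoc]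
  smul_mul_smul a b p q _ := by simp [mul_mul_mul_comm]
  U _ := Set.univ
  σ _ γ := (γ, 1)
  φ _ p := p.2
  isOpen_U _ := isOpen_univ
  mem_U _ := Set.mem_univ _
  π_σ _ _ _ := rfl
  φ_smul_σ _ _ _ a := by simp
  φ_smul _ p _ := by simp
  smooth_trans _ _ := contMDiffOn_const
  smooth_one _ := contMDiffOn_const
  smooth_inv _ _ := (contMDiffOn_const (c := (1⁻¹ : A))).congr (fun _ _ => rfl)
  smooth_mul _ _ _ := (contMDiffOn_const (c := (1 * 1 : A))).congr (fun _ _ => rfl)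

/-- The relation `(r, r') ∼ (a r, a⁻¹ r')` on `R ×_Γ R'`. -/
def tensorSetoid : Setoid {p : D.P × D'.P // D.π p.1 = D'.π p.2} where
  r p q := ∃ a : A, q.1.1 = D.smul a p.1.1 ∧ q.1.2 = D'.smul a⁻¹ p.1.2
  iseqv :=
    { refl := fun p => ⟨1, by rw [D.one_smul], by rw [inv_one, D'.one_smul]⟩
      symm := by
        rintro p q ⟨a, h, h'⟩
        exact ⟨a⁻¹, by rw [h, D.smul_smul, inv_mul_cancel, D.one_smul],
          by rw [h', D'.smul_smul, inv_inv, mul_inv_cancel, D'.one_smul]⟩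
      trans := by
        rintro p q r ⟨a, h, h'⟩ ⟨b, k, k'⟩
        exact ⟨b * a, by rw [k, h, D.smul_smul], by rw [k', h', D'.smul_smul, _root_.mul_inv]⟩ }

theorem φ_σ (i γ : Γ.arr) (h : γ ∈ D.U i) : D.φ i (D.σ i γ) = 1 := by
  rw [← D.φ_smul_σ i γ h 1, D.one_smul]

/-- The class of `(r, r')` in `(R ×_Γ R') / A`. -/
def tmk (p : D.P) (q : D'.P) (h : D.π p = D'.π q) : Quotient (tensorSetoid D D') :=
  Quotient.mk _ ⟨(p, q), h⟩

variable {D D'} in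
theorem tmk_ind {C : Quotient (tensorSetoid D D') → Prop}
    (H : ∀ p q h, C (tmk D D' p q h)) : ∀ x, C x := by
  rintro ⟨⟨⟨p, q⟩, h⟩⟩; exact H p q h

theorem tmk_smul (a : A) (p : D.P) (q : D'.P) (h : D.π p = D'.π q) (h₁ h₂) :
    tmk D D' (D.smul a p) q h₁ = tmk D D' p (D'.smul a q) h₂ := by
  refine Quotient.sound ⟨a⁻¹, ?_, ?_⟩
  · change p = _
    rw [D.smul_smul, inv_mul_cancel, D.one_smul]
  · change D'.smul a q = _
    rw [inv_inv]

theorem tmk_congr {p p' : D.P} {q q' : D'.P} {h : D.π p = D'.π q} (hp : p = p') (hq : q = q') :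
    tmk D D' p q h = tmk D D' p' q' (hp ▸ hq ▸ h) := by
  subst hp hq; rfl

/-- The projection `R ⊗ R' → Γ`. -/
def tensorπ : Quotient (tensorSetoid D D') → Γ.arr :=
  Quotient.lift (fun p => D.π p.1.1) (by
    rintro p q ⟨a, h, -⟩; rw [h, D.π_smul])

/-- `[r, r']⁻¹ = [r⁻¹, r'⁻¹]`. -/
def tensorInv : Quotient (tensorSetoid D D') → Quotient (tensorSetoid D D') :=
  Quotient.map (fun p => ⟨(D.inv p.1.1, D'.inv p.1.2), by
      rw [D.π_inv, D'.π_inv, p.2]⟩) (by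
    rintro p q ⟨a, h, h'⟩
    exact ⟨a⁻¹, by simp only [h, D.inv_smul], by simp only [h', D'.inv_smul]⟩)

open Classical in
/-- `[r₁, r₁'] [r₂, r₂'] = [r₁ r₂, r₁' r₂']` for composable elements. -/
noncomputable def tensorMul : Quotient (tensorSetoid D D') → Quotient (tensorSetoid D D') →
    Quotient (tensorSetoid D D') :=
  Quotient.map₂ (fun p q =>
      if h : Γ.s (D.π p.1.1) = Γ.t (D.π q.1.1) then
        ⟨(D.mul p.1.1 q.1.1, D'.mul p.1.2 q.1.2), by
          rw [D.π_mul _ _ h, D'.π_mul _ _ (by rw [← p.2, ← q.2, h]), p.2, q.2]⟩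
      else p) (by
    rintro p q ⟨a, h, h'⟩ p' q' ⟨b, k, k'⟩
    have e : (Γ.s (D.π q.1.1) = Γ.t (D.π q'.1.1)) =
        (Γ.s (D.π p.1.1) = Γ.t (D.π p'.1.1)) := by rw [h, k, D.π_smul, D.π_smul]
    by_cases hc : Γ.s (D.π p.1.1) = Γ.t (D.π p'.1.1)
    · have hc' : Γ.s (D'.π p.1.2) = Γ.t (D'.π p'.1.2) := by rw [← p.2, ← p'.2, hc]
      rw [dif_pos hc, dif_pos (e ▸ hc)]
      refine ⟨a * b, ?_, ?_⟩
      · simp only [h, k]; rw [D.smul_mul_smul _ _ _ _ hc]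
      · simp only [h', k']; rw [D'.smul_mul_smul _ _ _ _ hc', _root_.mul_inv]
    · rw [dif_neg hc, dif_neg (e ▸ hc)]
      exact ⟨a, h, h'⟩)

/-- `a • [r, r'] = [a r, r']`. -/
def tensorSmul (c : A) : Quotient (tensorSetoid D D') → Quotient (tensorSetoid D D') :=
  Quotient.map (fun p => ⟨(D.smul c p.1.1, p.1.2), by rw [D.π_smul, p.2]⟩) (by
    rintro p q ⟨a, h, h'⟩
    exact ⟨a, by simp only [h, D.smul_smul, mul_comm], h'⟩)

variable {D D'} in
theorem tensorMul_mk {p₁ p₂ : D.P} {q₁ q₂ : D'.P} (h₁ : D.π p₁ = D'.π q₁) (h₂ : D.π p₂ = D'.π q₂)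
    (h : Γ.s (D.π p₁) = Γ.t (D.π p₂)) :
    tensorMul D D' (tmk D D' p₁ q₁ h₁) (tmk D D' p₂ q₂ h₂) =
      tmk D D' (D.mul p₁ p₂) (D'.mul q₁ q₂)
        (by rw [D.π_mul _ _ h, D'.π_mul _ _ (by rw [← h₁, ← h₂, h]), h₁, h₂]) :=
  congrArg (Quotient.mk (tensorSetoid D D')) (dif_pos h)

open Classical in
/-- The local section `γ ↦ [σ γ, σ' γ]`. -/
noncomputable def tensorσ (i γ : Γ.arr) : Quotient (tensorSetoid D D') :=
  if h : γ ∈ D.U i ∩ D'.U i then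
    tmk D D' (D.σ i γ) (D'.σ i γ) (by rw [D.π_σ i _ h.1, D'.π_σ i _ h.2])
  else tmk D D' (D.σ γ γ) (D'.σ γ γ) (by
    rw [D.π_σ γ _ (D.mem_U γ), D'.π_σ γ _ (D'.mem_U γ)])

variable {D D'} in
theorem tensorσ_eq {i γ : Γ.arr} (h : γ ∈ D.U i ∩ D'.U i) :
    tensorσ D D' i γ = tmk D D' (D.σ i γ) (D'.σ i γ) (by rw [D.π_σ i _ h.1, D'.π_σ i _ h.2]) :=
  dif_pos h

open Classical in
/-- The fibre coordinate `[r, r'] ↦ φ r φ' r'`. -/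
noncomputable def tensorφ (i : Γ.arr) : Quotient (tensorSetoid D D') → A :=
  Quotient.lift
    (fun p => if D.π p.1.1 ∈ D.U i ∩ D'.U i then D.φ i p.1.1 * D'.φ i p.1.2 else 1) (by
    rintro p q ⟨a, h, h'⟩
    have e : D.π q.1.1 = D.π p.1.1 := by rw [h, D.π_smul]
    change ite _ _ _ = ite _ _ _
    rw [e]
    by_cases hp : D.π p.1.1 ∈ D.U i ∩ D'.U i
    · have hp' : D'.π p.1.2 ∈ D'.U i := by rw [← p.2]; exact hp.2
      rw [if_pos hp, if_pos hp, h, h', D.φ_smul_eq _ _ hp.1, D'.φ_smul_eq _ _ hp',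
        mul_mul_mul_comm, mul_inv_cancel, _root_.one_mul]
    · rw [if_neg hp, if_neg hp])

variable {D D'} in
theorem tensorφ_mk {i : Γ.arr} {p : D.P} {q : D'.P} (h : D.π p = D'.π q)
    (hp : D.π p ∈ D.U i ∩ D'.U i) :
    tensorφ D D' i (tmk D D' p q h) = D.φ i p * D'.φ i q :=
  if_pos hp

/-- Data for the tensor product `R ⊗ R' = (R ×_Γ R') / A`. -/
noncomputable def tensor : ExtensionData IA A Γ where
  P := Quotient (tensorSetoid D D')
  π := tensorπ D D'
  one x := tmk D D' (D.one x) (D'.one x) (by rw [D.π_one, D'.π_one])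
  inv := tensorInv D D'
  mul := tensorMul D D'
  smul := tensorSmul D D'
  π_one x := D.π_one x
  π_inv := tmk_ind fun _ _ _ => D.π_inv _
  π_mul := tmk_ind fun _ _ _ => tmk_ind fun _ _ _ hc => by
    rw [tensorMul_mk _ _ hc]; exact D.π_mul _ _ hc
  π_smul a := tmk_ind fun _ _ _ => D.π_smul _ _
  one_mul := tmk_ind fun p q h => by
    refine (tensorMul_mk (p₁ := D.one (Γ.t (D.π p))) (q₁ := D'.one (Γ.t (D.π p)))
      (by rw [D.π_one, D'.π_one]) h (by rw [D.π_one, Γ.s_one])).trans ?_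
    exact tmk_congr D D' (D.one_mul p) (by rw [h, D'.one_mul])
  mul_one := tmk_ind fun p q h => by
    refine (tensorMul_mk (p₂ := D.one (Γ.s (D.π p))) (q₂ := D'.one (Γ.s (D.π p))) h
      (by rw [D.π_one, D'.π_one]) (by rw [D.π_one, Γ.t_one])).trans ?_
    exact tmk_congr D D' (D.mul_one p) (by rw [h, D'.mul_one])
  inv_mul := tmk_ind fun p q h => by
    change tensorMul D D' (tmk D D' (D.inv p) (D'.inv q) _) _ =
      tmk D D' (D.one (Γ.s (D.π p))) (D'.one (Γ.s (D.π p))) _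
    rw [tensorMul_mk _ _ (by rw [D.π_inv, Γ.s_inv])]
    exact tmk_congr D D' (D.inv_mul p) (by rw [h, D'.inv_mul])
  mul_inv := tmk_ind fun p q h => by
    change tensorMul D D' _ (tmk D D' (D.inv p) (D'.inv q) _) =
      tmk D D' (D.one (Γ.t (D.π p))) (D'.one (Γ.t (D.π p))) _
    rw [tensorMul_mk _ _ (by rw [D.π_inv, Γ.t_inv])]
    exact tmk_congr D D' (D.mul_inv p) (by rw [h, D'.mul_inv])
  assoc := tmk_ind fun p q h => tmk_ind fun p' q' h' => tmk_ind fun p'' q'' h'' hc hc' => by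
    change Γ.s (D.π p) = Γ.t (D.π p') at hc
    change Γ.s (D.π p') = Γ.t (D.π p'') at hc'
    rw [tensorMul_mk _ _ hc, tensorMul_mk _ _ hc',
      tensorMul_mk _ _ (by rw [D.π_mul _ _ hc, Γ.s_mul _ _ hc, hc']),
      tensorMul_mk _ _ (by rw [D.π_mul _ _ hc', Γ.t_mul _ _ hc', hc])]
    exact tmk_congr D D' (D.assoc _ _ _ hc hc')
      (D'.assoc _ _ _ (by rw [← h, ← h', hc]) (by rw [← h', ← h'', hc']))
  one_smul := tmk_ind fun p q h => tmk_congr D D' (h := by rw [D.π_smul, h]) (D.one_smul p) rfl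
  smul_smul a b := tmk_ind fun p q h => tmk_congr D D'
    (h := by rw [D.π_smul, D.π_smul, h]) (D.smul_smul a b p) rfl
  smul_mul_smul a b := tmk_ind fun p q h => tmk_ind fun p' q' h' hc => by
    change Γ.s (D.π p) = Γ.t (D.π p') at hc
    change tensorMul D D' (tmk D D' (D.smul a p) q _) (tmk D D' (D.smul b p') q' _) = _
    rw [tensorMul_mk _ _ hc, tensorMul_mk _ _ (by rw [D.π_smul, D.π_smul, hc])]
    exact tmk_congr D D' (D.smul_mul_smul a b p p' hc) rfl
  U i := D.U i ∩ D'.U i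
  σ := tensorσ D D'
  φ := tensorφ D D'
  isOpen_U i := (D.isOpen_U i).inter (D'.isOpen_U i)
  mem_U i := ⟨D.mem_U i, D'.mem_U i⟩
  π_σ i γ h := by rw [tensorσ_eq h]; exact D.π_σ i γ h.1
  φ_smul_σ i γ h a := by
    rw [tensorσ_eq h]
    change tensorφ D D' i (tmk D D' (D.smul a (D.σ i γ)) (D'.σ i γ) _) = a
    rw [tensorφ_mk _ (by rw [D.π_smul, D.π_σ i _ h.1]; exact h), D.φ_smul_σ i _ h.1,
      D'.φ_σ i _ h.2, _root_.mul_one]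
  φ_smul i := tmk_ind fun p q h hp => by
    change D.π p ∈ D.U i ∩ D'.U i at hp
    change tensorSmul D D' (tensorφ D D' i (tmk D D' p q h)) (tensorσ D D' i (D.π p)) = _
    rw [tensorφ_mk h hp, tensorσ_eq hp]
    have e1 := D.φ_smul i p hp.1
    have e2 := D'.φ_smul i q (h ▸ hp.2)
    rw [← h] at e2
    have := tmk_smul D D' (D'.φ i q) (D.smul (D.φ i p) (D.σ i (D.π p))) (D'.σ i (D.π p))
      (by rw [e1, D'.π_σ i _ hp.2]) (by rw [D.π_smul, e1, D'.π_σ i _ hp.2])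
      (by rw [e1, e2, h])
    refine Eq.trans ?_ (this.trans (tmk_congr D D' e1 e2))
    refine tmk_congr D D' ?_ rfl
    rw [D.smul_smul, mul_comm]
  smooth_trans i j := by
    refine (((D.smooth_trans i j).mono ?_).mul ((D'.smooth_trans i j).mono ?_)).congr ?_
    · exact fun x hx => ⟨hx.1.1, hx.2.1⟩
    · exact fun x hx => ⟨hx.1.2, hx.2.2⟩
    · intro x hx
      rw [tensorσ_eq hx.1]
      exact tensorφ_mk _ (by rw [D.π_σ i _ hx.1.1]; exact hx.2)
  smooth_one i := by
    refine (((D.smooth_one i).mono ?_).mul ((D'.smooth_one i).mono ?_)).congr ?_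
    · exact fun x hx => hx.1
    · exact fun x hx => hx.2
    · intro x hx
      exact tensorφ_mk _ (by rw [D.π_one]; exact hx)
  smooth_inv i j := by
    refine (((D.smooth_inv i j).mono ?_).mul ((D'.smooth_inv i j).mono ?_)).congr ?_
    · exact fun x hx => ⟨hx.1.1, hx.2.1⟩
    · exact fun x hx => ⟨hx.1.2, hx.2.2⟩
    · intro x hx
      rw [tensorσ_eq hx.1]
      exact tensorφ_mk _ (by rw [D.π_inv, D.π_σ i _ hx.1.1]; exact hx.2)
  smooth_mul i j k := by
    refine (((D.smooth_mul i j k).mono ?_).mul ((D'.smooth_mul i j k).mono ?_)).congr ?_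
    · exact fun x hx => ⟨hx.1, hx.2.1.1, hx.2.2.1.1, hx.2.2.2.1⟩
    · exact fun x hx => ⟨hx.1, hx.2.1.2, hx.2.2.1.2, hx.2.2.2.2⟩
    · intro x hx
      have hc : Γ.s (D.π (D.σ i x.1)) = Γ.t (D.π (D.σ j x.2)) := by
        rw [D.π_σ i _ hx.2.1.1, D.π_σ j _ hx.2.2.1.1, hx.1]
      change tensorφ D D' k (tensorMul D D' (tensorσ D D' i x.1) (tensorσ D D' j x.2)) = _
      rw [tensorσ_eq hx.2.1, tensorσ_eq hx.2.2.1, tensorMul_mk _ _ hc]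
      exact tensorφ_mk _ (by
        rw [D.π_mul _ _ hc, D.π_σ i _ hx.2.1.1, D.π_σ j _ hx.2.2.1.1]; exact hx.2.2.2)

end ExtensionData
end

section
variable {EA HA : Type} [NormedAddCommGroup EA] [NormedSpace ℝ EA] [FiniteDimensional ℝ EA]
  [TopologicalSpace HA] {IA : ModelWithCorners ℝ EA HA} [IA.Boundaryless]
  {A : Type} [TopologicalSpace A] [ChartedSpace HA A] [CommGroup A] [LieGroup IA ∞ A]
  {EB HB : Type} [NormedAddCommGroup EB] [NormedSpace ℝ EB] [FiniteDimensional ℝ EB]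
  [TopologicalSpace HB] {IB : ModelWithCorners ℝ EB HB} [IB.Boundaryless]
  {B : Type} [TopologicalSpace B] [ChartedSpace HB B] [CommGroup B] [LieGroup IB ∞ B]
  {M : SmoothMfd.{u}} {Γ : LieGroupoid M}

namespace ExtensionData
variable (D : ExtensionData IA A Γ) (f : A →* B) (hf : ContMDiff IA IB ∞ f)

/-- The relation `(a r, b) ∼ (r, f(a) b)` on `R × B`. -/
def assocSetoid : Setoid (D.P × B) where
  r p q := ∃ a : A, p.1 = D.smul a q.1 ∧ q.2 = f a * p.2
  iseqv :=
    { refl := fun p => ⟨1, by rw [D.one_smul], by simp⟩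
      symm := by
        rintro p q ⟨a, h, h'⟩
        exact ⟨a⁻¹, by rw [h, D.smul_smul, inv_mul_cancel, D.one_smul], by simp [h']⟩
      trans := by
        rintro p q r ⟨a, h, h'⟩ ⟨b, k, k'⟩
        exact ⟨a * b, by rw [h, k, D.smul_smul], by rw [k', h', map_mul]; ac_rfl⟩ }

/-- The class of `(r, b)` in `R ×_A B`. -/
def amk (p : D.P) (b : B) : Quotient (assocSetoid D f) := Quotient.mk _ (p, b)

variable {D f} in
theorem amk_ind {C : Quotient (assocSetoid D f) → Prop} (H : ∀ p b, C (amk D f p b)) :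
    ∀ x, C x := by
  rintro ⟨⟨p, b⟩⟩; exact H p b

theorem amk_smul (a : A) (p : D.P) (b : B) : amk D f (D.smul a p) b = amk D f p (f a * b) :=
  Quotient.sound ⟨a, rfl, rfl⟩

/-- The projection `R ×_A B → Γ`. -/
def assocπ : Quotient (assocSetoid D f) → Γ.arr :=
  Quotient.lift (fun p => D.π p.1) (by rintro p q ⟨a, h, -⟩; rw [h, D.π_smul])

/-- `[r, b]⁻¹ = [r⁻¹, b⁻¹]`. -/
def assocInv : Quotient (assocSetoid D f) → Quotient (assocSetoid D f) :=
  Quotient.map (fun p => (D.inv p.1, p.2⁻¹)) (by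
    rintro p q ⟨a, h, h'⟩
    exact ⟨a⁻¹, by simp only [h, D.inv_smul], by simp [h', mul_comm]⟩)

open Classical in
/-- `[r, b] [r', b'] = [r r', b b']` for composable elements. -/
noncomputable def assocMul : Quotient (assocSetoid D f) → Quotient (assocSetoid D f) →
    Quotient (assocSetoid D f) :=
  Quotient.map₂ (fun p q =>
      if Γ.s (D.π p.1) = Γ.t (D.π q.1) then (D.mul p.1 q.1, p.2 * q.2) else p) (by
    rintro p q ⟨a, h, h'⟩ p' q' ⟨b, k, k'⟩
    have e : (Γ.s (D.π p.1) = Γ.t (D.π p'.1)) =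
        (Γ.s (D.π q.1) = Γ.t (D.π q'.1)) := by rw [h, k, D.π_smul, D.π_smul]
    by_cases hc : Γ.s (D.π q.1) = Γ.t (D.π q'.1)
    · rw [if_pos hc, if_pos (e ▸ hc)]
      refine ⟨a * b, ?_, ?_⟩
      · simp only [h, k]; rw [D.smul_mul_smul _ _ _ _ hc]
      · simp only [h', k', map_mul]; ac_rfl
    · rw [if_neg hc, if_neg (e ▸ hc)]
      exact ⟨a, h, h'⟩)

/-- `c • [r, b] = [r, c b]`. -/
def assocSmul (c : B) : Quotient (assocSetoid D f) → Quotient (assocSetoid D f) :=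
  Quotient.map (fun p => (p.1, c * p.2)) (by
    rintro p q ⟨a, h, h'⟩
    exact ⟨a, h, by simp only [h']; ac_rfl⟩)

variable {D f} in
theorem assocMul_mk {p₁ p₂ : D.P} (b₁ b₂ : B) (h : Γ.s (D.π p₁) = Γ.t (D.π p₂)) :
    assocMul D f (amk D f p₁ b₁) (amk D f p₂ b₂) = amk D f (D.mul p₁ p₂) (b₁ * b₂) :=
  congrArg (Quotient.mk (assocSetoid D f)) (if_pos h)

open Classical in
/-- The fibre coordinate `[r, b] ↦ f (φ r) b`. -/
noncomputable def assocφ (i : Γ.arr) : Quotient (assocSetoid D f) → B :=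
  Quotient.lift (fun p => if D.π p.1 ∈ D.U i then f (D.φ i p.1) * p.2 else 1) (by
    rintro p q ⟨a, h, h'⟩
    have e : D.π p.1 = D.π q.1 := by rw [h, D.π_smul]
    change ite _ _ _ = ite _ _ _
    rw [e]
    by_cases hp : D.π q.1 ∈ D.U i
    · rw [if_pos hp, if_pos hp, h, h', D.φ_smul_eq _ _ hp, map_mul]; ac_rfl
    · rw [if_neg hp, if_neg hp])

variable {D f} in
theorem assocφ_mk {i : Γ.arr} {p : D.P} (b : B) (hp : D.π p ∈ D.U i) :
    assocφ D f i (amk D f p b) = f (D.φ i p) * b :=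
  if_pos hp

/-- Data for the extension `R ×_A B` by `B`. -/
noncomputable def assocExt : ExtensionData IB B Γ where
  P := Quotient (assocSetoid D f)
  π := assocπ D f
  one x := amk D f (D.one x) 1
  inv := assocInv D f
  mul := assocMul D f
  smul := assocSmul D f
  π_one x := D.π_one x
  π_inv := amk_ind fun _ _ => D.π_inv _
  π_mul := amk_ind fun _ _ => amk_ind fun _ _ hc => by
    rw [assocMul_mk _ _ hc]; exact D.π_mul _ _ hc
  π_smul _ := amk_ind fun _ _ => rfl
  one_mul := amk_ind fun p b => by
    refine (assocMul_mk (p₁ := D.one (Γ.t (D.π p))) 1 b (by rw [D.π_one, Γ.s_one])).trans ?_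
    rw [D.one_mul, _root_.one_mul]
  mul_one := amk_ind fun p b => by
    refine (assocMul_mk (p₂ := D.one (Γ.s (D.π p))) b 1 (by rw [D.π_one, Γ.t_one])).trans ?_
    rw [D.mul_one, _root_.mul_one]
  inv_mul := amk_ind fun p b => by
    refine (assocMul_mk (p₁ := D.inv p) b⁻¹ b (by rw [D.π_inv, Γ.s_inv])).trans ?_
    rw [D.inv_mul, inv_mul_cancel]; rfl
  mul_inv := amk_ind fun p b => by
    refine (assocMul_mk (p₂ := D.inv p) b b⁻¹ (by rw [D.π_inv, Γ.t_inv])).trans ?_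
    rw [D.mul_inv, mul_inv_cancel]; rfl
  assoc := amk_ind fun p b => amk_ind fun p' b' => amk_ind fun p'' b'' hc hc' => by
    change Γ.s (D.π p) = Γ.t (D.π p') at hc
    change Γ.s (D.π p') = Γ.t (D.π p'') at hc'
    rw [assocMul_mk _ _ hc, assocMul_mk _ _ hc',
      assocMul_mk _ _ (by rw [D.π_mul _ _ hc, Γ.s_mul _ _ hc, hc']),
      assocMul_mk _ _ (by rw [D.π_mul _ _ hc', Γ.t_mul _ _ hc', hc]), D.assoc _ _ _ hc hc',
      mul_assoc]
  one_smul := amk_ind fun p b => congrArg (amk D f p) (_root_.one_mul b)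
  smul_smul a b := amk_ind fun p c => congrArg (amk D f p) (mul_assoc a b c).symm
  smul_mul_smul a b := amk_ind fun p c => amk_ind fun p' c' hc => by
    change Γ.s (D.π p) = Γ.t (D.π p') at hc
    rw [assocMul_mk _ _ hc]
    refine (assocMul_mk (a * c) (b * c') hc).trans ?_
    rw [mul_mul_mul_comm]; rfl
  U := D.U
  σ i γ := amk D f (D.σ i γ) 1
  φ := assocφ D f
  isOpen_U := D.isOpen_U
  mem_U := D.mem_U
  π_σ := D.π_σ
  φ_smul_σ i γ h a := by
    refine (assocφ_mk (p := D.σ i γ) (a * 1) (by rw [D.π_σ i _ h]; exact h)).trans ?_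
    rw [D.φ_σ i γ h, map_one, _root_.one_mul, _root_.mul_one]
  φ_smul i := amk_ind fun p b hp => by
    change D.π p ∈ D.U i at hp
    rw [assocφ_mk b hp]
    change amk D f (D.σ i (D.π p)) (f (D.φ i p) * b * 1) = _
    conv_rhs => rw [← D.φ_smul i p hp, amk_smul]
    rw [_root_.mul_one]
  smooth_trans i j := by
    refine (hf.comp_contMDiffOn (D.smooth_trans i j)).congr fun x hx => ?_
    refine (assocφ_mk (p := D.σ i x) 1 (by rw [D.π_σ i _ hx.1]; exact hx.2)).trans ?_
    rw [_root_.mul_one]; rfl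
  smooth_one i := by
    refine (hf.comp_contMDiffOn (D.smooth_one i)).congr fun x hx => ?_
    refine (assocφ_mk (p := D.one x) 1 (by rw [D.π_one]; exact hx)).trans ?_
    rw [_root_.mul_one]; rfl
  smooth_inv i j := by
    refine (hf.comp_contMDiffOn (D.smooth_inv i j)).congr fun x hx => ?_
    refine (assocφ_mk (p := D.inv (D.σ i x)) 1⁻¹
      (by rw [D.π_inv, D.π_σ i _ hx.1]; exact hx.2)).trans ?_
    rw [inv_one, _root_.mul_one]; rfl
  smooth_mul i j k := by
    refine (hf.comp_contMDiffOn (D.smooth_mul i j k)).congr fun x hx => ?_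
    have hc : Γ.s (D.π (D.σ i x.1)) = Γ.t (D.π (D.σ j x.2)) := by
      rw [D.π_σ i _ hx.2.1, D.π_σ j _ hx.2.2.1, hx.1]
    rw [assocMul_mk _ _ hc, assocφ_mk _ (by
      rw [D.π_mul _ _ hc, D.π_σ i _ hx.2.1, D.π_σ j _ hx.2.2.1]; exact hx.2.2.2),
      _root_.mul_one, _root_.mul_one]
    rfl

end ExtensionData

namespace CentralExtension

/-- The strictly trivial central extension `Γ × A`. -/
noncomputable def trivial (IA : ModelWithCorners ℝ EA HA) [IA.Boundaryless] (A : Type)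
    [TopologicalSpace A] [ChartedSpace HA A] [CommGroup A] [LieGroup IA ∞ A]
    (Γ : LieGroupoid M) : CentralExtension IA A Γ :=
  (ExtensionData.trivial IA A Γ).toCentralExtension

/-- The tensor product `R ⊗ R' = (R ×_Γ R') / A`, with `(r, r') ∼ (a r, a⁻¹ r')`. -/
noncomputable def tensor (R R' : CentralExtension IA A Γ) : CentralExtension IA A Γ :=
  (R.toData.tensor R'.toData).toCentralExtension

/-- The tensor power `Rⁿ = R ⊗ ⋯ ⊗ R`: the zeroth power is strictly trivial, and
`Rⁿ⁺¹ = Rⁿ ⊗ R`, starting from `R¹ = R`. -/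
noncomputable def pow (R : CentralExtension IA A Γ) : ℕ → CentralExtension IA A Γ
  | 0 => trivial IA A Γ
  | 1 => R
  | n + 2 => (R.pow (n + 1)).tensor R

/-- The extension `R ×_A B` by `B` associated with a smooth homomorphism `f : A → B`, the quotient
of `R × B` by `(a r, b) ∼ (r, f(a) b)`. -/
noncomputable def assocExt (R : CentralExtension IA A Γ) (f : A →* B)
    (hf : ContMDiff IA IB ∞ f) : CentralExtension IB B Γ :=
  (R.toData.assocExt f hf).toCentralExtension

/-- Isomorphisms of central extensions of `Γ` by `A`. -/
structure Iso (R R' : CentralExtension IA A Γ) where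
  toDiffeomorph : Diffeomorph R.R.arr.I R'.R.arr.I R.R.arr R'.R.arr ∞
  map_π : ∀ r, R'.π (toDiffeomorph r) = R.π r
  map_mul : ∀ r r', R.R.s r = R.R.t r' →
    toDiffeomorph (R.R.mul r r') = R'.R.mul (toDiffeomorph r) (toDiffeomorph r')
  map_smul : ∀ a r, toDiffeomorph (R.smul a r) = R'.smul a (toDiffeomorph r)

end CentralExtension
end

section Cover

namespace SmoothMfd
variable (X : SmoothMfd.{u}) {κ : Type u} (W : κ → Opens X)

/-- The underlying set of the disjoint union `∐ W k` of a family of open subsets of `X`: pairs of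
an index and a point of the corresponding open set. -/
@[ext]
structure CoprodType : Type u where
  idx : κ
  val : X
  val_mem : val ∈ W idx

variable {X W} in
/-- The piece containing `q`, identified with an open subset of `X`. -/
noncomputable def coprodChart (q : CoprodType X W) : PartialEquiv (CoprodType X W) X :=
  open Classical in
  { toFun := fun p => p.val
    invFun := fun x => if h : x ∈ W q.idx then ⟨q.idx, x, h⟩ else q
    source := {p | p.idx = q.idx}
    target := W q.idx
    map_source' := fun p hp => (show p.idx = q.idx from hp) ▸ p.val_mem
    map_target' := fun x hx => by
      rw [dif_pos (show x ∈ W q.idx from hx)]; rfl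
    left_inv' := fun p hp => by
      have h : p.val ∈ W q.idx := (show p.idx = q.idx from hp) ▸ p.val_mem
      rw [dif_pos h]
      exact CoprodType.ext (Eq.symm hp) rfl
    right_inv' := fun x hx => by rw [dif_pos (show x ∈ W q.idx from hx)] }

variable {X W} in
theorem coprodChart_symm (q : CoprodType X W) {x : X} (h : x ∈ W q.idx) :
    (coprodChart q).symm x = ⟨q.idx, x, h⟩ := dif_pos h

variable {X W} in
theorem coprodChart_trans_source (p q : CoprodType X W) :
    ((coprodChart p).symm.trans (coprodChart q)).source = {x | x ∈ W p.idx ∧ p.idx = q.idx} := by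
  ext x
  constructor
  · rintro ⟨h, h'⟩
    change (coprodChart p).symm x ∈ (coprodChart q).source at h'
    rw [coprodChart_symm p h] at h'
    exact ⟨h, h'⟩
  · rintro ⟨h, h'⟩
    refine ⟨h, ?_⟩
    change (coprodChart p).symm x ∈ (coprodChart q).source
    rw [coprodChart_symm p h]
    exact h'

variable {X W} in
theorem coprodChart_trans (p q : CoprodType X W) :
    ContMDiffOn X.I X.I ∞ ((coprodChart p).symm.trans (coprodChart q))
      {x | x ∈ W p.idx ∧ p.idx = q.idx} := by
  refine contMDiffOn_id.congr ?_
  rintro x ⟨h, -⟩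
  change ((coprodChart p).symm x).val = x
  rw [coprodChart_symm p h]

/-- The atlas of the disjoint union: each piece is identified with an open subset of `X`. -/
noncomputable def coprodCore : ChartedSpaceCore X (CoprodType X W) where
  atlas := Set.range coprodChart
  chartAt := coprodChart
  mem_chart_source _ := rfl
  chart_mem_atlas p := ⟨p, rfl⟩
  open_source := by
    rintro _ _ ⟨p, rfl⟩ ⟨q, rfl⟩
    rw [coprodChart_trans_source]
    exact (W p.idx).isOpen.inter isOpen_const
  continuousOn_toFun := by
    rintro _ _ ⟨p, rfl⟩ ⟨q, rfl⟩
    rw [coprodChart_trans_source]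
    exact (coprodChart_trans p q).continuousOn

/-- The disjoint union `∐ W k` of a family of open subsets of `X`, as a manifold. -/
noncomputable def coprod : SmoothMfd.{u} :=
  letI := (coprodCore X W).toTopologicalSpace
  letI := (coprodCore X W).toChartedSpace
  comp X (CoprodType X W) (by
    intro e he e' he'
    obtain ⟨_, ⟨p, rfl⟩, rfl⟩ := Set.mem_iUnion₂.1 he
    obtain ⟨_, ⟨q, rfl⟩, rfl⟩ := Set.mem_iUnion₂.1 he'
    have h : (((coprodCore X W).openPartialHomeomorph (coprodChart p) ⟨p, rfl⟩).symm.trans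
        ((coprodCore X W).openPartialHomeomorph (coprodChart q) ⟨q, rfl⟩)).source =
          {x | x ∈ W p.idx ∧ p.idx = q.idx} := coprodChart_trans_source p q
    rw [h]
    exact coprodChart_trans p q)

namespace coprod
variable {X W}

/-- The point `x` of the `k`-th piece. -/
def mk (k : κ) (x : X) (h : x ∈ W k) : X.coprod W := CoprodType.mk k x h

/-- The index of the piece containing a point. -/
def idx (q : X.coprod W) : κ := CoprodType.idx (X := X) (W := W) q

/-- The canonical map `∐ W k → X`. -/
def val (q : X.coprod W) : X := CoprodType.val (X := X) (W := W) q

theorem val_mem (q : X.coprod W) : val q ∈ W (idx q) := CoprodType.val_mem (X := X) (W := W) q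

@[simp] theorem idx_mk (k : κ) (x : X) (h : x ∈ W k) : idx (mk k x h) = k := rfl
@[simp] theorem val_mk (k : κ) (x : X) (h : x ∈ W k) : val (mk k x h) = x := rfl

theorem ext {p q : X.coprod W} (h : idx p = idx q) (h' : val p = val q) : p = q :=
  CoprodType.ext (X := X) (W := W) h h'

theorem isOpen_idx (k : κ) : IsOpen {p : X.coprod W | idx p = k} := by
  by_cases hk : ∃ q : X.coprod W, idx q = k
  · obtain ⟨q, rfl⟩ := hk
    exact (coprodCore X W).open_source' (e := coprodChart (show CoprodType X W from q)) ⟨_, rfl⟩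
  · convert isOpen_empty
    ext p
    simp only [Set.mem_ofPred_eq, Set.mem_empty_iff_false, iff_false]
    exact fun h => hk ⟨p, h⟩

theorem smooth_val : (X.coprod W).Smooth X val := by
  letI := (coprodCore X W).toTopologicalSpace
  letI := (coprodCore X W).toChartedSpace
  intro p
  have h : (X.coprod W).SmoothOn X val {q | idx q = idx p} :=
    comp_chart _ ((coprodCore X W).openPartialHomeomorph
      (coprodChart (show CoprodType X W from p)) ⟨_, rfl⟩) (Set.mem_iUnion₂.2 ⟨_, ⟨_, rfl⟩, rfl⟩)
  exact ContMDiffOn.contMDiffAt h ((isOpen_idx _).mem_nhds rfl)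

open Classical in
theorem smooth_mk (p : X.coprod W) :
    X.SmoothOn (X.coprod W) (fun x => if h : x ∈ W (idx p) then mk (idx p) x h else p)
      (W (idx p)) := by
  letI := (coprodCore X W).toTopologicalSpace
  letI := (coprodCore X W).toChartedSpace
  exact comp_chart_symm _ ((coprodCore X W).openPartialHomeomorph
      (coprodChart (show CoprodType X W from p)) ⟨_, rfl⟩) (Set.mem_iUnion₂.2 ⟨_, ⟨_, rfl⟩, rfl⟩)

variable {EY HY Y : Type*} [NormedAddCommGroup EY] [NormedSpace ℝ EY] [TopologicalSpace HY]
  {IY : ModelWithCorners ℝ EY HY} [TopologicalSpace Y] [ChartedSpace HY Y]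

/-- A map into `∐ W k` is smooth when it is smooth into `X` and its index is locally constant. -/
theorem smooth_into {f : Y → X.coprod W} {S : Set Y} {y : Y} (hy : y ∈ S)
    (hv : ContMDiffWithinAt IY X.I ∞ (fun y => val (f y)) S y)
    (hi : ∀ᶠ z in 𝓝[S] y, idx (f z) = idx (f y)) :
    ContMDiffWithinAt IY (X.coprod W).I ∞ f S y := by
  have h1 := ContMDiffAt.comp_contMDiffWithinAt y
    (ContMDiffOn.contMDiffAt (smooth_mk (f y)) ((W (idx (f y))).isOpen.mem_nhds (val_mem (f y)))) hv
  refine h1.congr_of_eventuallyEq_of_mem ?_ hy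
  filter_upwards [hi] with z hz
  have : val (f z) ∈ W (idx (f y)) := hz ▸ val_mem (f z)
  simp only [Function.comp, dif_pos this]
  exact ext hz rfl

theorem val_mfderiv_surjective (p : X.coprod W) :
    Function.Surjective (mfderiv (X.coprod W).I X.I val p) := by
  classical
  have hn := (W (idx p)).isOpen.mem_nhds (val_mem p)
  have h1 := ContMDiffOn.contMDiffAt (smooth_mk p) hn
  set g : X → X.coprod W := fun x => if h : x ∈ W (idx p) then mk (idx p) x h else p with hg
  have hgp : g (val p) = p := by
    rw [hg]; simp only [dif_pos (val_mem p)]; exact ext rfl rfl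
  have hv : ContMDiff (X.coprod W).I X.I ∞ (val : X.coprod W → X) := smooth_val
  have hc : (val ∘ g) =ᶠ[𝓝 (val p)] id := by
    filter_upwards [hn] with x hx
    simp only [hg, Function.comp, dif_pos (show x ∈ W (idx p) from hx)]; rfl
  have hd := mfderiv_comp (val p) ((hv (g (val p))).mdifferentiableAt (by simp))
    (h1.mdifferentiableAt (by simp))
  rw [hc.mfderiv_eq, mfderiv_id] at hd
  have hs : Function.Surjective (mfderiv (X.coprod W).I X.I val (g (val p))) := fun v =>
    ⟨mfderiv X.I (X.coprod W).I g (val p) v, (DFunLike.congr_fun hd v).symm⟩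
  rw [hgp] at hs
  exact hs

theorem val_mfderiv_injective (p : X.coprod W) :
    Function.Injective (mfderiv (X.coprod W).I X.I val p) := by
  classical
  have hn := (W (idx p)).isOpen.mem_nhds (val_mem p)
  have h1 := ContMDiffOn.contMDiffAt (smooth_mk p) hn
  set g : X → X.coprod W := fun x => if h : x ∈ W (idx p) then mk (idx p) x h else p with hg
  have hv : ContMDiff (X.coprod W).I X.I ∞ (val : X.coprod W → X) := smooth_val
  have hc : (g ∘ val) =ᶠ[𝓝 p] id := by
    filter_upwards [(isOpen_idx (idx p)).mem_nhds rfl] with q hq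
    have : val q ∈ W (idx p) := hq ▸ val_mem q
    simp only [hg, Function.comp, dif_pos this]
    exact ext (Eq.symm hq) rfl
  have hd := mfderiv_comp p (h1.mdifferentiableAt (by simp)) ((hv p).mdifferentiableAt (by simp))
  rw [hc.mfderiv_eq, mfderiv_id] at hd
  intro v w hvw
  have e1 := DFunLike.congr_fun hd v
  have e2 := DFunLike.congr_fun hd w
  have e3 := congrArg (mfderiv X.I (X.coprod W).I g (val p)) hvw
  exact e1.trans (e3.trans e2.symm)

end coprod
end SmoothMfd

open SmoothMfd

namespace LieGroupoid
variable {M : SmoothMfd.{u}} (Γ : LieGroupoid M) {ι : Type u} (U : ι → Opens M)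

theorem continuous_s : Continuous Γ.s := Γ.s_submersion.1.continuous
theorem continuous_t : Continuous Γ.t := Γ.t_submersion.1.continuous

/-- The open set `{g | t g ∈ U i, s g ∈ U j}` of arrows from `U j` to `U i`. -/
def piece (k : ι × ι) : Opens Γ.arr :=
  ⟨{g | Γ.t g ∈ U k.1 ∧ Γ.s g ∈ U k.2},
    ((U k.1).isOpen.preimage Γ.continuous_t).inter ((U k.2).isOpen.preimage Γ.continuous_s)⟩

theorem submersion_of_val {Y Z : SmoothMfd.{u}} {κ : Type u} {V : κ → Opens Y}
    {W : ι → Opens Z} (f : Y.coprod V → Z.coprod W) (g : Y → Z) (hg : Y.Submersion Z g)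
    (hfg : ∀ p, coprod.val (f p) = g (coprod.val p))
    (hi : ∀ p q, coprod.idx p = coprod.idx q → coprod.idx (f p) = coprod.idx (f q)) :
    (Y.coprod V).Submersion (Z.coprod W) f := by
  have hv : ContMDiff (Y.coprod V).I Y.I ∞ (coprod.val : Y.coprod V → Y) := coprod.smooth_val
  have hw : ContMDiff (Z.coprod W).I Z.I ∞ (coprod.val : Z.coprod W → Z) := coprod.smooth_val
  have hf : ContMDiff (Y.coprod V).I (Z.coprod W).I ∞ f := by
    intro p
    refine ContMDiffWithinAt.contMDiffAt (s := Set.univ) ?_ Filter.univ_mem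
    refine coprod.smooth_into (Set.mem_univ _) ?_ ?_
    · simp only [hfg]
      exact (hg.1.comp hv).contMDiffAt.contMDiffWithinAt
    · rw [nhdsWithin_univ]
      filter_upwards [(coprod.isOpen_idx (coprod.idx p)).mem_nhds rfl] with q hq
      exact hi _ _ hq
  refine ⟨hf, fun p v => ?_⟩
  have e : (coprod.val ∘ f) = (g ∘ coprod.val) := funext hfg
  have d1 := mfderiv_comp p ((hw (f p)).mdifferentiableAt (by simp))
    ((hf p).mdifferentiableAt (by simp))
  have d2 := mfderiv_comp p ((hg.1 (coprod.val p)).mdifferentiableAt (by simp))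
    ((hv p).mdifferentiableAt (by simp))
  rw [e, d2] at d1
  obtain ⟨a, ha⟩ := hg.2 (coprod.val p) (mfderiv (Z.coprod W).I Z.I coprod.val (f p) v)
  obtain ⟨b, hb⟩ := coprod.val_mfderiv_surjective p a
  refine ⟨b, coprod.val_mfderiv_injective (f p) ?_⟩
  have h1 := DFunLike.congr_fun d1 b
  refine Eq.trans h1.symm (Eq.trans ?_ ha)
  exact congrArg (mfderiv Y.I Z.I g (coprod.val p)) hb

variable {Γ U} in
theorem val_mul_mem {k l : ι × ι} {g h : Γ.arr} (hg : g ∈ Γ.piece U k) (hh : h ∈ Γ.piece U l)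
    (hc : Γ.s g = Γ.t h) : Γ.mul g h ∈ Γ.piece U (k.1, l.2) :=
  ⟨by rw [Γ.t_mul _ _ hc]; exact hg.1, by rw [Γ.s_mul _ _ hc]; exact hh.2⟩

open Classical in
/-- The multiplication of the pull-back groupoid: `(i, g, j) (j, h, k) = (i, g h, k)`. -/
noncomputable def coverMul (g h : Γ.arr.coprod (Γ.piece U)) : Γ.arr.coprod (Γ.piece U) :=
  if hc : Γ.s (coprod.val g) = Γ.t (coprod.val h) then
    coprod.mk ((coprod.idx g).1, (coprod.idx h).2) (Γ.mul (coprod.val g) (coprod.val h))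
      (val_mul_mem (coprod.val_mem g) (coprod.val_mem h) hc)
  else g

theorem coverMul_eq (g h : Γ.arr.coprod (Γ.piece U))
    (hc : Γ.s (coprod.val g) = Γ.t (coprod.val h)) :
    Γ.coverMul U g h = coprod.mk ((coprod.idx g).1, (coprod.idx h).2)
      (Γ.mul (coprod.val g) (coprod.val h))
      (val_mul_mem (coprod.val_mem g) (coprod.val_mem h) hc) := dif_pos hc

/-- The pull-back groupoid `Γ[U] ⇉ ∐ U i`: its arrows are the triples `(i, g, j)` with
`t g ∈ U i` and `s g ∈ U j`, with `(i, g, j) (j, h, k) = (i, g h, k)`. -/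
noncomputable def cover : LieGroupoid (M.coprod U) where
  arr := Γ.arr.coprod (Γ.piece U)
  s g := coprod.mk (coprod.idx g).2 (Γ.s (coprod.val g)) (coprod.val_mem g).2
  t g := coprod.mk (coprod.idx g).1 (Γ.t (coprod.val g)) (coprod.val_mem g).1
  one x := coprod.mk (coprod.idx x, coprod.idx x) (Γ.one (coprod.val x))
    ⟨by rw [Γ.t_one]; exact coprod.val_mem x, by rw [Γ.s_one]; exact coprod.val_mem x⟩
  inv g := coprod.mk ((coprod.idx g).2, (coprod.idx g).1) (Γ.inv (coprod.val g))
    ⟨by rw [Γ.t_inv]; exact (coprod.val_mem g).2, by rw [Γ.s_inv]; exact (coprod.val_mem g).1⟩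
  mul g h := Γ.coverMul U g h
  s_submersion := submersion_of_val _ Γ.s Γ.s_submersion (fun _ => rfl)
    (fun _ _ h => congrArg Prod.snd h)
  t_submersion := submersion_of_val _ Γ.t Γ.t_submersion (fun _ => rfl)
    (fun _ _ h => congrArg Prod.fst h)
  one_smooth := fun x => by
    have hv : ContMDiff (M.coprod U).I M.I ∞ (coprod.val : M.coprod U → M) := coprod.smooth_val
    have ho : ContMDiff M.I Γ.arr.I ∞ Γ.one := Γ.one_smooth
    refine ContMDiffWithinAt.contMDiffAt (s := Set.univ) ?_ Filter.univ_mem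
    refine coprod.smooth_into (Set.mem_univ _) (ho.comp hv).contMDiffAt.contMDiffWithinAt ?_
    rw [nhdsWithin_univ]
    filter_upwards [(coprod.isOpen_idx (coprod.idx x)).mem_nhds rfl] with y hy
    exact congrArg (fun i => (i, i)) hy
  inv_smooth := fun g => by
    have hv : ContMDiff (Γ.arr.coprod (Γ.piece U)).I Γ.arr.I ∞
      (coprod.val : Γ.arr.coprod (Γ.piece U) → Γ.arr) := coprod.smooth_val
    have ho : ContMDiff Γ.arr.I Γ.arr.I ∞ Γ.inv := Γ.inv_smooth
    refine ContMDiffWithinAt.contMDiffAt (s := Set.univ) ?_ Filter.univ_mem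
    refine coprod.smooth_into (Set.mem_univ _) (ho.comp hv).contMDiffAt.contMDiffWithinAt ?_
    rw [nhdsWithin_univ]
    filter_upwards [(coprod.isOpen_idx (coprod.idx g)).mem_nhds rfl] with y hy
    exact congrArg (fun i : ι × ι => (i.2, i.1)) hy
  mul_smooth := by
    have hv : ContMDiff (Γ.arr.coprod (Γ.piece U)).I Γ.arr.I ∞
      (coprod.val : Γ.arr.coprod (Γ.piece U) → Γ.arr) := coprod.smooth_val
    rintro ⟨g, h⟩ hgh
    have hS : ∀ q : Γ.arr.coprod (Γ.piece U) × Γ.arr.coprod (Γ.piece U),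
        (coprod.mk (coprod.idx q.1).2 (Γ.s (coprod.val q.1)) (coprod.val_mem q.1).2 : M.coprod U) =
        coprod.mk (coprod.idx q.2).1 (Γ.t (coprod.val q.2)) (coprod.val_mem q.2).1 →
        Γ.s (coprod.val q.1) = Γ.t (coprod.val q.2) := fun q hq => congrArg coprod.val hq
    have hm := ContMDiffOn.comp (g := fun q : Γ.arr × Γ.arr => Γ.mul q.1 q.2) Γ.mul_smooth
      (((hv.comp contMDiff_fst).prodMk (hv.comp contMDiff_snd)).contMDiffOn) hS
    refine coprod.smooth_into hgh ?_ ?_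
    · refine (hm _ hgh).congr ?_ ?_
      · intro q hq
        exact congrArg coprod.val (Γ.coverMul_eq U q.1 q.2 (hS q hq))
      · exact congrArg coprod.val (Γ.coverMul_eq U g h (hS _ hgh))
    · have e1 : ∀ᶠ q in 𝓝 (g, h), coprod.idx q.1 = coprod.idx g :=
        ((coprod.isOpen_idx (coprod.idx g)).preimage continuous_fst).mem_nhds rfl
      have e2 : ∀ᶠ q in 𝓝 (g, h), coprod.idx q.2 = coprod.idx h :=
        ((coprod.isOpen_idx (coprod.idx h)).preimage continuous_snd).mem_nhds rfl
      filter_upwards [mem_nhdsWithin_of_mem_nhds e1, mem_nhdsWithin_of_mem_nhds e2,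
        self_mem_nhdsWithin] with q h1 h2 h3
      refine (congrArg coprod.idx (Γ.coverMul_eq U q.1 q.2 (hS q h3))).trans
        (Eq.trans ?_ (congrArg coprod.idx (Γ.coverMul_eq U g h (hS _ hgh))).symm)
      rw [coprod.idx_mk, coprod.idx_mk, h1, h2]
  s_one x := coprod.ext rfl (Γ.s_one _)
  t_one x := coprod.ext rfl (Γ.t_one _)
  s_inv g := coprod.ext rfl (Γ.s_inv _)
  t_inv g := coprod.ext rfl (Γ.t_inv _)
  s_mul g h hc := by
    have hc' : Γ.s (coprod.val g) = Γ.t (coprod.val h) := congrArg coprod.val hc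
    rw [Γ.coverMul_eq U g h hc']
    exact coprod.ext rfl (Γ.s_mul _ _ hc')
  t_mul g h hc := by
    have hc' : Γ.s (coprod.val g) = Γ.t (coprod.val h) := congrArg coprod.val hc
    rw [Γ.coverMul_eq U g h hc']
    exact coprod.ext rfl (Γ.t_mul _ _ hc')
  one_mul g := Eq.trans (Γ.coverMul_eq U _ g (by exact Γ.s_one _))
    (coprod.ext rfl (Γ.one_mul _))
  mul_one g := Eq.trans (Γ.coverMul_eq U g _ (by exact (Γ.t_one _).symm))
    (coprod.ext rfl (Γ.mul_one _))
  inv_mul g := Eq.trans (Γ.coverMul_eq U _ g (by exact Γ.s_inv _))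
    (coprod.ext rfl (Γ.inv_mul _))
  mul_inv g := Eq.trans (Γ.coverMul_eq U g _ (by exact (Γ.t_inv _).symm))
    (coprod.ext rfl (Γ.mul_inv _))
  assoc g h k hc hc' := by
    have e : Γ.s (coprod.val g) = Γ.t (coprod.val h) := congrArg coprod.val hc
    have e' : Γ.s (coprod.val h) = Γ.t (coprod.val k) := congrArg coprod.val hc'
    rw [Γ.coverMul_eq U g h e, Γ.coverMul_eq U h k e']
    refine Eq.trans (Γ.coverMul_eq U _ k ?_)
      (Eq.trans ?_ (Γ.coverMul_eq U g _ ?_).symm)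
    · exact (Γ.s_mul _ _ e).trans e'
    · exact coprod.ext rfl (Γ.assoc _ _ _ e e')
    · exact e.trans (Γ.t_mul _ _ e').symm

end LieGroupoid

namespace CentralExtension
variable {EA HA : Type} [NormedAddCommGroup EA] [NormedSpace ℝ EA] [FiniteDimensional ℝ EA]
  [TopologicalSpace HA] {IA : ModelWithCorners ℝ EA HA} [IA.Boundaryless]
  {A : Type} [TopologicalSpace A] [ChartedSpace HA A] [CommGroup A] [LieGroup IA ∞ A]
  {M : SmoothMfd.{u}} {Γ : LieGroupoid M} (R : CentralExtension IA A Γ)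
  {ι : Type u} (U : ι → Opens M)

variable {R U} in
theorem mem_piece_of_π {k : ι × ι} {r : R.R.arr} {γ : Γ.arr} (h : R.π r = γ)
    (hγ : γ ∈ Γ.piece U k) : r ∈ R.R.piece U k := by
  subst h
  exact ⟨by rw [← R.t_π]; exact hγ.1, by rw [← R.s_π]; exact hγ.2⟩

theorem smooth_smul : ContMDiff (R.R.arr.I.prod IA) R.R.arr.I ∞
    (fun q : R.R.arr × A => R.smul q.2 q.1) := R.principal.smooth_act

/-- The underlying projection of `R[U] → Γ[U]`. -/
noncomputable def coverπ (r : (R.R.cover U).arr) : (Γ.cover U).arr :=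
  coprod.mk (coprod.idx r) (R.π (coprod.val r))
    ⟨by rw [R.t_π]; exact (coprod.val_mem r).1, by rw [R.s_π]; exact (coprod.val_mem r).2⟩

/-- The action of `A` on `R[U]`. -/
noncomputable def coverSmul (a : A) (r : (R.R.cover U).arr) : (R.R.cover U).arr :=
  coprod.mk (coprod.idx r) (R.smul a (coprod.val r))
    ⟨by rw [R.t_smul]; exact (coprod.val_mem r).1, by rw [R.s_smul]; exact (coprod.val_mem r).2⟩

/-- The pull-back extension `R[U] → Γ[U]`. -/
noncomputable def cover : CentralExtension IA A (Γ.cover U) where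
  R := R.R.cover U
  π := R.coverπ U
  smul := R.coverSmul U
  s_π r := coprod.ext rfl (R.s_π _)
  t_π r := coprod.ext rfl (R.t_π _)
  π_mul r r' hc := by
    have e : R.R.s (coprod.val r) = R.R.t (coprod.val r') := congrArg coprod.val hc
    have e' : Γ.s (R.π (coprod.val r)) = Γ.t (R.π (coprod.val r')) := by
      rw [R.s_π, R.t_π, e]
    have h1 : (R.R.cover U).mul r r' = coprod.mk ((coprod.idx r).1, (coprod.idx r').2)
      (R.R.mul (coprod.val r) (coprod.val r'))
        (LieGroupoid.val_mul_mem (coprod.val_mem r) (coprod.val_mem r') e) := R.R.coverMul_eq U r r' e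
    rw [h1]
    refine Eq.trans ?_ (Γ.coverMul_eq U (R.coverπ U r) (R.coverπ U r') e').symm
    exact coprod.ext rfl (R.π_mul _ _ e)
  smul_mul_smul a b r r' hc := by
    have e : R.R.s (coprod.val r) = R.R.t (coprod.val r') := congrArg coprod.val hc
    have h1 : (R.R.cover U).mul r r' = coprod.mk ((coprod.idx r).1, (coprod.idx r').2)
      (R.R.mul (coprod.val r) (coprod.val r'))
        (LieGroupoid.val_mul_mem (coprod.val_mem r) (coprod.val_mem r') e) := R.R.coverMul_eq U r r' e
    rw [h1]
    refine (R.R.coverMul_eq U _ _ (by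
      change R.R.s (R.smul a (coprod.val r)) = R.R.t (R.smul b (coprod.val r'))
      rw [R.s_smul, R.t_smul, e])).trans ?_
    exact coprod.ext rfl (R.smul_mul_smul a b _ _ e)
  principal := by
    have hv : ContMDiff (R.R.arr.coprod (R.R.piece U)).I R.R.arr.I ∞
      (coprod.val : R.R.arr.coprod (R.R.piece U) → R.R.arr) := coprod.smooth_val
    have hw : ContMDiff (Γ.arr.coprod (Γ.piece U)).I Γ.arr.I ∞
      (coprod.val : Γ.arr.coprod (Γ.piece U) → Γ.arr) := coprod.smooth_val
    have hπ : ContMDiff R.R.arr.I Γ.arr.I ∞ R.π := R.principal.smooth_proj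
    refine ⟨fun r => ?_, ?_, fun r => coprod.ext rfl (R.one_smul _),
      fun r a b => coprod.ext rfl (R.principal.act_mul _ a b),
      fun r a => coprod.ext rfl (R.π_smul _ _), fun γ => ?_⟩
    · refine ContMDiffWithinAt.contMDiffAt (s := Set.univ) ?_ Filter.univ_mem
      refine coprod.smooth_into (Set.mem_univ _) (hπ.comp hv).contMDiffAt.contMDiffWithinAt ?_
      rw [nhdsWithin_univ]
      filter_upwards [(coprod.isOpen_idx (coprod.idx r)).mem_nhds rfl] with y hy
      exact hy
    · rintro ⟨r, a⟩
      refine ContMDiffWithinAt.contMDiffAt (s := Set.univ) ?_ Filter.univ_mem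
      refine coprod.smooth_into (Set.mem_univ _) (R.smooth_smul.comp
        ((hv.comp contMDiff_fst).prodMk contMDiff_snd)).contMDiffAt.contMDiffWithinAt ?_
      rw [nhdsWithin_univ]
      filter_upwards [((coprod.isOpen_idx (coprod.idx r)).preimage continuous_fst).mem_nhds
        (x := (r, a)) rfl] with y hy
      exact hy
    · classical
      obtain ⟨V, hV, hγ, σ, φ, hσ, hφ, h1, h2, h3⟩ :=
        R.principal.locally_trivial (coprod.val γ)
      let c := mem_piece_of_π (h1 _ hγ) (coprod.val_mem γ)
      let σ' : (Γ.cover U).arr → (R.R.cover U).arr := fun x =>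
        if h : σ (coprod.val x) ∈ R.R.piece U (coprod.idx x) then
          coprod.mk (coprod.idx x) (σ (coprod.val x)) h
        else coprod.mk (coprod.idx γ) (σ (coprod.val γ)) c
      have hσ' : ∀ x, coprod.val x ∈ V →
          ∃ h, σ' x = coprod.mk (coprod.idx x) (σ (coprod.val x)) h := fun x hx =>
        have h := mem_piece_of_π (h1 _ hx) (coprod.val_mem x)
        ⟨h, dif_pos h⟩
      refine ⟨coprod.val ⁻¹' V, hV.preimage hw.continuous, hγ, σ',
        fun r => φ (coprod.val r), ?_, ?_, ?_, ?_, ?_⟩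
      · intro x hx
        refine coprod.smooth_into hx ?_ ?_
        · have : ∀ y ∈ (coprod.val ⁻¹' V : Set (Γ.cover U).arr),
              coprod.val (σ' y) = σ (coprod.val y) := fun y hy => by
            obtain ⟨_, e⟩ := hσ' y hy
            rw [e]; rfl
          exact ((hσ.comp hw.contMDiffOn (fun _ h => h)) x hx).congr this (this x hx)
        · filter_upwards [mem_nhdsWithin_of_mem_nhds
            ((coprod.isOpen_idx (coprod.idx x)).mem_nhds rfl), self_mem_nhdsWithin] with y hy hy'
          obtain ⟨_, e⟩ := hσ' y hy'
          obtain ⟨_, e'⟩ := hσ' x hx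
          rw [e, e']
          exact hy
      · exact hφ.comp hv.contMDiffOn (fun _ h => h)
      · intro x hx
        obtain ⟨_, e⟩ := hσ' x hx
        rw [e]
        exact coprod.ext rfl (h1 _ hx)
      · intro x hx a
        obtain ⟨_, e⟩ := hσ' x hx
        rw [e]
        exact h2 _ hx a
      · intro r hr
        obtain ⟨_, e⟩ := hσ' _ hr
        rw [e]
        exact coprod.ext rfl (h3 _ hr)

end CentralExtension
end Cover

section Groups

/-- The general linear group of `ℂⁿ`: the invertible linear operators on `ℂⁿ`. -/
abbrev GLn (n : ℕ) : Type := ((Fin n → ℂ) →L[ℂ] (Fin n → ℂ))ˣ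

/-- The inclusion of `S¹` in the general linear group as unitary scalars. -/
noncomputable def scalarGLn (n : ℕ) : Circle →* GLn n :=
  (Units.map (algebraMap ℂ ((Fin n → ℂ) →L[ℂ] (Fin n → ℂ))).toMonoidHom).comp Circle.toUnits

/-- The group of `n`-th roots of unity in `S¹`. -/
noncomputable abbrev MuN (n : ℕ) : Subgroup Circle := (powMonoidHom n : Circle →* Circle).ker

instance (n : ℕ) [NeZero n] : Finite (MuN n) := by
  let f : MuN n → rootsOfUnity n ℂ := fun z => ⟨Circle.toUnits z.1, by
    rw [mem_rootsOfUnity, ← map_pow]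
    have h : (z.1 : Circle) ^ n = 1 := z.2
    rw [h, map_one]⟩
  refine Finite.of_injective f fun z w h => ?_
  have h1 : Circle.toUnits z.1 = Circle.toUnits w.1 := congrArg Subtype.val h
  exact Subtype.ext (Circle.ext (congrArg Units.val h1))

instance (n : ℕ) [NeZero n] : DiscreteTopology (MuN n) := inferInstance

/-- The group of `n`-th roots of unity, as a discrete (zero-dimensional) Lie group. -/
noncomputable instance (n : ℕ) [NeZero n] : ChartedSpace (EuclideanSpace ℝ (Fin 0)) (MuN n) :=
  ChartedSpace.ofDiscreteTopology

instance (n : ℕ) [NeZero n] : LieGroup (𝓡 0) ∞ (MuN n) where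
  toIsManifold := IsManifold.of_discreteTopology _
  contMDiff_mul := contMDiff_of_discreteTopology
  contMDiff_inv := contMDiff_of_discreteTopology

theorem contMDiff_MuN_subtype (n : ℕ) [NeZero n] :
    ContMDiff (𝓡 0) (𝓡 1) ∞ (MuN n).subtype := contMDiff_of_discreteTopology

end Groups

section GeneralizedHomomorphisms

/-- A generalized homomorphism from the Lie groupoid `Γ ⇉ M` to the Lie group `G`: a smooth locally
trivial principal `G`-bundle `τ : Z → M` with a left action of `Γ` commuting with the right action
of `G`.  The element `γ · z` is `lact γ z`, which is relevant only for `s γ = τ z`. -/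
structure GenHom {M : SmoothMfd.{u}} (Γ : LieGroupoid M)
    {EG HG : Type} [NormedAddCommGroup EG] [NormedSpace ℝ EG] [TopologicalSpace HG]
    (IG : ModelWithCorners ℝ EG HG) (G : Type) [TopologicalSpace G] [ChartedSpace HG G]
    [Group G] : Type (u + 1) where
  Z : SmoothMfd.{u}
  τ : Z → M
  lact : Γ.arr → Z → Z
  ract : Z → G → Z
  principal : IsPrincipalBundle IG G Z M τ ract
  lact_smooth : SmoothMfd.SmoothOn₂ Γ.arr Z Z (fun γ z => Γ.s γ = τ z) lact
  τ_lact : ∀ γ z, Γ.s γ = τ z → τ (lact γ z) = Γ.t γ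
  one_lact : ∀ z, lact (Γ.one (τ z)) z = z
  mul_lact : ∀ γ δ z, Γ.s γ = Γ.t δ → Γ.s δ = τ z →
    lact (Γ.mul γ δ) z = lact γ (lact δ z)
  lact_ract : ∀ γ z g, Γ.s γ = τ z → ract (lact γ z) g = lact γ (ract z g)

/-- An `S¹`-equivariant generalized homomorphism from the `S¹`-central extension `R` to the Lie
group `G`, on which `S¹` acts through the homomorphism `j : S¹ → G`: the space `Z` carries an
`S¹`-action over `M` such that `(λ r) · z · g = r · (λ z) · g = r · z · (λ g)`. -/
structure EquivariantGenHom {M : SmoothMfd.{u}} {Γ : LieGroupoid M}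
    (R : CentralExtension (𝓡 1) Circle Γ)
    {EG HG : Type} [NormedAddCommGroup EG] [NormedSpace ℝ EG] [TopologicalSpace HG]
    (IG : ModelWithCorners ℝ EG HG) (G : Type) [TopologicalSpace G] [ChartedSpace HG G]
    [Group G] (j : Circle →* G) extends GenHom R.R IG G where
  csmul : Circle → Z → Z
  csmul_smooth : ContMDiff ((𝓡 1).prod Z.I) Z.I ∞ (fun q : Circle × Z => csmul q.1 q.2)
  one_csmul : ∀ z, csmul 1 z = z
  mul_csmul : ∀ a b z, csmul (a * b) z = csmul a (csmul b z)
  τ_csmul : ∀ a z, τ (csmul a z) = τ z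
  smul_lact_ract : ∀ a r z g, R.R.s r = τ z →
    ract (lact (R.smul a r) z) g = ract (lact r (csmul a z)) g
  lact_csmul_ract : ∀ a r z g, R.R.s r = τ z →
    ract (lact r (csmul a z)) g = ract (lact r z) (j a * g)

namespace CentralExtension
variable {M : SmoothMfd.{u}} {Γ : LieGroupoid M} (R : CentralExtension (𝓡 1) Circle Γ)

/-- An `S¹`-central extension `R` is trivial if there is an `S¹`-equivariant generalized
homomorphism from `R` to `S¹`. -/
def IsTrivial : Prop := Nonempty (EquivariantGenHom R (𝓡 1) Circle (MonoidHom.id Circle))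

/-- An `S¹`-central extension is torsion if one of its powers of positive exponent is trivial. -/
def IsTorsion : Prop := ∃ m : ℕ, 0 < m ∧ (R.pow m).IsTrivial

/-- There are an open cover `(U i)` of `M` and a smooth groupoid homomorphism
`ψ : R[U] → ℂˣ` with `ψ (λ r) = λⁿ ψ r`. -/
def HasPowerCharacter (n : ℕ) : Prop :=
  ∃ (ι : Type u) (U : ι → Opens M), (∀ x, ∃ i, x ∈ U i) ∧
    ∃ ψ : (R.cover U).R.arr → ℂˣ,
      ContMDiff (R.cover U).R.arr.I 𝓘(ℝ, ℂ) ∞ ψ ∧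
      (∀ r r', (R.cover U).R.s r = (R.cover U).R.t r' →
        ψ ((R.cover U).R.mul r r') = ψ r * ψ r') ∧
      ∀ a r, ψ ((R.cover U).smul a r) = Circle.toUnits a ^ n * ψ r

/-- There are an open cover `(U i)` of `M` and a central extension `R'` of `Γ[U]` by the group
`μ_n` of `n`-th roots of unity such that `R[U]` is isomorphic to `R' ×_{μ_n} S¹`. -/
def LocallyFromRootsOfUnity (n : ℕ) [NeZero n] : Prop :=
  ∃ (ι : Type u) (U : ι → Opens M), (∀ x, ∃ i, x ∈ U i) ∧
    ∃ R' : CentralExtension (𝓡 0) (MuN n) (Γ.cover U),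
      Nonempty (Iso (R'.assocExt (MuN n).subtype (contMDiff_MuN_subtype n)) (R.cover U))

end CentralExtension
end GeneralizedHomomorphisms

section TwistedVectorBundles
open Bundle

/-- Scalar multiplication in the fibres of a family of complex vector spaces. -/
def fiberSmul {B F : Type*} {E : B → Type*} [∀ x, AddCommGroup (E x)] [∀ x, Module ℂ (E x)]
    (c : ℂ) (e : TotalSpace F E) : TotalSpace F E := ⟨e.proj, c • e.2⟩

/-- A twisted vector bundle of rank `n`: a smooth complex vector bundle `E → M` of rank `n` with a
fibrewise linear smooth left action of the groupoid `R` on which `S¹` acts by scalars, that is,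
`(λ r) · e = λ (r · e)`.  The element `r · e` is `act r e`, which is relevant only when `s r` is the
base point of `e`. -/
structure TwistedVectorBundle {M : SmoothMfd.{u}} {Γ : LieGroupoid M}
    (R : CentralExtension (𝓡 1) Circle Γ) (n : ℕ) where
  E : M → Type
  [addCommGroup : ∀ x, AddCommGroup (E x)]
  [module : ∀ x, Module ℂ (E x)]
  [topE : ∀ x, TopologicalSpace (E x)]
  [topTotal : TopologicalSpace (TotalSpace (Fin n → ℂ) E)]
  [fiberBundle : FiberBundle (Fin n → ℂ) E]
  [vectorBundle : VectorBundle ℂ (Fin n → ℂ) E]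
  /-- The transition functions are smooth. -/
  smooth_coordChange : ∀ (e e' : Trivialization (Fin n → ℂ) (π (Fin n → ℂ) E))
    [MemTrivializationAtlas e] [MemTrivializationAtlas e'],
    ContMDiffOn M.I 𝓘(ℝ, (Fin n → ℂ) →L[ℂ] (Fin n → ℂ)) ∞
      (fun x => (e.coordChangeL ℂ e' x : (Fin n → ℂ) →L[ℂ] (Fin n → ℂ)))
      (e.baseSet ∩ e'.baseSet)
  act : R.R.arr → TotalSpace (Fin n → ℂ) E → TotalSpace (Fin n → ℂ) E
  act_smooth : ContMDiffOn (R.R.arr.I.prod (M.I.prod 𝓘(ℝ, Fin n → ℂ)))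
    (M.I.prod 𝓘(ℝ, Fin n → ℂ)) ∞
    (fun q : R.R.arr × TotalSpace (Fin n → ℂ) E => act q.1 q.2) {q | R.R.s q.1 = q.2.proj}
  /-- Each `r` acts as a linear map from the fibre over `s r` to the fibre over `t r`. -/
  act_linear : ∀ r, ∃ L : E (R.R.s r) →ₗ[ℂ] E (R.R.t r),
    ∀ v, act r ⟨R.R.s r, v⟩ = ⟨R.R.t r, L v⟩
  one_act : ∀ e, act (R.R.one e.proj) e = e
  mul_act : ∀ r r' e, R.R.s r = R.R.t r' → R.R.s r' = e.proj →
    act (R.R.mul r r') e = act r (act r' e)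
  smul_act : ∀ (a : Circle) r e, R.R.s r = e.proj →
    act (R.smul a r) e = fiberSmul (a : ℂ) (act r e)

end TwistedVectorBundles

/-! All the properties are translated into one notion. Fix a Lie group `G` and a homomorphism `j :
S¹ → G`. A local character of `R` in `G` is an open cover `(U i)` with smooth maps `χ i k` to `G`,
defined on the arrows of `R` from `U k` to `U i`, such that `χ i l (r r') = χ i k (r) χ k l (r')`
and `χ i k (λ r) = j(λ) χ i k (r)`. Its values on the unit arrows form a cocycle, hence a bundle on
`M`; its values on the other arrows are an action of `R` on that bundle, written in local
coordinates.

For central `j(S¹)`, an equivariant generalized homomorphism to `G` is therefore the same as a local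
character in `G` (`nonempty_equivariantGenHom_iff`): local sections of the bundle give `χ`, and
gluing by the cocycle recovers the bundle. Replacing the principal bundle by a vector bundle gives
the same statement for twisted vector bundles and `G = GL_n` (`nonempty_twistedVectorBundle_iff`).
This is (i) ⇔ (ii). The determinant turns a character in `GL_n` with `j` the scalars into a
character in `ℂˣ` with `j(λ) = λⁿ`, which is (iii). The retraction `z ↦ z / |z|` shows that (iii)
may be stated with values in `S¹` (`hasPowerCharacter_iff_circle`). So it remains to compare (iv)
and (v) with the existence of a local character of weight `n` in `S¹`.

For (iv), the map `r ↦ r ⊗ ⋯ ⊗ r` from `R` to `Rⁿ` is multiplicative, covers the identity of `Γ` and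
has weight `n`. Every element of `Rⁿ` is a unique scalar times the image of any given element of `R`
over the same arrow. So characters of weight one on `Rⁿ`, which are its trivializations, restrict to
characters of weight `n` on `R`, and each of the latter extends uniquely by equivariance
(`hasLocalCharacter_pow_iff`).

For (v), the kernel of a character `ψ` of weight `n` on `R[U]` is an extension `R'` by `μ_n`: it has
local sections because `S¹` has smooth local `n`-th roots. The map `[r, λ] ↦ λ r` identifies `R'
×_{μ_n} S¹` with `R[U]`. Conversely `[r, λ] ↦ λⁿ` is a character of weight `n` on any such extension
(`locallyFromRootsOfUnity_iff`). Torsion follows from (iv), with exponent `n`. -/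

open SmoothMfd

/-! ### Local characters, and characters of the pull-back extension `R[U]`. -/

section LocalCharacters

variable {EG HG : Type} [NormedAddCommGroup EG] [NormedSpace ℝ EG] [TopologicalSpace HG]
  {IG : ModelWithCorners ℝ EG HG} {G : Type} [TopologicalSpace G] [ChartedSpace HG G] [Group G]
  {EK HK : Type} [NormedAddCommGroup EK] [NormedSpace ℝ EK] [TopologicalSpace HK]
  {IK : ModelWithCorners ℝ EK HK} {K : Type} [TopologicalSpace K] [ChartedSpace HK K] [Group K]
  {M : SmoothMfd.{u}} {Γ : LieGroupoid M}

/-- A smooth multiplicative map from `R[U]` to the group `G` that is equivariant with respect to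
`j : S¹ → G`, given by its restrictions to the open sets of arrows from `U k` to `U i`. -/
structure LocalCharacter (R : CentralExtension (𝓡 1) Circle Γ) (IG : ModelWithCorners ℝ EG HG)
    (j : Circle →* G) {ι : Type u} (U : ι → Opens M) where
  toFun : ι → ι → R.R.arr → G
  smooth : ∀ i k, ContMDiffOn R.R.arr.I IG ∞ (toFun i k) (R.R.piece U (i, k))
  map_mul : ∀ i k l r r', r ∈ R.R.piece U (i, k) → r' ∈ R.R.piece U (k, l) →
    R.R.s r = R.R.t r' → toFun i l (R.R.mul r r') = toFun i k r * toFun k l r'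
  map_smul : ∀ a i k r, r ∈ R.R.piece U (i, k) → toFun i k (R.smul a r) = j a * toFun i k r

/-- There are an open cover of `M` and a local character with respect to it. -/
def HasLocalCharacter (R : CentralExtension (𝓡 1) Circle Γ) (IG : ModelWithCorners ℝ EG HG)
    (j : Circle →* G) : Prop :=
  ∃ (ι : Type u) (U : ι → Opens M), (∀ x, ∃ i, x ∈ U i) ∧ Nonempty (LocalCharacter R IG j U)

/-- Units over an overlap are arrows from `U k` to `U i`, and the values of a local character there
serve as transition functions. -/
theorem LieGroupoid.one_mem_piece (Γ : LieGroupoid M) {ι : Type u} {U : ι → Opens M} {i k : ι}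
    {x : M} (hi : x ∈ U i) (hk : x ∈ U k) : Γ.one x ∈ Γ.piece U (i, k) :=
  ⟨by rw [Γ.t_one]; exact hi, by rw [Γ.s_one]; exact hk⟩

theorem LieGroupoid.inv_mem_piece (Γ : LieGroupoid M) {ι : Type u} {U : ι → Opens M} {i k : ι}
    {g : Γ.arr} (hg : g ∈ Γ.piece U (i, k)) : Γ.inv g ∈ Γ.piece U (k, i) :=
  ⟨by rw [Γ.t_inv]; exact hg.2, by rw [Γ.s_inv]; exact hg.1⟩

theorem CentralExtension.smul_mem_piece (R : CentralExtension (𝓡 1) Circle Γ) {ι : Type u}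
    {U : ι → Opens M} {k : ι × ι} {r : R.R.arr} (a : Circle) (hr : r ∈ R.R.piece U k) :
    R.smul a r ∈ R.R.piece U k :=
  ⟨by rw [R.t_smul]; exact hr.1, by rw [R.s_smul]; exact hr.2⟩

namespace LocalCharacter

variable {R : CentralExtension (𝓡 1) Circle Γ} {j : Circle →* G} {ι : Type u} {U : ι → Opens M}

/-- The composition of a local character with a smooth homomorphism of groups. -/
def map (χ : LocalCharacter R IG j U) (f : G →* K) (hf : ContMDiff IG IK ∞ f)
    (j' : Circle →* K) (hj : ∀ a, f (j a) = j' a) : LocalCharacter R IK j' U where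
  toFun i k r := f (χ.toFun i k r)
  smooth i k := hf.comp_contMDiffOn (χ.smooth i k)
  map_mul i k l r r' hr hr' hc := by rw [χ.map_mul i k l r r' hr hr' hc, _root_.map_mul]
  map_smul a i k r hr := by rw [χ.map_smul a i k r hr, _root_.map_mul, hj]

theorem map_one (χ : LocalCharacter R IG j U) {i : ι} {x : M} (hi : x ∈ U i) :
    χ.toFun i i (R.R.one x) = 1 := by
  have h := χ.map_mul i i i (R.R.one x) (R.R.one x) (R.R.one_mem_piece hi hi)
    (R.R.one_mem_piece hi hi) (by rw [R.R.s_one, R.R.t_one])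
  have e := R.R.one_mul (R.R.one x)
  rw [R.R.t_one] at e
  rw [e] at h
  exact left_eq_mul.1 h

end LocalCharacter

theorem HasLocalCharacter.map {R : CentralExtension (𝓡 1) Circle Γ} {j : Circle →* G}
    (h : HasLocalCharacter R IG j) (f : G →* K) (hf : ContMDiff IG IK ∞ f)
    (j' : Circle →* K) (hj : ∀ a, f (j a) = j' a) : HasLocalCharacter R IK j' := by
  obtain ⟨ι, U, hU, ⟨χ⟩⟩ := h
  exact ⟨ι, U, hU, ⟨χ.map f hf j' hj⟩⟩

/-- A smooth multiplicative map on `R` that is equivariant with respect to `j : S¹ → G`. -/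
structure IsCharacter (R : CentralExtension (𝓡 1) Circle Γ) (IG : ModelWithCorners ℝ EG HG)
    (j : Circle →* G) (ψ : R.R.arr → G) : Prop where
  smooth : ContMDiff R.R.arr.I IG ∞ ψ
  map_mul : ∀ r r', R.R.s r = R.R.t r' → ψ (R.R.mul r r') = ψ r * ψ r'
  map_smul : ∀ a r, ψ (R.smul a r) = j a * ψ r

namespace IsCharacter
variable {R : CentralExtension (𝓡 1) Circle Γ} {j : Circle →* G} {ψ : R.R.arr → G}
  (h : IsCharacter R IG j ψ)
include h

theorem map_one (x : M) : ψ (R.R.one x) = 1 := by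
  have h := h.map_mul (R.R.one x) (R.R.one x) (by rw [R.R.s_one, R.R.t_one])
  have e := R.R.one_mul (R.R.one x)
  rw [R.R.t_one] at e
  rw [e] at h
  exact left_eq_mul.1 h

theorem map_inv (r : R.R.arr) : ψ (R.R.inv r) = (ψ r)⁻¹ := by
  have h1 := h.map_mul (R.R.inv r) r (R.R.s_inv r)
  rw [R.R.inv_mul, h.map_one] at h1
  exact eq_inv_of_mul_eq_one_left h1.symm

end IsCharacter

-- The arrows of `R[U]` are the disjoint union of the pieces, so smoothness is checked piece by
-- piece, and composability in `R[U]` already forces the two middle indices to agree.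
open Classical in
theorem hasLocalCharacter_iff (R : CentralExtension (𝓡 1) Circle Γ) (j : Circle →* G) :
    HasLocalCharacter R IG j ↔ ∃ (ι : Type u) (U : ι → Opens M), (∀ x, ∃ i, x ∈ U i) ∧
      ∃ ψ : (R.cover U).R.arr → G, IsCharacter (R.cover U) IG j ψ := by
  refine exists_congr fun ι => exists_congr fun U => and_congr_right fun _ => ⟨?_, ?_⟩
  · rintro ⟨χ⟩
    have hv : ContMDiff (R.R.arr.coprod (R.R.piece U)).I R.R.arr.I ∞
      (coprod.val : R.R.arr.coprod (R.R.piece U) → R.R.arr) := coprod.smooth_val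
    let ψ : R.R.arr.coprod (R.R.piece U) → G :=
      fun r => χ.toFun (coprod.idx r).1 (coprod.idx r).2 (coprod.val r)
    have h1 : ContMDiff (R.R.arr.coprod (R.R.piece U)).I IG ∞ ψ := fun r => by
      have h1 := ((χ.smooth (coprod.idx r).1 (coprod.idx r).2).contMDiffAt
        ((R.R.piece U (coprod.idx r)).isOpen.mem_nhds (coprod.val_mem r))).comp r (hv r)
      refine h1.congr_of_eventuallyEq ?_
      filter_upwards [(coprod.isOpen_idx (coprod.idx r)).mem_nhds rfl] with q hq
      simp only [ψ, show coprod.idx q = coprod.idx r from hq]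
      rfl
    have h2 : ∀ r r' : R.R.arr.coprod (R.R.piece U), R.R.s (coprod.val r) = R.R.t (coprod.val r') →
        (coprod.idx r).2 = (coprod.idx r').1 → ψ (R.R.coverMul U r r') = ψ r * ψ r' := by
      intro r r' e e'
      rw [R.R.coverMul_eq U r r' e]
      refine (χ.map_mul _ (coprod.idx r).2 _ _ _ (coprod.val_mem r) ?_ e).trans ?_
      · rw [e']; exact coprod.val_mem r'
      · simp only [ψ, e']
        rfl
    exact ⟨ψ, h1, fun r r' hc => h2 r r' (congrArg coprod.val hc) (congrArg coprod.idx hc),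
      fun a r => χ.map_smul _ _ _ _ (coprod.val_mem r)⟩
  · rintro ⟨ψ', hψ⟩
    let ψ : R.R.arr.coprod (R.R.piece U) → G := ψ'
    have h1 : ContMDiff (R.R.arr.coprod (R.R.piece U)).I IG ∞ ψ := hψ.smooth
    let χ : ι → ι → R.R.arr → G := fun i k r =>
      if h : r ∈ R.R.piece U (i, k) then ψ (coprod.mk (i, k) r h) else 1
    have hχ : ∀ {i k r} (h : r ∈ R.R.piece U (i, k)), χ i k r = ψ (coprod.mk (i, k) r h) :=
      fun h => dif_pos h
    refine ⟨χ, fun i k r hr => ?_, fun i k l r r' hr hr' hc => ?_, fun a i k r hr => ?_⟩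
    -- Smoothness of the inclusion of a piece in the disjoint union is stated relative to a point of
    -- that piece, which `r` itself supplies.
    · let r0 : R.R.arr.coprod (R.R.piece U) := coprod.mk (i, k) r hr
      have h2 := ContMDiffAt.comp_contMDiffWithinAt r (h1 _) ((coprod.smooth_mk r0) r hr)
      refine h2.congr ?_ ?_
      · intro y hy
        rw [hχ hy]
        exact congrArg ψ (dif_pos hy).symm
      · rw [hχ hr]
        exact congrArg ψ (dif_pos hr).symm
    · rw [hχ hr, hχ hr', hχ (LieGroupoid.val_mul_mem hr hr' hc)]
      refine Eq.trans ?_ (hψ.map_mul (coprod.mk (i, k) r hr) (coprod.mk (k, l) r' hr')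
        (coprod.ext rfl hc))
      exact congrArg ψ (R.R.coverMul_eq U (coprod.mk (i, k) r hr) (coprod.mk (k, l) r' hr')
          hc).symm
    · rw [hχ hr, hχ (R.smul_mem_piece a hr)]
      exact hψ.map_smul a (coprod.mk (i, k) r hr)

theorem hasPowerCharacter_iff (R : CentralExtension (𝓡 1) Circle Γ) (n : ℕ) :
    R.HasPowerCharacter n ↔
      HasLocalCharacter R 𝓘(ℝ, ℂ) ((powMonoidHom n).comp Circle.toUnits) := by
  rw [hasLocalCharacter_iff]
  refine exists_congr fun ι => exists_congr fun U => and_congr_right fun _ =>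
    exists_congr fun ψ => ⟨?_, ?_⟩
  · rintro ⟨h1, h2, h3⟩
    exact ⟨h1, h2, h3⟩
  · rintro ⟨h1, h2, h3⟩
    exact ⟨h1, h2, h3⟩

end LocalCharacters

/-! ### The circle, `ℂˣ` and `GL_n`: determinant, retraction and local roots. -/

section Groups

theorem contMDiff_circle_coe : ContMDiff (𝓡 1) 𝓘(ℝ, ℂ) ∞ (fun z : Circle => (z : ℂ)) := by
  have := finrank_real_complex_fact'
  exact (contMDiff_coe_sphere : ContMDiff (𝓡 1) 𝓘(ℝ, ℂ) ∞ ((↑) : Metric.sphere (0 : ℂ) 1 → ℂ))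

variable {EX HX X : Type*} [NormedAddCommGroup EX] [NormedSpace ℝ EX] [TopologicalSpace HX]
  {IX : ModelWithCorners ℝ EX HX} [TopologicalSpace X] [ChartedSpace HX X]

/-- The group of units has a single chart, the open embedding in the algebra, so the hypothesis is
already the expression of `f` in that chart; only continuity has to be transferred. -/
theorem contMDiffWithinAt_units {S : Type*} [NormedRing S] [CompleteSpace S] [NormedAlgebra ℝ S]
    {f : X → Sˣ} {s : Set X} {x : X}
    (hf : ContMDiffWithinAt IX 𝓘(ℝ, S) ∞ (fun y => (f y : S)) s x) :
    ContMDiffWithinAt IX 𝓘(ℝ, S) ∞ f s x := by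
  rw [contMDiffWithinAt_iff_target]
  refine ⟨Units.isOpenEmbedding_val.toIsInducing.continuousWithinAt_iff.2 hf.continuousWithinAt, ?_⟩
  exact hf

theorem contMDiff_circle_toUnits : ContMDiff (𝓡 1) 𝓘(ℝ, ℂ) ∞ Circle.toUnits :=
  fun x => contMDiffWithinAt_units (contMDiff_circle_coe x)

theorem contMDiff_scalarGLn (n : ℕ) :
    ContMDiff (𝓡 1) 𝓘(ℝ, (Fin n → ℂ) →L[ℂ] (Fin n → ℂ)) ∞ (scalarGLn n) := by
  intro x
  refine contMDiffWithinAt_units ?_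
  have h : ContDiff ℝ ∞ (fun z : ℂ => algebraMap ℂ ((Fin n → ℂ) →L[ℂ] (Fin n → ℂ)) z) := by
    simp only [Algebra.algebraMap_eq_smul_one]
    exact contDiff_id.smul contDiff_const
  exact (h.contMDiff.comp contMDiff_circle_coe) x

theorem scalarGLn_apply (n : ℕ) (a : Circle) (v : Fin n → ℂ) :
    (scalarGLn n a : (Fin n → ℂ) →L[ℂ] (Fin n → ℂ)) v = (a : ℂ) • v := rfl

/-- Centrality of the image of `S¹` is what lets a scalar pass between the left action of `R` and
the right action of the structure group. -/
theorem scalarGLn_comm (n : ℕ) (a : Circle) (g : GLn n) : scalarGLn n a * g = g * scalarGLn n a := by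
  ext1
  exact Algebra.commutes (a : ℂ) (g : (Fin n → ℂ) →L[ℂ] (Fin n → ℂ))

/-- The determinant on `GL_n(ℂ)`. -/
noncomputable def detGLn (n : ℕ) : GLn n →* ℂˣ :=
  Units.map
    { toFun := fun f => LinearMap.det (f : (Fin n → ℂ) →ₗ[ℂ] (Fin n → ℂ))
      map_one' := LinearMap.det_id
      map_mul' := fun f g => LinearMap.det_comp _ _ }

/-- The determinant is a polynomial in the matrix entries, and each entry is a continuous
real-linear function of the operator. -/
theorem contMDiff_detGLn (n : ℕ) :
    ContMDiff 𝓘(ℝ, (Fin n → ℂ) →L[ℂ] (Fin n → ℂ)) 𝓘(ℝ, ℂ) ∞ (detGLn n) := by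
  intro x
  refine contMDiffWithinAt_units ?_
  have h : ContDiff ℝ ∞ (fun f : (Fin n → ℂ) →L[ℂ] (Fin n → ℂ) =>
      LinearMap.det (f : (Fin n → ℂ) →ₗ[ℂ] (Fin n → ℂ))) := by
    simp only [← LinearMap.det_toMatrix', Matrix.det_apply, LinearMap.toMatrix'_apply]
    refine ContDiff.sum fun σ _ => ContDiff.const_smul _ (contDiff_prod fun i _ => ?_)
    exact contDiff_pi.1 (((ContinuousLinearMap.apply ℂ (Fin n → ℂ)
        (Pi.single i (1 : ℂ) : Fin n → ℂ)).restrictScalars ℝ)).contDiff (σ i)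
  exact (h.contMDiff.comp Units.contMDiff_val) x

/-- This identity is the source of the weight `n`: rank `n` enters the later properties only through
it. -/
theorem detGLn_scalar (n : ℕ) (a : Circle) :
    detGLn n (scalarGLn n a) = ((powMonoidHom n).comp Circle.toUnits) a := by
  ext1
  have h : (((scalarGLn n a : GLn n) : (Fin n → ℂ) →L[ℂ] (Fin n → ℂ)) :
      (Fin n → ℂ) →ₗ[ℂ] (Fin n → ℂ)) = (a : ℂ) • LinearMap.id := rfl
  change LinearMap.det _ = (a : ℂ) ^ n
  rw [h, LinearMap.det_smul, LinearMap.det_id]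
  simp

theorem unit_div_norm_mem (z : ℂˣ) : (z : ℂ) / ‖(z : ℂ)‖ ∈ Metric.sphere (0 : ℂ) 1 := by
  simp

/-- The homomorphism `z ↦ z / |z|`. -/
noncomputable def unitsToCircle : ℂˣ →* Circle where
  toFun z := ⟨(z : ℂ) / ‖(z : ℂ)‖, unit_div_norm_mem z⟩
  map_one' := Circle.ext (by simp)
  map_mul' z w := Circle.ext (by
    change ((z * w : ℂˣ) : ℂ) / ‖((z * w : ℂˣ) : ℂ)‖ = (z : ℂ) / ‖(z : ℂ)‖ * ((w : ℂ) / ‖(w : ℂ)‖)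
    rw [Units.val_mul, norm_mul, Complex.ofReal_mul, mul_div_mul_comm])

theorem unitsToCircle_toUnits (a : Circle) : unitsToCircle (Circle.toUnits a) = a :=
  Circle.ext (by
    have h : ‖(a : ℂ)‖ = 1 := Circle.norm_coe a
    change (a : ℂ) / ‖(a : ℂ)‖ = a
    rw [h, Complex.ofReal_one, div_one])

theorem contMDiff_unitsToCircle : ContMDiff 𝓘(ℝ, ℂ) (𝓡 1) ∞ unitsToCircle := by
  have := finrank_real_complex_fact'
  have h : ContMDiff 𝓘(ℝ, ℂ) 𝓘(ℝ, ℂ) ∞ (fun z : ℂˣ => (z : ℂ) / ‖(z : ℂ)‖) := by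
    intro z
    have h1 : ContDiffAt ℝ ∞ (fun z : ℂ => z / ‖z‖) z := by
      have h2 : ContDiffAt ℝ ∞ (fun z : ℂ => ((‖z‖ : ℝ) : ℂ)) z :=
        (Complex.ofRealCLM.contDiff.contDiffAt).comp _ (contDiffAt_norm ℝ z.ne_zero)
      simp only [div_eq_mul_inv]
      exact contDiffAt_id.mul (h2.inv (by simp))
    exact h1.contMDiffAt.comp z (Units.contMDiff_val z)
  exact h.codRestrict_sphere unit_div_norm_mem

theorem circle_exp_arg_pow (n : ℕ) (hn : n ≠ 0) (z : Circle) :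
    Circle.exp (Complex.arg z / n) ^ n = z := by
  rw [← Circle.exp_nsmul, nsmul_eq_mul, mul_div_cancel₀ _ (by exact_mod_cast hn), Circle.exp_arg]

/-- Smooth local `n`-th roots exist on the circle. -/
theorem exists_local_root (n : ℕ) (hn : n ≠ 0) (z : Circle) :
    ∃ (V : Set Circle) (ρ : Circle → Circle), IsOpen V ∧ z ∈ V ∧ ContMDiffOn (𝓡 1) (𝓡 1) ∞ ρ V ∧
      ∀ w, ρ w ^ n = w := by
  -- Translation moves `z` to `1`, away from the branch cut of the logarithm.
  let m : Circle → Circle := fun w => w * z⁻¹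
  have hm : ContMDiff (𝓡 1) (𝓡 1) ∞ m := contMDiff_id.mul contMDiff_const
  have hmc : ContMDiff (𝓡 1) 𝓘(ℝ, ℂ) ∞ (fun w => (m w : ℂ)) := contMDiff_circle_coe.comp hm
  refine ⟨(fun w => (m w : ℂ)) ⁻¹' Complex.slitPlane,
    -- Since `w = z · m w`, a root of `w` is a fixed root of `z` times the principal root of `m w`.
    -- The identity `ρ w ^ n = w` holds everywhere; only smoothness requires the slit plane.
    fun w => Circle.exp (Complex.arg (z : ℂ) / n) * Circle.exp (Complex.arg (m w : ℂ) / n),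
    Complex.isOpen_slitPlane.preimage hmc.continuous, by simp [m], ?_, fun w => ?_⟩
  · intro w hw
    have h1 : ContDiffAt ℝ ∞ (fun z : ℂ => Complex.arg z / n) (m w : ℂ) := by
      have h2 : ContDiffAt ℝ ∞ Complex.log (m w : ℂ) :=
        (Complex.contDiffAt_log (n := ∞) hw).restrict_scalars ℝ
      have h3 := (Complex.imCLM.contDiff (n := ∞)).contDiffAt.comp _ h2
      refine (h3.congr_of_eventuallyEq ?_).div_const _
      exact Filter.Eventually.of_forall fun x => (Complex.log_im x).symm
    have h2 := (contMDiff_circleExp _).comp w (h1.contMDiffAt.comp w (hmc w))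
    exact (contMDiffAt_const.mul h2).contMDiffWithinAt
  · rw [mul_pow, circle_exp_arg_pow n hn, circle_exp_arg_pow n hn]
    simp [m]

end Groups

/-! ### From a generalized homomorphism to a local character. -/

section PrincipalBundles

variable {EG HG : Type} [NormedAddCommGroup EG] [NormedSpace ℝ EG]
  [TopologicalSpace HG] {IG : ModelWithCorners ℝ EG HG}
  {G : Type} [TopologicalSpace G] [ChartedSpace HG G] [Group G]

/-- Local sections of a generalized homomorphism yield a local character. -/
theorem EquivariantGenHom.hasLocalCharacter {M : SmoothMfd.{u}} {Γ : LieGroupoid M}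
    {R : CentralExtension (𝓡 1) Circle Γ} {j : Circle →* G} (hj : ∀ a g, j a * g = g * j a)
    (Z : EquivariantGenHom R IG G j) : HasLocalCharacter R IG j := by
  choose U hU hxU σ φ hσ hφ h1 h2 h3 using Z.principal.locally_trivial
  -- The defining equation `σ i (t r) · χ i k (r) = r · σ k (s r)`, comparing two local sections.
  -- Since `G` acts freely, every law for `χ` follows by exhibiting a solution of it.
  have key : ∀ i k r, R.R.t r ∈ U i → R.R.s r ∈ U k →
      Z.ract (σ i (R.R.t r)) (φ i (Z.lact r (σ k (R.R.s r)))) = Z.lact r (σ k (R.R.s r)) := by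
    intro i k r hi hk
    have ht : Z.τ (Z.lact r (σ k (R.R.s r))) = R.R.t r := Z.τ_lact _ _ (h1 _ _ hk).symm
    have := h3 i (Z.lact r (σ k (R.R.s r))) (by rw [ht]; exact hi)
    rwa [ht] at this
  have uniq : ∀ i x g z, x ∈ U i → Z.ract (σ i x) g = z → φ i z = g := by
    rintro i x g z hx rfl
    exact h2 i x hx g
  have hs : ContMDiff R.R.arr.I M.I ∞ R.R.s := R.R.s_submersion.1
  -- The points of `M` themselves index the cover, each with its trivializing neighbourhood.
  refine ⟨M, fun x => ⟨U x, hU x⟩, fun x => ⟨x, hxU x⟩, ⟨⟨fun i k r => φ i (Z.lact r (σ k (R.R.s r))),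
    fun i k => ?_, fun i k l r r' hr hr' hc => ?_, fun a i k r hr => ?_⟩⟩⟩
  · have h4 : ContMDiffOn R.R.arr.I Z.Z.I ∞ (fun r => σ k (R.R.s r)) {r | R.R.s r ∈ U k} :=
      (hσ k).comp hs.contMDiffOn (fun r hr => hr)
    have h5 : ContMDiffOn R.R.arr.I Z.Z.I ∞ (fun r => Z.lact r (σ k (R.R.s r)))
        {r | R.R.s r ∈ U k} :=
      ContMDiffOn.comp (g := fun q : R.R.arr × Z.Z => Z.lact q.1 q.2) Z.lact_smooth
        (contMDiffOn_id.prodMk h4) (fun r hr => (h1 k _ hr).symm)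
    refine (hφ i).comp (h5.mono fun r hr => hr.2) fun r hr => ?_
    change Z.τ _ ∈ U i
    rw [Z.τ_lact _ _ (h1 _ _ hr.2).symm]
    exact hr.1
  · have ht : R.R.t (R.R.mul r r') ∈ U i := by rw [R.R.t_mul _ _ hc]; exact hr.1
    refine uniq i _ _ _ ht ?_
    rw [Z.principal.act_mul, R.R.t_mul _ _ hc, key i k r hr.1 hr.2,
      Z.lact_ract _ _ _ (h1 k _ hr.2).symm, hc, key k l r' hr'.1 hr'.2, R.R.s_mul _ _ hc,
      Z.mul_lact _ _ _ hc (h1 l _ hr'.2).symm]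
  · have ht : R.R.t (R.smul a r) ∈ U i := by rw [R.t_smul]; exact hr.1
    refine uniq i _ _ _ ht ?_
    have hz := (h1 k _ hr.2).symm
    -- At `g = 1` the two equivariance axioms combine to `(a r) · z = (r · z) · j(a)`. Centrality
    -- then puts `j(a)` on the left of `χ i k (r)`.
    have e1 := Z.smul_lact_ract a r (σ k (R.R.s r)) 1 hz
    rw [Z.lact_csmul_ract a r _ 1 hz, Z.principal.act_one, _root_.mul_one] at e1
    rw [hj, Z.principal.act_mul, R.t_smul, key i k r hr.1 hr.2, R.s_smul, e1]

/-! ### The smooth principal bundle glued from a cocycle. -/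

/-- A smooth cocycle with values in `G` on an open cover of `M`, with a chosen index for each
point. -/
structure BundleCocycle (M : SmoothMfd.{u}) (IG : ModelWithCorners ℝ EG HG) (G : Type)
    [TopologicalSpace G] [ChartedSpace HG G] [Group G] (ι : Type u) where
  U : ι → Opens M
  idx : M → ι
  mem_idx : ∀ x, x ∈ U (idx x)
  c : ι → ι → M → G
  smooth : ∀ i k, ContMDiffOn M.I IG ∞ (c i k) (U i ∩ U k)
  mul : ∀ i k l x, x ∈ U i → x ∈ U k → x ∈ U l → c i k x * c k l x = c i l x

namespace BundleCocycle

variable {M : SmoothMfd.{u}} {ι : Type u} (C : BundleCocycle M IG G ι)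

theorem self {i : ι} {x : M} (hi : x ∈ C.U i) : C.c i i x = 1 :=
  left_eq_mul.1 (C.mul i i i x hi hi hi).symm

theorem mul_symm {i k : ι} {x : M} (hi : x ∈ C.U i) (hk : x ∈ C.U k) :
    C.c i k x * C.c k i x = 1 := by
  rw [C.mul _ _ _ _ hi hk hi, C.self hi]

/-- The total space of the principal bundle of a cocycle; the fibre coordinate is taken with
respect to the chosen index of the base point. -/
@[ext]
structure Total (C : BundleCocycle M IG G ι) : Type u where
  base : M
  fib : G

/-- The fibre coordinate over `U i`. -/
def coord (i : ι) (p : C.Total) : G := C.c i (C.idx p.base) p.base * p.fib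

/-- The point over `x` with fibre coordinate `g` over `U i`. -/
def point (i : ι) (x : M) (g : G) : C.Total := ⟨x, C.c (C.idx x) i x * g⟩

/-- The chosen index of `x` need not be locally constant in `x`, but the cocycle identity eliminates
it and leaves only the smooth transition function `c i k`. This makes the atlas smooth. -/
theorem coord_point {i k : ι} {x : M} (hi : x ∈ C.U i) (hk : x ∈ C.U k) (g : G) :
    C.coord i (C.point k x g) = C.c i k x * g := by
  change C.c i (C.idx x) x * (C.c (C.idx x) k x * g) = _
  rw [← mul_assoc, C.mul _ _ _ _ hi (C.mem_idx x) hk]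

theorem point_coord {i : ι} {p : C.Total} (hi : p.base ∈ C.U i) :
    C.point i p.base (C.coord i p) = p := by
  refine Total.ext rfl ?_
  change C.c (C.idx p.base) i p.base * (C.c i (C.idx p.base) p.base * p.fib) = _
  rw [← mul_assoc, C.mul_symm (C.mem_idx _) hi, one_mul]

/-- The local trivialization over `U i`. -/
def triv (i : ι) : PartialEquiv C.Total (M × G) where
  toFun p := (p.base, C.coord i p)
  invFun q := C.point i q.1 q.2
  source := {p | p.base ∈ C.U i}
  target := {q | q.1 ∈ C.U i}
  map_source' _ h := h
  map_target' _ h := h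
  left_inv' _ h := C.point_coord h
  right_inv' q h := Prod.ext rfl (by
    change C.coord i (C.point i q.1 q.2) = _
    rw [C.coord_point h h, C.self h, one_mul])

theorem triv_trans_source (i k : ι) :
    ((C.triv i).symm.trans (C.triv k)).source = {q | q.1 ∈ (C.U i ∩ C.U k : Set M)} := by
  ext q
  exact Iff.rfl

variable [LieGroup IG ∞ G]

theorem triv_trans (i k : ι) :
    ContMDiffOn (M.I.prod IG) (M.I.prod IG) ∞
      (fun q : M × G => (C.triv i).symm.trans (C.triv k) q)
      {q | q.1 ∈ (C.U i ∩ C.U k : Set M)} := by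
  have h1 : ContMDiffOn (M.I.prod IG) (M.I.prod IG) ∞
      (fun q : M × G => (q.1, C.c k i q.1 * q.2)) {q | q.1 ∈ (C.U i ∩ C.U k : Set M)} :=
    contMDiffOn_fst.prodMk (ContMDiffOn.mul
      ((C.smooth k i).comp contMDiffOn_fst (fun q h => ⟨h.2, h.1⟩)) contMDiffOn_snd)
  exact h1.congr fun q h => Prod.ext rfl (C.coord_point h.2 h.1 _)

variable [FiniteDimensional ℝ EG] [IG.Boundaryless]

/-- The product of a manifold with a Lie group. -/
noncomputable abbrev prodMfd (X : SmoothMfd.{u}) (IG : ModelWithCorners ℝ EG HG)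
    [IG.Boundaryless] (G : Type)
    [TopologicalSpace G] [ChartedSpace HG G] [Group G] [LieGroup IG ∞ G] : SmoothMfd.{u} :=
  { carrier := X × G, E := X.E × EG, H := ModelProd X.H HG, I := X.I.prod IG,
    isManifold := by
      have : IsManifold IG ∞ G := ContMDiffMul.toIsManifold
      infer_instance }

/-- The atlas of local trivializations. -/
noncomputable def core : ChartedSpaceCore (prodMfd M IG G) C.Total where
  atlas := Set.range C.triv
  chartAt p := C.triv (C.idx p.base)
  mem_chart_source p := C.mem_idx _
  chart_mem_atlas p := ⟨_, rfl⟩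
  open_source := by
    rintro _ _ ⟨i, rfl⟩ ⟨k, rfl⟩
    rw [C.triv_trans_source]
    exact ((C.U i).isOpen.inter (C.U k).isOpen).preimage continuous_fst
  continuousOn_toFun := by
    rintro _ _ ⟨i, rfl⟩ ⟨k, rfl⟩
    rw [C.triv_trans_source]
    exact (C.triv_trans i k).continuousOn

/-- The total space of the principal bundle, as a manifold. -/
noncomputable def mfd : SmoothMfd.{u} :=
  letI := C.core.toTopologicalSpace
  letI := C.core.toChartedSpace
  SmoothMfd.comp (prodMfd M IG G) C.Total (by
    intro e he e' he'
    obtain ⟨_, ⟨i, rfl⟩, rfl⟩ := Set.mem_iUnion₂.1 he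
    obtain ⟨_, ⟨k, rfl⟩, rfl⟩ := Set.mem_iUnion₂.1 he'
    have h : ((C.core.openPartialHomeomorph (C.triv i) ⟨i, rfl⟩).symm.trans
        (C.core.openPartialHomeomorph (C.triv k) ⟨k, rfl⟩)).source =
          {q | q.1 ∈ (C.U i ∩ C.U k : Set M)} := C.triv_trans_source i k
    rw [h]
    exact C.triv_trans i k)

/-- The projection of the principal bundle. -/
def proj (p : C.mfd) : M := Total.base (C := C) p

/-- The fibre coordinate over `U i`, on the manifold. -/
def φ (i : ι) (p : C.mfd) : G := C.coord i p

/-- The inverse of the local trivialization over `U i`, on the manifold. -/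
def pt (i : ι) (x : M) (g : G) : C.mfd := C.point i x g

theorem smooth_triv (i : ι) :
    ContMDiffOn C.mfd.I (M.I.prod IG) ∞ (fun p => (C.proj p, C.φ i p)) {p | C.proj p ∈ C.U i} := by
  letI := C.core.toTopologicalSpace
  letI := C.core.toChartedSpace
  refine SmoothMfd.comp_chart _ (C.core.openPartialHomeomorph (C.triv i) ⟨i, rfl⟩) ?_
  exact Set.mem_iUnion₂.2 ⟨_, ⟨i, rfl⟩, rfl⟩

theorem smooth_triv_symm (i : ι) :
    ContMDiffOn (M.I.prod IG) C.mfd.I ∞ (fun q : M × G => C.pt i q.1 q.2) {q | q.1 ∈ C.U i} := by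
  letI := C.core.toTopologicalSpace
  letI := C.core.toChartedSpace
  refine SmoothMfd.comp_chart_symm _ (C.core.openPartialHomeomorph (C.triv i) ⟨i, rfl⟩) ?_
  exact Set.mem_iUnion₂.2 ⟨_, ⟨i, rfl⟩, rfl⟩

theorem isOpen_dom (i : ι) : IsOpen {p : C.mfd | C.proj p ∈ C.U i} :=
  C.core.open_source' ⟨i, rfl⟩

theorem smooth_φ (i : ι) : ContMDiffOn C.mfd.I IG ∞ (C.φ i) {p | C.proj p ∈ C.U i} :=
  contMDiff_snd.comp_contMDiffOn (C.smooth_triv i)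

theorem smooth_proj : ContMDiff C.mfd.I M.I ∞ C.proj := by
  intro p
  have h : ContMDiffOn C.mfd.I M.I ∞ C.proj {q | C.proj q ∈ C.U (C.idx (C.proj p))} :=
    contMDiff_fst.comp_contMDiffOn (C.smooth_triv _)
  exact h.contMDiffAt ((C.isOpen_dom _).mem_nhds (C.mem_idx _))

theorem pt_φ {i : ι} {p : C.mfd} (hi : C.proj p ∈ C.U i) : C.pt i (C.proj p) (C.φ i p) = p :=
  C.point_coord hi

theorem φ_pt {i : ι} {x : M} (hi : x ∈ C.U i) (g : G) : C.φ i (C.pt i x g) = g :=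
  (C.coord_point hi hi g).trans (by rw [C.self hi, one_mul])

theorem φ_change {i k : ι} {p : C.mfd} (hi : C.proj p ∈ C.U i) (hk : C.proj p ∈ C.U k) :
    C.φ i p = C.c i k (C.proj p) * C.φ k p := by
  conv_lhs => rw [← C.pt_φ hk]
  exact C.coord_point hi hk _

theorem ext_φ {i : ι} {p q : C.mfd} (h : C.proj p = C.proj q) (hi : C.proj q ∈ C.U i)
    (hφ : C.φ i p = C.φ i q) : p = q := by
  rw [← C.pt_φ hi, ← C.pt_φ (i := i) (p := p) (by rw [h]; exact hi), h, hφ]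

variable {EY HY Y : Type*} [NormedAddCommGroup EY] [NormedSpace ℝ EY] [TopologicalSpace HY]
  {IY : ModelWithCorners ℝ EY HY} [TopologicalSpace Y] [ChartedSpace HY Y]

/-- Near `y` the map is the inverse trivialization `pt i` applied to its projection and fibre
coordinate, and `pt i` is smooth. -/
theorem smooth_into {f : Y → C.mfd} {S : Set Y} {y : Y} (hy : y ∈ S) (i : ι)
    (hi : C.proj (f y) ∈ C.U i)
    (hπ : ContMDiffWithinAt IY M.I ∞ (fun y => C.proj (f y)) S y)
    (hφ : ContMDiffWithinAt IY IG ∞ (fun y => C.φ i (f y)) S y) :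
    ContMDiffWithinAt IY C.mfd.I ∞ f S y := by
  have hi' : {q : M × G | q.1 ∈ C.U i} ∈ 𝓝 (C.proj (f y), C.φ i (f y)) :=
    ((C.U i).isOpen.preimage continuous_fst).mem_nhds hi
  have h1 := (C.smooth_triv_symm i).contMDiffAt hi'
  refine (ContMDiffAt.comp_contMDiffWithinAt y h1 (hπ.prodMk hφ)).congr_of_eventuallyEq_of_mem ?_ hy
  have h3 : ∀ᶠ z in 𝓝[S] y, C.proj (f z) ∈ C.U i :=
    hπ.continuousWithinAt ((C.U i).isOpen.mem_nhds hi)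
  filter_upwards [h3] with z hz
  exact (C.pt_φ hz).symm

/-- The right action of `G`. -/
def ract (p : C.mfd) (g : G) : C.mfd :=
  (⟨Total.base (C := C) p, Total.fib (C := C) p * g⟩ : C.Total)

theorem proj_ract (p : C.mfd) (g : G) : C.proj (C.ract p g) = C.proj p := rfl

theorem φ_ract (i : ι) (p : C.mfd) (g : G) : C.φ i (C.ract p g) = C.φ i p * g :=
  (mul_assoc _ _ _).symm

theorem smooth_ract : ContMDiff (C.mfd.I.prod IG) C.mfd.I ∞
    (fun q : C.mfd × G => C.ract q.1 q.2) := by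
  rintro ⟨p, g⟩
  have hV : IsOpen {q : C.mfd × G | C.proj q.1 ∈ C.U (C.idx (C.proj p))} :=
    (C.isOpen_dom _).preimage continuous_fst
  refine ContMDiffWithinAt.contMDiffAt ?_ (hV.mem_nhds (C.mem_idx (C.proj p)))
  refine C.smooth_into (C.mem_idx (C.proj p)) _ (C.mem_idx (C.proj p)) ?_ ?_
  · exact (C.smooth_proj.comp contMDiff_fst).contMDiffAt.contMDiffWithinAt
  · simp only [φ_ract]
    exact (((C.smooth_φ _).comp contMDiffOn_fst fun q hq => hq).mul contMDiffOn_snd) _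
      (C.mem_idx (C.proj p))

theorem isPrincipalBundle : IsPrincipalBundle IG G C.mfd M C.proj C.ract where
  smooth_proj := C.smooth_proj
  smooth_act := C.smooth_ract
  act_one p := Total.ext rfl (mul_one _)
  act_mul p g h := Total.ext rfl (mul_assoc _ _ _).symm
  proj_act := C.proj_ract
  locally_trivial b := by
    refine ⟨C.U (C.idx b), (C.U _).isOpen, C.mem_idx b, fun x => C.pt (C.idx b) x 1, C.φ (C.idx b),
      ?_, C.smooth_φ _, fun x _ => rfl, fun x hx g => ?_, fun p hp => ?_⟩
    · exact (C.smooth_triv_symm _).comp (contMDiffOn_id.prodMk contMDiffOn_const) fun x hx => hx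
    · rw [φ_ract, C.φ_pt hx, one_mul]
    · refine C.ext_φ (i := C.idx b) rfl hp ?_
      rw [φ_ract, C.φ_pt hp, one_mul]

end BundleCocycle

/-! ### The generalized homomorphism of a local character. -/

namespace LocalCharacter

variable {M : SmoothMfd.{u}} {Γ : LieGroupoid M} {R : CentralExtension (𝓡 1) Circle Γ}
  {j : Circle →* G} {ι : Type u} {U : ι → Opens M} (χ : LocalCharacter R IG j U)

/-- The restriction of a local character to the units. -/
def cocycle (idx : M → ι) (h : ∀ x, x ∈ U (idx x)) : BundleCocycle M IG G ι where
  U := U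
  idx := idx
  mem_idx := h
  c i k x := χ.toFun i k (R.R.one x)
  smooth i k := (χ.smooth i k).comp (ContMDiff.contMDiffOn R.R.one_smooth)
    fun x hx => R.R.one_mem_piece hx.1 hx.2
  mul i k l x hi hk hl := by
    have e := R.R.one_mul (R.R.one x)
    rw [R.R.t_one] at e
    rw [← χ.map_mul i k l _ _ (R.R.one_mem_piece hi hk) (R.R.one_mem_piece hk hl)
      (by rw [R.R.s_one, R.R.t_one]), e]

/-- The unit at `t r`, viewed as an arrow from `U i` to `U i'`, absorbs a change of index at the
target; units at `s r` do the same at the source. -/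
theorem change_left {i i' k : ι} {r : R.R.arr} (hr : r ∈ R.R.piece U (i, k))
    (hi : R.R.t r ∈ U i') :
    χ.toFun i' i (R.R.one (R.R.t r)) * χ.toFun i k r = χ.toFun i' k r := by
  rw [← χ.map_mul _ _ _ _ _ (R.R.one_mem_piece hi hr.1) hr (R.R.s_one _), R.R.one_mul]

theorem change_right {i k k' : ι} {r : R.R.arr} (hr : r ∈ R.R.piece U (i, k))
    (hk : R.R.s r ∈ U k') :
    χ.toFun i k r * χ.toFun k k' (R.R.one (R.R.s r)) = χ.toFun i k' r := by
  rw [← χ.map_mul _ _ _ _ _ hr (R.R.one_mem_piece hr.2 hk) (R.R.t_one _).symm, R.R.mul_one]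

variable [LieGroup IG ∞ G] [FiniteDimensional ℝ EG] [IG.Boundaryless]

/-- The action of `R` on the principal bundle of a local character. -/
def lact (idx : M → ι) (h : ∀ x, x ∈ U (idx x)) (r : R.R.arr) (z : (χ.cocycle idx h).mfd) :
    (χ.cocycle idx h).mfd :=
  (χ.cocycle idx h).pt (idx (R.R.t r)) (R.R.t r)
    (χ.toFun (idx (R.R.t r)) (idx (R.R.s r)) r * (χ.cocycle idx h).φ (idx (R.R.s r)) z)

variable (idx : M → ι) (h : ∀ x, x ∈ U (idx x))

/-- The action is defined with the indices chosen at `s r` and `t r`, which may jump as `r` moves.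
Absorbing the two unit factors shows that in any admissible coordinates it is left multiplication by
`χ i k (r)`. Its smoothness and all its algebraic laws are read off from this formula. -/
theorem φ_lact {i k : ι} {r : R.R.arr} {z : (χ.cocycle idx h).mfd}
    (hr : r ∈ R.R.piece U (i, k)) (hz : R.R.s r = (χ.cocycle idx h).proj z) :
    (χ.cocycle idx h).φ i (χ.lact idx h r z) = χ.toFun i k r * (χ.cocycle idx h).φ k z := by
  refine ((χ.cocycle idx h).coord_point hr.1 (h _) _).trans ?_
  have h1 := (χ.cocycle idx h).φ_change (i := idx (R.R.s r)) (k := k) (p := z)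
    (by rw [← hz]; exact h _) (by rw [← hz]; exact hr.2)
  rw [h1, ← hz, ← mul_assoc, ← mul_assoc]
  congr 1
  change χ.toFun i (idx (R.R.t r)) (R.R.one (R.R.t r)) * _ *
    χ.toFun (idx (R.R.s r)) k (R.R.one (R.R.s r)) = _
  rw [χ.change_left ⟨h _, h _⟩ hr.1]
  exact χ.change_right ⟨hr.1, h _⟩ hr.2

theorem smooth_lact : SmoothMfd.SmoothOn₂ R.R.arr (χ.cocycle idx h).mfd (χ.cocycle idx h).mfd
    (fun r z => R.R.s r = (χ.cocycle idx h).proj z) (χ.lact idx h) := by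
  set C := χ.cocycle idx h with hC
  rintro ⟨r, z⟩ hrz
  change R.R.s r = C.proj z at hrz
  -- The indices chosen at `r` are frozen: they remain admissible on the whole neighbourhood `T`,
  -- where the coordinate formula for the action is manifestly smooth.
  let i := idx (R.R.t r)
  let k := idx (R.R.s r)
  let S : Set (R.R.arr × C.mfd) := {q | R.R.s q.1 = C.proj q.2}
  let T : Set (R.R.arr × C.mfd) := {q | q.1 ∈ R.R.piece U (i, k)}
  have hr : r ∈ R.R.piece U (i, k) := ⟨h _, h _⟩
  have hT : T ∈ 𝓝 (r, z) := ((R.R.piece U (i, k)).isOpen.preimage continuous_fst).mem_nhds hr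
  have ht : ContMDiff R.R.arr.I M.I ∞ R.R.t := R.R.t_submersion.1
  have hm : (r, z) ∈ S ∩ T := ⟨hrz, hr⟩
  refine ContMDiffWithinAt.mono_of_mem_nhdsWithin (s := S ∩ T) ?_
    (Filter.inter_mem self_mem_nhdsWithin (mem_nhdsWithin_of_mem_nhds hT))
  refine C.smooth_into (f := fun q : R.R.arr × C.mfd => χ.lact idx h q.1 q.2) hm i hr.1 ?_ ?_
  · have h1 : ContMDiff (R.R.arr.I.prod C.mfd.I) M.I ∞ (fun q : R.R.arr × C.mfd => R.R.t q.1) :=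
      ht.comp contMDiff_fst
    exact h1.contMDiffAt.contMDiffWithinAt
  · have h1 : ContMDiffOn (R.R.arr.I.prod C.mfd.I) IG ∞
        (fun q : R.R.arr × C.mfd => χ.toFun i k q.1 * C.φ k q.2) (S ∩ T) := by
      refine ContMDiffOn.mul (ContMDiffOn.comp (χ.smooth i k) contMDiffOn_fst fun q hq => hq.2)
        (ContMDiffOn.comp (C.smooth_φ k) contMDiffOn_snd fun q hq => ?_)
      have e : R.R.s q.1 = C.proj q.2 := hq.1
      change C.proj q.2 ∈ U k
      rw [← e]; exact hq.2.2
    exact (h1.congr fun q hq => χ.φ_lact idx h hq.2 hq.1) _ hm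

/-- The generalized homomorphism defined by a local character. -/
noncomputable def equivariantGenHom (hjs : ContMDiff (𝓡 1) IG ∞ j)
    (hj : ∀ a g, j a * g = g * j a) : EquivariantGenHom R IG G j :=
  let C := χ.cocycle idx h
  have hφ : ∀ (i k : ι) (r : R.R.arr) (z : C.mfd), r ∈ R.R.piece U (i, k) → R.R.s r = C.proj z →
      C.φ i (χ.lact idx h r z) = χ.toFun i k r * C.φ k z := fun i k r z hr hz =>
    χ.φ_lact idx h hr hz
  { Z := C.mfd
    τ := C.proj
    lact := χ.lact idx h
    ract := C.ract
    principal := C.isPrincipalBundle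
    lact_smooth := χ.smooth_lact idx h
    τ_lact := fun r z _ => rfl
    one_lact := fun z => by
      have e : R.R.s (R.R.one (C.proj z)) = C.proj z := R.R.s_one _
      refine C.ext_φ (i := idx (C.proj z)) (R.R.t_one _) (h _) ?_
      rw [hφ _ _ _ _ (R.R.one_mem_piece (h _) (h _)) e, χ.map_one (h _), one_mul]
    mul_lact := fun r r' z hc hz => by
      have e : R.R.t (R.R.mul r r') = R.R.t r := R.R.t_mul _ _ hc
      have e' : R.R.s (R.R.mul r r') = R.R.s r' := R.R.s_mul _ _ hc
      have hr : r ∈ R.R.piece U (idx (R.R.t r), idx (R.R.s r)) := ⟨h _, h _⟩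
      have hr' : r' ∈ R.R.piece U (idx (R.R.s r), idx (R.R.s r')) := ⟨by rw [hc]; exact h _, h _⟩
      refine C.ext_φ (i := idx (R.R.t r)) e (h _) ?_
      rw [hφ _ (idx (R.R.s r')) _ _ (LieGroupoid.val_mul_mem hr hr' hc) (e'.trans hz),
        hφ _ _ r (χ.lact idx h r' z) hr hc, hφ _ _ r' z hr' hz, χ.map_mul _ _ _ _ _ hr hr' hc, mul_assoc]
    lact_ract := fun r z g hz => by
      have hr : r ∈ R.R.piece U (idx (R.R.t r), idx (R.R.s r)) := ⟨h _, h _⟩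
      refine C.ext_φ (i := idx (R.R.t r)) rfl (h _) ?_
      rw [C.φ_ract, hφ _ _ r z hr hz, hφ _ _ r (C.ract z g) hr hz, C.φ_ract, mul_assoc]
    -- A scalar on `r` multiplies `χ` from the left by `j(a)`, whereas this action multiplies the
    -- coordinate of `z` from the left of `g` but after `χ`. The two agree because `j(a)` is
    -- central.
    csmul := fun a z => C.ract z (j a)
    csmul_smooth := C.smooth_ract.comp (contMDiff_snd.prodMk (hjs.comp contMDiff_fst))
    one_csmul := fun z => by rw [_root_.map_one]; exact C.isPrincipalBundle.act_one z
    mul_csmul := fun a b z => by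
      rw [_root_.map_mul, hj]; exact C.isPrincipalBundle.act_mul z _ _
    τ_csmul := fun a z => rfl
    smul_lact_ract := fun a r z g hz => by
      have hr : r ∈ R.R.piece U (idx (R.R.t r), idx (R.R.s r)) := ⟨h _, h _⟩
      have hz' : R.R.s (R.smul a r) = C.proj z := (R.s_smul a r).trans hz
      refine C.ext_φ (i := idx (R.R.t r)) (R.t_smul a r) (h _) ?_
      rw [C.φ_ract, C.φ_ract, hφ _ _ _ _ (R.smul_mem_piece a hr) hz', hφ _ _ r (C.ract z (j a)) hr hz,
        C.φ_ract, χ.map_smul _ _ _ _ hr, hj, mul_assoc (χ.toFun _ _ _), hj, mul_assoc, mul_assoc]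
    lact_csmul_ract := fun a r z g hz => by
      have hr : r ∈ R.R.piece U (idx (R.R.t r), idx (R.R.s r)) := ⟨h _, h _⟩
      refine C.ext_φ (i := idx (R.R.t r)) rfl (h _) ?_
      rw [C.φ_ract, C.φ_ract, hφ _ _ r z hr hz, hφ _ _ r (C.ract z (j a)) hr hz, C.φ_ract]
      simp only [mul_assoc] }

end LocalCharacter

/-- An equivariant generalized homomorphism to `G` amounts to a local character in `G`. -/
theorem nonempty_equivariantGenHom_iff [LieGroup IG ∞ G] [FiniteDimensional ℝ EG]
    [IG.Boundaryless] {M : SmoothMfd.{u}} {Γ : LieGroupoid M}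
    (R : CentralExtension (𝓡 1) Circle Γ) (j : Circle →* G) (hjs : ContMDiff (𝓡 1) IG ∞ j)
    (hj : ∀ a g, j a * g = g * j a) :
    Nonempty (EquivariantGenHom R IG G j) ↔ HasLocalCharacter R IG j := by
  refine ⟨fun ⟨Z⟩ => Z.hasLocalCharacter hj, ?_⟩
  rintro ⟨ι, U, hU, ⟨χ⟩⟩
  choose idx h using hU
  exact ⟨χ.equivariantGenHom idx h hjs hj⟩

end PrincipalBundles

/-! ### Twisted vector bundles as local characters in `GL_n`. -/

section TwistedVectorBundles
open Bundle

section Smoothness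

variable {EX HX X : Type*} [NormedAddCommGroup EX] [NormedSpace ℝ EX] [TopologicalSpace HX]
  {IX : ModelWithCorners ℝ EX HX} [TopologicalSpace X] [ChartedSpace HX X]

/-- Smoothness is over `ℝ` while the operators are linear over `ℂ`: evaluation is a bounded complex
bilinear map, hence smooth, also after restriction of scalars. -/
theorem ContMDiffWithinAt.complex_clm_apply {V W : Type*} [NormedAddCommGroup V] [NormedSpace ℂ V]
    [NormedAddCommGroup W] [NormedSpace ℂ W] {f : X → V →L[ℂ] W} {g : X → V} {S : Set X} {x : X}
    (hf : ContMDiffWithinAt IX 𝓘(ℝ, V →L[ℂ] W) ∞ f S x)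
    (hg : ContMDiffWithinAt IX 𝓘(ℝ, V) ∞ g S x) :
    ContMDiffWithinAt IX 𝓘(ℝ, W) ∞ (fun y => f y (g y)) S x := by
  have h : ContDiff ℝ ∞ (fun p : (V →L[ℂ] W) × V => p.1 p.2) :=
    (isBoundedBilinearMap_apply (𝕜 := ℂ)).contDiff.restrict_scalars ℝ
  exact ContMDiffAt.comp_contMDiffWithinAt (g := fun p : (V →L[ℂ] W) × V => p.1 p.2) x
    h.contMDiff.contMDiffAt (hf.prodMk_space hg)

/-- An operator on `ℂⁿ` is a sum of rank one operators that depend linearly on its values on the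
standard basis, so smoothness may be tested one vector at a time. -/
theorem contMDiffWithinAt_complex_clm {n : ℕ} {W : Type*} [NormedAddCommGroup W] [NormedSpace ℂ W]
    {f : X → (Fin n → ℂ) →L[ℂ] W} {S : Set X} {x : X}
    (hf : ∀ v, ContMDiffWithinAt IX 𝓘(ℝ, W) ∞ (fun y => f y v) S x) :
    ContMDiffWithinAt IX 𝓘(ℝ, (Fin n → ℂ) →L[ℂ] W) ∞ f S x := by
  let T : Fin n → W →L[ℂ] ((Fin n → ℂ) →L[ℂ] W) := fun k =>
    ContinuousLinearMap.smulRightL ℂ (Fin n → ℂ) W (ContinuousLinearMap.proj k)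
  let g : (Fin n → W) → ((Fin n → ℂ) →L[ℂ] W) := fun w => ∑ k, T k (w k)
  have hg : ContDiff ℝ ∞ g := ContDiff.sum fun k _ =>
    ((T k).restrictScalars ℝ).contDiff.comp (contDiff_apply ℝ W k)
  have h1 : ContMDiffWithinAt IX 𝓘(ℝ, Fin n → W) ∞
      (fun y k => f y (Pi.single k (1 : ℂ))) S x :=
    contMDiffWithinAt_pi_space.2 fun k => hf _
  have h2 := ContMDiffAt.comp_contMDiffWithinAt (g := g) x hg.contMDiff.contMDiffAt h1
  refine h2.congr (fun y _ => ?_) ?_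
  all_goals
    refine ContinuousLinearMap.ext fun v => ?_
    simp only [g, T, Function.comp, _root_.sum_apply]
    conv_lhs => rw [← Finset.univ_sum_single v, _root_.map_sum]
    refine Finset.sum_congr rfl fun k _ => ?_
    have h3 : (Pi.single k (v k) : Fin n → ℂ) = v k • Pi.single k (1 : ℂ) := by
      rw [← Pi.single_smul, smul_eq_mul, mul_one]
    rw [h3, _root_.map_smul]
    rfl

variable {M : SmoothMfd.{u}} {n : ℕ} {E : M → Type} [∀ x, AddCommGroup (E x)]
  [∀ x, Module ℂ (E x)] [∀ x, TopologicalSpace (E x)]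
  [TopologicalSpace (TotalSpace (Fin n → ℂ) E)] [FiberBundle (Fin n → ℂ) E]
  [VectorBundle ℂ (Fin n → ℂ) E]

/-- The transition functions of the complex vector bundle `E` are smooth over `ℝ`. -/
def SmoothCoordChange (M : SmoothMfd.{u}) (n : ℕ) (E : M → Type) [∀ x, AddCommGroup (E x)]
    [∀ x, Module ℂ (E x)] [∀ x, TopologicalSpace (E x)]
    [TopologicalSpace (TotalSpace (Fin n → ℂ) E)] [FiberBundle (Fin n → ℂ) E]
    [VectorBundle ℂ (Fin n → ℂ) E] : Prop :=
  ∀ (e e' : Trivialization (Fin n → ℂ) (π (Fin n → ℂ) E))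
    [MemTrivializationAtlas e] [MemTrivializationAtlas e'],
    ContMDiffOn M.I 𝓘(ℝ, (Fin n → ℂ) →L[ℂ] (Fin n → ℂ)) ∞
      (fun x => (e.coordChangeL ℂ e' x : (Fin n → ℂ) →L[ℂ] (Fin n → ℂ)))
      (e.baseSet ∩ e'.baseSet)

/-- The fibre coordinate of a smooth map to a vector bundle is smooth. -/
theorem SmoothCoordChange.snd_comp (hE : SmoothCoordChange M n E)
    (e : Trivialization (Fin n → ℂ) (π (Fin n → ℂ) E)) [MemTrivializationAtlas e]
    {f : X → TotalSpace (Fin n → ℂ) E} {S : Set X} {x : X}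
    (hf : ContMDiffWithinAt IX (M.I.prod 𝓘(ℝ, Fin n → ℂ)) ∞ f S x)
    (hx : x ∈ S) (he : (f x).proj ∈ e.baseSet) :
    ContMDiffWithinAt IX 𝓘(ℝ, Fin n → ℂ) ∞ (fun y => (e (f y)).2) S x := by
  obtain ⟨hp, hc⟩ := contMDiffWithinAt_totalSpace.1 hf
  -- Smoothness into the total space is tested in the preferred trivialization at `f x`; the smooth
  -- transition operator to `e` transfers it.
  set e₀ := trivializationAt (Fin n → ℂ) E (f x).proj
  have he₀ : (f x).proj ∈ e₀.baseSet := mem_baseSet_trivializationAt _ _ _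
  have hn : e₀.baseSet ∩ e.baseSet ∈ 𝓝 (f x).proj :=
    (e₀.open_baseSet.inter e.open_baseSet).mem_nhds ⟨he₀, he⟩
  have h1 := ((hE e₀ e).contMDiffAt hn).comp_contMDiffWithinAt x hp
  refine (h1.complex_clm_apply hc).congr_of_eventuallyEq_of_mem ?_ hx
  filter_upwards [hp.continuousWithinAt hn] with y hy
  have := e₀.coordChangeL_apply (R := ℂ) e hy (e₀ (f y)).2
  have e1 := congrArg (TotalSpace.mk (F := Fin n → ℂ) (f y).proj) (e₀.symm_proj_apply (f y) hy.1)
  exact (congrArg (fun z => (e z).2) e1).symm.trans this.symm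

/-- A map to a vector bundle is smooth if its projection and its fibre coordinate are. -/
theorem SmoothCoordChange.smooth_into (hE : SmoothCoordChange M n E)
    (e : Trivialization (Fin n → ℂ) (π (Fin n → ℂ) E)) [MemTrivializationAtlas e]
    {f : X → TotalSpace (Fin n → ℂ) E} {S : Set X} {x : X} (hx : x ∈ S)
    (he : (f x).proj ∈ e.baseSet)
    (hp : ContMDiffWithinAt IX M.I ∞ (fun y => (f y).proj) S x)
    (hf : ContMDiffWithinAt IX 𝓘(ℝ, Fin n → ℂ) ∞ (fun y => (e (f y)).2) S x) :
    ContMDiffWithinAt IX (M.I.prod 𝓘(ℝ, Fin n → ℂ)) ∞ f S x := by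
  refine contMDiffWithinAt_totalSpace.2 ⟨hp, ?_⟩
  set e₀ := trivializationAt (Fin n → ℂ) E (f x).proj
  have he₀ : (f x).proj ∈ e₀.baseSet := mem_baseSet_trivializationAt _ _ _
  have hn : e.baseSet ∩ e₀.baseSet ∈ 𝓝 (f x).proj :=
    (e.open_baseSet.inter e₀.open_baseSet).mem_nhds ⟨he, he₀⟩
  have h1 := ((hE e e₀).contMDiffAt hn).comp_contMDiffWithinAt x hp
  refine (h1.complex_clm_apply hf).congr_of_eventuallyEq_of_mem ?_ hx
  filter_upwards [hp.continuousWithinAt hn] with y hy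
  have := e.coordChangeL_apply (R := ℂ) e₀ hy (e (f y)).2
  have e1 := congrArg (TotalSpace.mk (F := Fin n → ℂ) (f y).proj) (e.symm_proj_apply (f y) hy.1)
  exact (congrArg (fun z => (e₀ z).2) e1).symm.trans this.symm

end Smoothness

/-! ### The matrices of the action in local trivializations. -/

namespace TwistedVectorBundle

attribute [local instance] TwistedVectorBundle.addCommGroup TwistedVectorBundle.module
  TwistedVectorBundle.topE TwistedVectorBundle.topTotal TwistedVectorBundle.fiberBundle
  TwistedVectorBundle.vectorBundle

variable {M : SmoothMfd.{u}} {Γ : LieGroupoid M} {R : CentralExtension (𝓡 1) Circle Γ} {n : ℕ}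
  (W : TwistedVectorBundle R n)

/-- The trivialization near `i`. -/
noncomputable def triv (i : M) : Trivialization (Fin n → ℂ) (π (Fin n → ℂ) W.E) :=
  trivializationAt (Fin n → ℂ) W.E i

noncomputable instance (i : M) : MemTrivializationAtlas (W.triv i) :=
  inferInstanceAs (MemTrivializationAtlas (trivializationAt (Fin n → ℂ) W.E i))

/-- The neighbourhood of `i` over which the trivialization near `i` is defined. -/
noncomputable def base (i : M) : Opens M := ⟨(W.triv i).baseSet, (W.triv i).open_baseSet⟩

/-- The point over `x` with fibre coordinate `v`. -/
noncomputable def pt (k x : M) (v : Fin n → ℂ) : TotalSpace (Fin n → ℂ) W.E :=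
  ⟨x, (W.triv k).symm x v⟩

theorem pt_snd {k : M} {z : TotalSpace (Fin n → ℂ) W.E} {x : M} (hz : z.proj = x)
    (hx : x ∈ W.base k) : W.pt k x (W.triv k z).2 = z := by
  subst hz
  exact congrArg (TotalSpace.mk z.proj) ((W.triv k).symm_proj_apply z hx)

theorem triv_pt {k x : M} (hx : x ∈ W.base k) (v : Fin n → ℂ) : (W.triv k (W.pt k x v)).2 = v :=
  congrArg Prod.snd ((W.triv k).apply_mk_symm hx v)

theorem proj_act {r : R.R.arr} {z : TotalSpace (Fin n → ℂ) W.E} (hz : R.R.s r = z.proj) :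
    (W.act r z).proj = R.R.t r := by
  obtain ⟨L, hL⟩ := W.act_linear r
  obtain ⟨x, v⟩ := z
  change R.R.s r = x at hz
  subst hz
  rw [hL]

/-- The action of `r` in local coordinates, as a map. -/
noncomputable def matFun (i k : M) (r : R.R.arr) (v : Fin n → ℂ) : Fin n → ℂ :=
  (W.triv i (W.act r (W.pt k (R.R.s r) v))).2

/-- The action of `r` in local coordinates, as a linear map. -/
noncomputable def matCLM (i k : M) (r : R.R.arr) : (Fin n → ℂ) →L[ℂ] (Fin n → ℂ) :=
  LinearMap.toContinuousLinearMap (((W.triv i).linearMapAt ℂ (R.R.t r)) ∘ₗ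
    (W.act_linear r).choose ∘ₗ ((W.triv k).symmₗ ℂ (R.R.s r)))

theorem matCLM_apply {i k : M} {r : R.R.arr} (hr : r ∈ R.R.piece W.base (i, k))
    (v : Fin n → ℂ) : W.matCLM i k r v = W.matFun i k r v := by
  have h := (W.act_linear r).choose_spec ((W.triv k).symm (R.R.s r) v)
  change (W.triv i).linearMapAt ℂ (R.R.t r) ((W.act_linear r).choose
    ((W.triv k).symmₗ ℂ (R.R.s r) v)) = _
  unfold matFun pt
  rw [h, (W.triv i).coe_linearMapAt_of_mem (R := ℂ) hr.1, (W.triv k).symmₗ_apply (R := ℂ) hr.2]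

/-- Passing to the coordinate over the middle point and back is the identity there, so only the
action law of `R` remains. -/
theorem matFun_matFun {i k l : M} {r r' : R.R.arr} (hk : R.R.s r ∈ W.base k)
    (hc : R.R.s r = R.R.t r') (v : Fin n → ℂ) :
    W.matFun i k r (W.matFun k l r' v) = W.matFun i l (R.R.mul r r') v := by
  unfold matFun
  rw [W.pt_snd (by rw [W.proj_act rfl, hc]) hk, R.R.s_mul _ _ hc, W.mul_act _ _ _ hc rfl]

theorem matFun_one {i x : M} (hx : x ∈ W.base i) (v : Fin n → ℂ) :
    W.matFun i i (R.R.one x) v = v := by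
  have h := W.one_act (W.pt i x v)
  unfold matFun
  rw [R.R.s_one]
  exact (congrArg (fun z => (W.triv i z).2) h).trans (W.triv_pt hx v)

theorem matCLM_mul {i k l : M} {r r' : R.R.arr} (hr : r ∈ R.R.piece W.base (i, k))
    (hr' : r' ∈ R.R.piece W.base (k, l)) (hc : R.R.s r = R.R.t r') :
    W.matCLM i k r * W.matCLM k l r' = W.matCLM i l (R.R.mul r r') := by
  refine ContinuousLinearMap.ext fun v => ?_
  change W.matCLM i k r (W.matCLM k l r' v) = _
  rw [W.matCLM_apply hr, W.matCLM_apply hr', W.matFun_matFun hr.2 hc,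
    W.matCLM_apply (LieGroupoid.val_mul_mem hr hr' hc)]

theorem matCLM_one {i x : M} (hx : x ∈ W.base i) : W.matCLM i i (R.R.one x) = 1 := by
  refine ContinuousLinearMap.ext fun v => ?_
  rw [W.matCLM_apply (R.R.one_mem_piece hx hx), W.matFun_one hx]
  rfl

open Classical in
/-- The action of `r` in local coordinates, as an invertible linear map. -/
noncomputable def mat (i k : M) (r : R.R.arr) : GLn n :=
  if h : r ∈ R.R.piece W.base (i, k) then
    { val := W.matCLM i k r
      inv := W.matCLM k i (R.R.inv r)
      val_inv := by
        rw [W.matCLM_mul h (R.R.inv_mem_piece h) (R.R.t_inv r).symm, R.R.mul_inv,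
          W.matCLM_one h.1]
      inv_val := by
        rw [W.matCLM_mul (R.R.inv_mem_piece h) h (R.R.s_inv r), R.R.inv_mul,
          W.matCLM_one h.2] }
  else 1

theorem coe_mat {i k : M} {r : R.R.arr} (h : r ∈ R.R.piece W.base (i, k)) :
    (W.mat i k r : (Fin n → ℂ) →L[ℂ] (Fin n → ℂ)) = W.matCLM i k r := by
  rw [mat, dif_pos h]

/-- On a fixed vector `v` the matrix is a composition of smooth maps: the section over `s r` with
constant coordinate `v`, the action of `r`, and the fibre coordinate at the target. -/
theorem smooth_matCLM (i k : M) : ContMDiffOn R.R.arr.I 𝓘(ℝ, (Fin n → ℂ) →L[ℂ] (Fin n → ℂ)) ∞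
    (W.matCLM i k) (R.R.piece W.base (i, k)) := by
  have hE : SmoothCoordChange M n W.E := W.smooth_coordChange
  have hs : ContMDiff R.R.arr.I M.I ∞ R.R.s := R.R.s_submersion.1
  intro r hr
  refine contMDiffWithinAt_complex_clm fun v => ?_
  have h1 : ContMDiffWithinAt R.R.arr.I (M.I.prod 𝓘(ℝ, Fin n → ℂ)) ∞
      (fun r => W.pt k (R.R.s r) v) (R.R.piece W.base (i, k)) r := by
    refine hE.smooth_into (W.triv k) hr hr.2 hs.contMDiffAt.contMDiffWithinAt ?_
    exact contMDiffWithinAt_const.congr (fun q hq => W.triv_pt hq.2 v) (W.triv_pt hr.2 v)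
  have h2 : ContMDiffWithinAt R.R.arr.I (M.I.prod 𝓘(ℝ, Fin n → ℂ)) ∞
      (fun r => W.act r (W.pt k (R.R.s r) v)) (R.R.piece W.base (i, k)) r :=
    ContMDiffWithinAt.comp (g := fun q : R.R.arr × TotalSpace (Fin n → ℂ) W.E => W.act q.1 q.2)
      (t := {q : R.R.arr × TotalSpace (Fin n → ℂ) W.E | R.R.s q.1 = q.2.proj}) r
      (W.act_smooth _ rfl) (contMDiffWithinAt_id.prodMk h1) (fun q _ => rfl)
  refine (hE.snd_comp (W.triv i) h2 hr ?_).congr (fun q hq => W.matCLM_apply hq v)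
    (W.matCLM_apply hr v)
  rw [W.proj_act rfl]
  exact hr.1

/-- The local character of a twisted vector bundle. -/
noncomputable def localCharacter :
    LocalCharacter R 𝓘(ℝ, (Fin n → ℂ) →L[ℂ] (Fin n → ℂ)) (scalarGLn n) W.base where
  toFun := W.mat
  smooth i k r hr := contMDiffWithinAt_units
    ((W.smooth_matCLM i k r hr).congr (fun q hq => W.coe_mat hq) (W.coe_mat hr))
  map_mul i k l r r' hr hr' hc := by
    ext1
    rw [Units.val_mul, W.coe_mat hr, W.coe_mat hr', W.matCLM_mul hr hr' hc,
      W.coe_mat (LieGroupoid.val_mul_mem hr hr' hc)]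
  map_smul a i k r hr := by
    ext1
    rw [Units.val_mul, W.coe_mat hr, W.coe_mat (R.smul_mem_piece a hr)]
    refine ContinuousLinearMap.ext fun v => ?_
    change _ = (scalarGLn n a : (Fin n → ℂ) →L[ℂ] (Fin n → ℂ)) (W.matCLM i k r v)
    rw [scalarGLn_apply, W.matCLM_apply hr, W.matCLM_apply (R.smul_mem_piece a hr)]
    unfold matFun
    rw [R.s_smul, W.smul_act _ _ _ rfl]
    have hp : (W.act r (W.pt k (R.R.s r) v)).proj ∈ (W.triv i).baseSet := by
      rw [W.proj_act rfl]; exact hr.1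
    exact ((W.triv i).linear ℂ hp).map_smul (a : ℂ) _

theorem hasLocalCharacter (W : TwistedVectorBundle R n) :
    HasLocalCharacter R 𝓘(ℝ, (Fin n → ℂ) →L[ℂ] (Fin n → ℂ)) (scalarGLn n) :=
  ⟨M, W.base, fun x => ⟨x, mem_baseSet_trivializationAt _ _ _⟩, ⟨W.localCharacter⟩⟩

end TwistedVectorBundle

/-! ### The twisted vector bundle of a local character. -/

namespace LocalCharacter

variable {M : SmoothMfd.{u}} {Γ : LieGroupoid M} {R : CentralExtension (𝓡 1) Circle Γ} {n : ℕ}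
  {ι : Type u} {U : ι → Opens M}
  (χ : LocalCharacter R 𝓘(ℝ, (Fin n → ℂ) →L[ℂ] (Fin n → ℂ)) (scalarGLn n) U)
  (idx : M → ι) (h : ∀ x, x ∈ U (idx x))

/-- The vector bundle core of a local character. -/
noncomputable def vectorCore : VectorBundleCore ℂ M (Fin n → ℂ) ι where
  baseSet i := U i
  isOpen_baseSet i := (U i).isOpen
  indexAt := idx
  mem_baseSet_at := h
  -- The coordinate change goes from the coordinate over `U i` to the one over `U k`, and `χ k i` is
  -- the value on an arrow from `U i` to `U k`; hence the exchanged indices.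
  coordChange i k x := (χ.toFun k i (R.R.one x) : GLn n).val
  coordChange_self i x hx v := by rw [χ.map_one hx]; rfl
  continuousOn_coordChange i k :=
    (Units.continuous_val.comp_continuousOn ((χ.cocycle idx h).smooth k i).continuousOn).mono
      fun x hx => ⟨hx.2, hx.1⟩
  coordChange_comp i k l x hx v := by
    have := (χ.cocycle idx h).mul l k i x hx.2 hx.1.2 hx.1.1
    exact DFunLike.congr_fun (congrArg Units.val this) v

/-- The fibre coordinate over `U i`. -/
noncomputable def vcoord (i : ι) (z : (χ.vectorCore idx h).TotalSpace) : Fin n → ℂ :=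
  ((χ.vectorCore idx h).localTriv i z).2

/-- The point over `x` with fibre coordinate `v` in the trivialization at `x`. -/
def vpt (x : M) (v : Fin n → ℂ) : (χ.vectorCore idx h).TotalSpace :=
  ⟨x, v⟩

theorem vcoord_self (z : (χ.vectorCore idx h).TotalSpace) :
    χ.vcoord idx h (idx z.proj) z = z.2 :=
  congrArg Prod.snd ((χ.vectorCore idx h).localTrivAt_apply z)

theorem vpt_vcoord {x : M} {z : (χ.vectorCore idx h).TotalSpace} (hz : z.proj = x) :
    χ.vpt idx h x (χ.vcoord idx h (idx x) z) = z := by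
  subst hz
  exact congrArg (TotalSpace.mk z.proj) (χ.vcoord_self idx h z)

theorem vcoord_vpt (i : ι) (x : M) (v : Fin n → ℂ) :
    χ.vcoord idx h i (χ.vpt idx h x v) = (χ.toFun i (idx x) (R.R.one x)).val v := rfl

theorem vcoord_change {i k : ι} {z : (χ.vectorCore idx h).TotalSpace} {x : M} (hz : z.proj = x)
    (hi : x ∈ U i) (hk : x ∈ U k) :
    χ.vcoord idx h i z = (χ.toFun i k (R.R.one x)).val (χ.vcoord idx h k z) := by
  conv_lhs => rw [← χ.vpt_vcoord idx h hz]
  conv_rhs => rw [← χ.vpt_vcoord idx h hz]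
  rw [vcoord_vpt, vcoord_vpt]
  have := (χ.cocycle idx h).mul i k (idx x) x hi hk (h x)
  exact (DFunLike.congr_fun (congrArg Units.val this) _).symm

/-- The action of `R` on the vector bundle of a local character. -/
noncomputable def vact (r : R.R.arr) (z : (χ.vectorCore idx h).TotalSpace) :
    (χ.vectorCore idx h).TotalSpace :=
  χ.vpt idx h (R.R.t r)
    ((χ.toFun (idx (R.R.t r)) (idx (R.R.s r)) r).val (χ.vcoord idx h (idx (R.R.s r)) z))

/-- As for principal bundles, the units at both ends absorb the chosen indices, so every admissible
pair of coordinates sees the action as the matrix `χ i k (r)`. -/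
theorem vcoord_vact {i k : ι} {r : R.R.arr} {z : (χ.vectorCore idx h).TotalSpace}
    (hr : r ∈ R.R.piece U (i, k)) (hz : R.R.s r = z.proj) :
    χ.vcoord idx h i (χ.vact idx h r z) = (χ.toFun i k r).val (χ.vcoord idx h k z) := by
  rw [vact, vcoord_vpt, χ.vcoord_change idx h hz.symm (h _) hr.2]
  have h1 := χ.change_left (i := idx (R.R.t r)) (k := idx (R.R.s r)) ⟨h _, h _⟩ hr.1
  have h2 := χ.change_right (i := i) (k := idx (R.R.s r)) ⟨hr.1, h _⟩ hr.2
  rw [← h2, ← h1]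
  rfl

theorem ext_vcoord {i : ι} {z z' : (χ.vectorCore idx h).TotalSpace} {x : M} (hz : z.proj = x)
    (hz' : z'.proj = x) (hi : x ∈ U i) (e : χ.vcoord idx h i z = χ.vcoord idx h i z') :
    z = z' := by
  rw [← χ.vpt_vcoord idx h hz, ← χ.vpt_vcoord idx h hz', χ.vcoord_change idx h hz (h x) hi, e,
    χ.vcoord_change idx h hz' (h x) hi]

/-- The transition operators are the values of `χ` on units, which depend smoothly on the base
point. -/
theorem smoothCoordChange_vectorCore : SmoothCoordChange M n (χ.vectorCore idx h).Fiber := by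
  rintro - - ⟨i, rfl⟩ ⟨k, rfl⟩
  have h1 : ContMDiffOn M.I 𝓘(ℝ, (Fin n → ℂ) →L[ℂ] (Fin n → ℂ)) ∞
      (fun x => (χ.toFun k i (R.R.one x)).val) ((U i : Set M) ∩ U k) :=
    Units.contMDiff_val.comp_contMDiffOn (((χ.cocycle idx h).smooth k i).mono
      fun x hx => ⟨hx.2, hx.1⟩)
  refine h1.congr fun b hb => ?_
  ext v
  exact congrFun ((χ.vectorCore idx h).localTriv_coordChange_eq i k hb v) _

theorem smooth_vact : ContMDiffOn (R.R.arr.I.prod (M.I.prod 𝓘(ℝ, Fin n → ℂ)))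
    (M.I.prod 𝓘(ℝ, Fin n → ℂ)) ∞
    (fun q : R.R.arr × (χ.vectorCore idx h).TotalSpace => χ.vact idx h q.1 q.2)
    {q | R.R.s q.1 = q.2.proj} := by
  have hE := χ.smoothCoordChange_vectorCore idx h
  have ht : ContMDiff R.R.arr.I M.I ∞ R.R.t := R.R.t_submersion.1
  rintro ⟨r, z⟩ hrz
  change R.R.s r = z.proj at hrz
  let Z := χ.vectorCore idx h
  let i := idx (R.R.t r)
  let k := idx (R.R.s r)
  let S : Set (R.R.arr × Z.TotalSpace) := {q | R.R.s q.1 = q.2.proj}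
  let T : Set (R.R.arr × Z.TotalSpace) := {q | q.1 ∈ R.R.piece U (i, k)}
  have hr : r ∈ R.R.piece U (i, k) := ⟨h _, h _⟩
  have hT : T ∈ 𝓝 (r, z) := ((R.R.piece U (i, k)).isOpen.preimage continuous_fst).mem_nhds hr
  have hm : (r, z) ∈ S ∩ T := ⟨hrz, hr⟩
  refine ContMDiffWithinAt.mono_of_mem_nhdsWithin (s := S ∩ T) ?_
    (Filter.inter_mem self_mem_nhdsWithin (mem_nhdsWithin_of_mem_nhds hT))
  have mi : MemTrivializationAtlas (Z.localTriv i) := ⟨⟨i, rfl⟩⟩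
  have mk : MemTrivializationAtlas (Z.localTriv k) := ⟨⟨k, rfl⟩⟩
  refine hE.smooth_into (Z.localTriv i) hm hr.1 ?_ ?_
  · have h1 : ContMDiff (R.R.arr.I.prod (M.I.prod 𝓘(ℝ, Fin n → ℂ))) M.I ∞
      (fun q : R.R.arr × Z.TotalSpace => R.R.t q.1) := ht.comp contMDiff_fst
    exact h1.contMDiffAt.contMDiffWithinAt
  · have h1 : ContMDiffWithinAt (R.R.arr.I.prod (M.I.prod 𝓘(ℝ, Fin n → ℂ)))
        𝓘(ℝ, (Fin n → ℂ) →L[ℂ] (Fin n → ℂ)) ∞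
        (fun q : R.R.arr × Z.TotalSpace => (χ.toFun i k q.1).val) (S ∩ T) (r, z) :=
      (Units.contMDiff_val.comp_contMDiffOn (ContMDiffOn.comp (χ.smooth i k) contMDiffOn_fst
        fun q hq => hq.2)) _ hm
    have h2 := hE.snd_comp (Z.localTriv k) (f := fun q : R.R.arr × Z.TotalSpace => q.2)
      (IX := R.R.arr.I.prod (M.I.prod 𝓘(ℝ, Fin n → ℂ))) (S := S ∩ T) (x := (r, z))
      contMDiffWithinAt_snd hm (by rw [← hrz]; exact hr.2)
    exact (h1.complex_clm_apply h2).congr (fun q hq => χ.vcoord_vact idx h hq.2 hq.1)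
      (χ.vcoord_vact idx h hr hrz)

theorem vact_linear (r : R.R.arr) :
    ∃ L : (χ.vectorCore idx h).Fiber (R.R.s r) →ₗ[ℂ] (χ.vectorCore idx h).Fiber (R.R.t r),
      ∀ v, χ.vact idx h r ⟨R.R.s r, v⟩ = ⟨R.R.t r, L v⟩ := by
  refine ⟨((χ.toFun (idx (R.R.t r)) (idx (R.R.s r)) r).val : (Fin n → ℂ) →ₗ[ℂ] (Fin n → ℂ)),
    fun v => ?_⟩
  exact congrArg (χ.vpt idx h (R.R.t r)) (congrArg _ (χ.vcoord_self idx h ⟨R.R.s r, v⟩))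

/-- The twisted vector bundle of a local character. -/
noncomputable def twistedVectorBundle : TwistedVectorBundle R n where
  E := (χ.vectorCore idx h).Fiber
  smooth_coordChange := χ.smoothCoordChange_vectorCore idx h
  act := χ.vact idx h
  act_smooth := χ.smooth_vact idx h
  act_linear := χ.vact_linear idx h
  one_act z := by
    have e : R.R.s (R.R.one z.proj) = z.proj := R.R.s_one _
    refine χ.ext_vcoord idx h (x := z.proj) (i := idx z.proj) (R.R.t_one _) rfl (h _) ?_
    rw [χ.vcoord_vact idx h (R.R.one_mem_piece (h _) (h _)) e, χ.map_one (h _)]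
    rfl
  mul_act r r' z hc hz := by
    have e : R.R.t (R.R.mul r r') = R.R.t r := R.R.t_mul _ _ hc
    have e' : R.R.s (R.R.mul r r') = R.R.s r' := R.R.s_mul _ _ hc
    have hr : r ∈ R.R.piece U (idx (R.R.t r), idx (R.R.s r)) := ⟨h _, h _⟩
    have hr' : r' ∈ R.R.piece U (idx (R.R.s r), idx (R.R.s r')) := ⟨by rw [hc]; exact h _, h _⟩
    refine χ.ext_vcoord idx h (x := R.R.t r) (i := idx (R.R.t r)) e rfl (h _) ?_
    rw [χ.vcoord_vact idx h (k := idx (R.R.s r')) (LieGroupoid.val_mul_mem hr hr' hc)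
      (e'.trans hz), χ.vcoord_vact idx h (z := χ.vact idx h r' z) hr hc,
      χ.vcoord_vact idx h hr' hz, χ.map_mul _ _ _ _ _ hr hr' hc]
    rfl
  smul_act a r z hz := by
    have hr : r ∈ R.R.piece U (idx (R.R.t r), idx (R.R.s r)) := ⟨h _, h _⟩
    have hz' : R.R.s (R.smul a r) = z.proj := (R.s_smul a r).trans hz
    refine χ.ext_vcoord idx h (x := R.R.t r) (i := idx (R.R.t r)) (R.t_smul a r) rfl (h _) ?_
    rw [χ.vcoord_vact idx h (R.smul_mem_piece a hr) hz', χ.map_smul _ _ _ _ hr]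
    have h1 : χ.vcoord idx h (idx (R.R.t r)) (fiberSmul (a : ℂ) (χ.vact idx h r z)) =
        (a : ℂ) • χ.vcoord idx h (idx (R.R.t r)) (χ.vact idx h r z) :=
      (χ.toFun (idx (R.R.t r)) (idx (R.R.t r)) (R.R.one (R.R.t r))).val.map_smul (a : ℂ) _
    rw [h1, χ.vcoord_vact idx h hr hz]
    rfl

end LocalCharacter

/-- The matrices of the action form a local character; conversely the values on units glue a vector
bundle and the remaining values act on it. -/
theorem nonempty_twistedVectorBundle_iff {M : SmoothMfd.{u}} {Γ : LieGroupoid M}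
    (R : CentralExtension (𝓡 1) Circle Γ) (n : ℕ) :
    Nonempty (TwistedVectorBundle R n) ↔
      HasLocalCharacter R 𝓘(ℝ, (Fin n → ℂ) →L[ℂ] (Fin n → ℂ)) (scalarGLn n) := by
  refine ⟨fun ⟨W⟩ => W.hasLocalCharacter, ?_⟩
  rintro ⟨ι, U, hU, ⟨χ⟩⟩
  choose idx h using hU
  exact ⟨χ.twistedVectorBundle idx h⟩

end TwistedVectorBundles

/-! ### Fibres as torsors, and maps of weight `n` between extensions. -/

section Ratios

variable {EA HA : Type} [NormedAddCommGroup EA] [NormedSpace ℝ EA] [FiniteDimensional ℝ EA]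
  [TopologicalSpace HA] {IA : ModelWithCorners ℝ EA HA} [IA.Boundaryless]
  {A : Type} [TopologicalSpace A] [ChartedSpace HA A] [CommGroup A] [LieGroup IA ∞ A]
  {M : SmoothMfd.{u}} {Γ : LieGroupoid M}
  {EX HX X : Type*} [NormedAddCommGroup EX] [NormedSpace ℝ EX] [TopologicalSpace HX]
  {IX : ModelWithCorners ℝ EX HX} [TopologicalSpace X] [ChartedSpace HX X]

namespace CentralExtension
variable (Q : CentralExtension IA A Γ)

theorem smooth_π : ContMDiff Q.R.arr.I Γ.arr.I ∞ Q.π := Q.principal.smooth_proj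

/-- In a trivialization around the common image, two points of a fibre are multiples of the same
point, and the quotient of their coordinates carries one to the other. -/
theorem exists_smul_eq {p q : Q.R.arr} (h : Q.π p = Q.π q) : ∃ a, Q.smul a p = q := by
  obtain ⟨U, -, hp, σ, φ, -, -, h1, h2, h3⟩ := Q.principal.locally_trivial (Q.π p)
  refine ⟨φ q * (φ p)⁻¹, ?_⟩
  rw [← h3 p hp, ← h3 q (by rw [← h]; exact hp), Q.smul_smul, h, h2 _ (h ▸ hp), h2 _ (h ▸ hp),
    inv_mul_cancel_right]

theorem smul_left_injective {a b : A} {p : Q.R.arr} (h : Q.smul a p = Q.smul b p) : a = b := by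
  obtain ⟨U, -, hp, σ, φ, -, -, h1, h2, h3⟩ := Q.principal.locally_trivial (Q.π p)
  rw [← h3 p hp, Q.smul_smul, Q.smul_smul] at h
  have := congrArg φ h
  rw [h2 _ hp, h2 _ hp] at this
  exact mul_right_cancel this

open Classical in
/-- The element `a` with `a p = q`, for `p` and `q` over the same arrow of `Γ`. -/
noncomputable def ratio (p q : Q.R.arr) : A :=
  if h : Q.π p = Q.π q then (Q.exists_smul_eq h).choose else 1

theorem ratio_smul {p q : Q.R.arr} (h : Q.π p = Q.π q) : Q.smul (Q.ratio p q) p = q := by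
  rw [ratio, dif_pos h]
  exact (Q.exists_smul_eq h).choose_spec

theorem ratio_eq {a : A} {p q : Q.R.arr} (h : Q.smul a p = q) : Q.ratio p q = a := by
  refine Q.smul_left_injective (p := p) ?_
  rw [h, Q.ratio_smul]
  rw [← h, Q.π_smul]

/-- Locally the ratio is the quotient of the two fibre coordinates in one trivialization. -/
theorem smooth_ratio {f g : X → Q.R.arr} {S : Set X} {x : X} (hx : x ∈ S)
    (hf : ContMDiffWithinAt IX Q.R.arr.I ∞ f S x) (hg : ContMDiffWithinAt IX Q.R.arr.I ∞ g S x)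
    (hfg : ∀ y ∈ S, Q.π (f y) = Q.π (g y)) :
    ContMDiffWithinAt IX IA ∞ (fun y => Q.ratio (f y) (g y)) S x := by
  obtain ⟨U, hU, hp, σ, φ, -, hφ, h1, h2, h3⟩ := Q.principal.locally_trivial (Q.π (f x))
  have hV : IsOpen (Q.π ⁻¹' U) := hU.preimage Q.smooth_π.continuous
  have hp' : Q.π (g x) ∈ U := by rw [← hfg x hx]; exact hp
  have e1 := (hφ.contMDiffAt (hV.mem_nhds hp)).comp_contMDiffWithinAt x hf
  have e2 := (hφ.contMDiffAt (hV.mem_nhds hp')).comp_contMDiffWithinAt x hg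
  refine (e2.mul e1.inv).congr_of_eventuallyEq_of_mem ?_ hx
  filter_upwards [hf.continuousWithinAt (hV.mem_nhds hp), self_mem_nhdsWithin] with y hy hyS
  have hy' : Q.π (g y) ∈ U := by rw [← hfg y hyS]; exact hy
  refine Q.ratio_eq ?_
  change Q.smul (φ (g y) * (φ (f y))⁻¹) (f y) = g y
  conv_lhs => rw [← h3 (f y) hy]
  conv_rhs => rw [← h3 (g y) hy']
  rw [Q.smul_smul, h2 _ hy, inv_mul_cancel_right, hfg y hyS]

theorem exists_smooth_section (γ : Γ.arr) : ∃ (U : Set Γ.arr) (σ : Γ.arr → Q.R.arr),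
    IsOpen U ∧ γ ∈ U ∧ ContMDiffOn Γ.arr.I Q.R.arr.I ∞ σ U ∧ ∀ x ∈ U, Q.π (σ x) = x := by
  obtain ⟨U, hU, hp, σ, φ, hσ, -, h1, -⟩ := Q.principal.locally_trivial γ
  exact ⟨U, σ, hU, hp, hσ, h1⟩

theorem π_surjective : Function.Surjective Q.π := fun γ => by
  obtain ⟨U, σ, -, hγ, -, h⟩ := Q.exists_smooth_section γ
  exact ⟨σ γ, h γ hγ⟩

/-- `toData` keeps the trivializations chosen for `Q` but not their smoothness on `Q` itself. That
smoothness, recovered here and for the sections, is needed to compare the original manifold with one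
assembled from the data. -/
theorem smooth_toData_φ (i : Γ.arr) :
    ContMDiffOn Q.R.arr.I IA ∞ (show Q.R.arr → A from Q.toData.φ i) (Q.π ⁻¹' Q.toData.U i) :=
  (Q.principal.locally_trivial i).choose_spec.2.2.choose_spec.choose_spec.2.1

theorem smooth_toData_σ (i : Γ.arr) :
    ContMDiffOn Γ.arr.I Q.R.arr.I ∞ (show Γ.arr → Q.R.arr from Q.toData.σ i) (Q.toData.U i) :=
  (Q.principal.locally_trivial i).choose_spec.2.2.choose_spec.choose_spec.1

variable (R : CentralExtension IA A Γ)

/-- A smooth homomorphism `F : R → Q` of groupoids over `Γ` with `F (a r) = aⁿ F(r)`. -/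
structure IsPowerMap (n : ℕ) (F : R.R.arr → Q.R.arr) : Prop where
  smooth : ContMDiff R.R.arr.I Q.R.arr.I ∞ F
  map_π : ∀ r, Q.π (F r) = R.π r
  map_mul : ∀ r r', R.R.s r = R.R.t r' → F (R.R.mul r r') = Q.R.mul (F r) (F r')
  map_smul : ∀ a r, F (R.smul a r) = Q.smul (a ^ n) (F r)

variable {Q R} {n : ℕ} {F : R.R.arr → Q.R.arr} (hF : IsPowerMap Q R n F)

namespace IsPowerMap
include hF

theorem s_map (r : R.R.arr) : Q.R.s (F r) = R.R.s r := by rw [← Q.s_π, hF.map_π, R.s_π]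

theorem t_map (r : R.R.arr) : Q.R.t (F r) = R.R.t r := by rw [← Q.t_π, hF.map_π, R.t_π]

end IsPowerMap

/-- An equivariant smooth homomorphism of central extensions is an isomorphism. -/
theorem nonempty_iso (hF : IsPowerMap Q R 1 F) : Nonempty (Iso R Q) := by
  choose s hs using R.π_surjective
  -- The preimage chosen by `s` is arbitrary; rescaling it by the ratio makes `F` send it exactly to
  -- `q`.
  let G : Q.R.arr → R.R.arr := fun q => R.smul (Q.ratio (F (s (Q.π q))) q) (s (Q.π q))
  have hπ : ∀ q, Q.π (F (s (Q.π q))) = Q.π q := fun q => by rw [hF.map_π, hs]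
  have hFG : ∀ q, F (G q) = q := fun q => by
    simp only [G]
    rw [hF.map_smul, pow_one, Q.ratio_smul (hπ q)]
  have inj : ∀ r r', F r = F r' → R.π r = R.π r' → r = r' := fun r r' h h' => by
    obtain ⟨a, rfl⟩ := R.exists_smul_eq h'
    rw [hF.map_smul, pow_one] at h
    have := Q.smul_left_injective (p := F r) ((Q.one_smul _).trans h)
    rw [← this, R.one_smul]
  have πG : ∀ q, R.π (G q) = Q.π q := fun q => by
    simp only [G]
    rw [R.π_smul, hs]
  have hGF : ∀ r, G (F r) = r := fun r => inj _ _ (hFG _) (by rw [πG, hF.map_π])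
  have hG : ContMDiff Q.R.arr.I R.R.arr.I ∞ G := fun q => by
    obtain ⟨U, σ, hU, hq, hσ, h1⟩ := R.exists_smooth_section (Q.π q)
    have hV : IsOpen (Q.π ⁻¹' U) := hU.preimage Q.smooth_π.continuous
    have e1 : ContMDiffOn Q.R.arr.I R.R.arr.I ∞ (fun q => σ (Q.π q)) (Q.π ⁻¹' U) :=
      hσ.comp Q.smooth_π.contMDiffOn fun _ h => h
    have e2 : ContMDiffOn Q.R.arr.I IA ∞ (fun q => Q.ratio (F (σ (Q.π q))) q) (Q.π ⁻¹' U) :=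
      fun y hy => Q.smooth_ratio hy (hF.smooth.comp_contMDiffOn e1 y hy) contMDiffWithinAt_id
        fun z hz => by rw [hF.map_π, h1 _ hz]
    have e3 : ContMDiffOn Q.R.arr.I R.R.arr.I ∞
        (fun q => R.smul (Q.ratio (F (σ (Q.π q))) q) (σ (Q.π q))) (Q.π ⁻¹' U) :=
      R.smooth_smul.comp_contMDiffOn (e1.prodMk e2)
    -- The inverse does not depend on the preimage, since `F` is injective on each fibre; hence it
    -- agrees locally with the formula built from the smooth section.
    refine (e3.congr fun y hy => ?_).contMDiffAt (hV.mem_nhds hq)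
    refine inj _ _ ?_ ?_
    · rw [hFG, hF.map_smul, pow_one, Q.ratio_smul (by rw [hF.map_π, h1 _ hy])]
    · rw [πG, R.π_smul, h1 _ hy]
  exact ⟨{
    toDiffeomorph :=
      { toFun := F
        invFun := G
        left_inv := hGF
        right_inv := hFG
        contMDiff_toFun := hF.smooth
        contMDiff_invFun := hG }
    map_π := hF.map_π
    map_mul := hF.map_mul
    map_smul := fun a r => (hF.map_smul a r).trans (by rw [pow_one]; rfl) }⟩

/-- The homomorphism `r ↦ [F(r), r]` to a tensor product. -/
theorem IsPowerMap.tensor (hF : IsPowerMap Q R n F) :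
    ∃ F', IsPowerMap (Q.tensor R) R (n + 1) F' := by
  let D := Q.toData
  let D' := R.toData
  have hπ : ∀ r, D.π (F r) = D'.π r := hF.map_π
  let F' : R.R.arr → (D.tensor D').mfd := fun r => ExtensionData.tmk D D' (F r) r (hπ r)
  have hs : ContMDiff R.R.arr.I (D.tensor D').mfd.I ∞ F' := by
    intro r
    have hr : R.π r ∈ D.U (R.π r) ∩ D'.U (R.π r) := ⟨D.mem_U _, D'.mem_U _⟩
    have hV : IsOpen {q | R.π q ∈ D.U (R.π r) ∩ D'.U (R.π r)} :=
      ((D.isOpen_U _).inter (D'.isOpen_U _)).preimage R.smooth_π.continuous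
    refine ContMDiffWithinAt.contMDiffAt
      (s := {q | R.π q ∈ D.U (R.π r) ∩ D'.U (R.π r)}) ?_ (hV.mem_nhds hr)
    have e1 : ∀ q, (D.tensor D').π (F' q) = R.π q := hF.map_π
    refine (D.tensor D').smooth_into (f := F') hr (R.π r) ?_ ?_ ?_
    · rw [e1]; exact hr
    · simp only [e1]
      exact R.smooth_π.contMDiffAt.contMDiffWithinAt
    -- In the assembled tensor product the coordinate of `[F(q), q]` is the product of the two
    -- coordinates, each smooth on `R`.
    · have h1 : ContMDiffOn R.R.arr.I IA ∞
          (fun q => D.φ (R.π r) (F q) * D'.φ (R.π r) q)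
          {q | R.π q ∈ D.U (R.π r) ∩ D'.U (R.π r)} := by
        refine ContMDiffOn.mul ((Q.smooth_toData_φ (R.π r)).comp hF.smooth.contMDiffOn ?_)
          ((R.smooth_toData_φ (R.π r)).mono fun q hq => hq.2)
        intro q hq
        change Q.π (F q) ∈ Q.toData.U (R.π r)
        rw [hF.map_π]
        exact hq.1
      refine (h1.congr fun q hq => ?_) _ hr
      refine ExtensionData.tensorφ_mk (hπ q) ?_
      rw [hπ]
      exact hq
  refine ⟨F', hs, hF.map_π, fun r r' hc => ?_, fun a r => ?_⟩
  · refine Eq.trans ?_ (ExtensionData.tensorMul_mk (hπ r) (hπ r') ?_).symm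
    · exact ExtensionData.tmk_congr D D' (hF.map_mul r r' hc) rfl
    · change Γ.s (Q.π (F r)) = Γ.t (Q.π (F r'))
      rw [hF.map_π, hF.map_π, R.s_π, R.t_π, hc]
  -- One factor of `a` crosses the tensor sign: `[F(a r), a r] = [a F(a r), r] = [aⁿ⁺¹ F(r), r]`.
  · have h1 : D.smul (a ^ (n + 1)) (F r) = D.smul a (F (R.smul a r)) := by
      change Q.smul _ _ = Q.smul _ _
      rw [hF.map_smul, Q.smul_smul, pow_succ']
    have e1 : Q.π (Q.smul a (F (R.smul a r))) = R.π r := by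
      rw [Q.π_smul, hF.map_π, R.π_smul]
    have e2 : Q.π (F (R.smul a r)) = R.π r := by rw [hF.map_π, R.π_smul]
    refine Eq.trans ?_ (ExtensionData.tmk_congr D D' (h := e1) h1.symm rfl)
    exact (ExtensionData.tmk_smul D D' a (F (R.smul a r)) r e2 e1 _).symm

/-- The map `r ↦ r ⊗ ⋯ ⊗ r`, built one factor at a time. The induction starts from the identity at
exponent one, since `R.pow 1` is `R` itself. -/
theorem exists_isPowerMap_pow (R : CentralExtension IA A Γ) (n : ℕ) :
    ∃ F, IsPowerMap (R.pow (n + 1)) R (n + 1) F := by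
  induction n with
  | zero => exact ⟨id, contMDiff_id, fun _ => rfl, fun _ _ _ => rfl, fun a r =>
      congrArg (fun b => R.smul b r) (pow_one a).symm⟩
  | succ n ih =>
    obtain ⟨F, hF⟩ := ih
    exact hF.tensor

end CentralExtension
end Ratios

/-! ### Characters of `Rⁿ` of weight one and characters of `R` of weight `n`. -/

section PowerTransfer

namespace CentralExtension.IsPowerMap

variable {M : SmoothMfd.{u}} {Γ : LieGroupoid M} {R Q : CentralExtension (𝓡 1) Circle Γ} {n : ℕ}
  {F : R.R.arr → Q.R.arr} (hF : IsPowerMap Q R n F) {ι : Type u} {U : ι → Opens M}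

/-- The pull-back of a local character along a power map. -/
noncomputable def pullback (χ : LocalCharacter Q (𝓡 1) (MonoidHom.id Circle) U) :
    LocalCharacter R (𝓡 1) (powMonoidHom n) U where
  toFun i k r := χ.toFun i k (F r)
  smooth i k := (χ.smooth i k).comp hF.smooth.contMDiffOn fun r hr =>
    mem_piece_of_π (hF.map_π r) ⟨by rw [R.t_π]; exact hr.1, by rw [R.s_π]; exact hr.2⟩
  map_mul i k l r r' hr hr' hc := by
    rw [hF.map_mul r r' hc]
    refine χ.map_mul i k l _ _ ?_ ?_ (by rw [hF.s_map, hF.t_map, hc])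
    · exact ⟨by rw [hF.t_map]; exact hr.1, by rw [hF.s_map]; exact hr.2⟩
    · exact ⟨by rw [hF.t_map]; exact hr'.1, by rw [hF.s_map]; exact hr'.2⟩
  map_smul a i k r hr := by
    rw [hF.map_smul]
    exact χ.map_smul _ i k _ ⟨by rw [hF.t_map]; exact hr.1, by rw [hF.s_map]; exact hr.2⟩

include hF in
/-- The extension of a local character along a power map. -/
theorem nonempty_pushforward (χ : LocalCharacter R (𝓡 1) (powMonoidHom n) U) :
    Nonempty (LocalCharacter Q (𝓡 1) (MonoidHom.id Circle) U) := by
  choose s hs using R.π_surjective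
  have hpR : ∀ {i k r γ}, R.π r = γ → γ ∈ Γ.piece U (i, k) → r ∈ R.R.piece U (i, k) :=
    fun h h' => mem_piece_of_π h h'
  have hpQ : ∀ {i k p}, p ∈ Q.R.piece U (i, k) → Q.π p ∈ Γ.piece U (i, k) :=
    fun h => ⟨by rw [Q.t_π]; exact h.1, by rw [Q.s_π]; exact h.2⟩
  -- If `p = c F(r)`, then equivariance and the prescribed value `χ(r)` on `F(r)` force the value `c
  -- χ(r)` on `p`.
  let f : ι → ι → Q.R.arr → Circle := fun i k p =>
    Q.ratio (F (s (Q.π p))) p * χ.toFun i k (s (Q.π p))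
  -- Replacing `r` by `a r` multiplies the ratio by `a⁻ⁿ` and `χ` by `aⁿ`. So any `r` over the same
  -- arrow may be used: the value of a smooth local section to prove smoothness, a product to prove
  -- multiplicativity.
  have key : ∀ {i k p r}, p ∈ Q.R.piece U (i, k) → R.π r = Q.π p →
      f i k p = Q.ratio (F r) p * χ.toFun i k r := by
    intro i k p r hp hr
    have hsp := hs (Q.π p)
    obtain ⟨a, ha⟩ := R.exists_smul_eq (hr.trans hsp.symm)
    have h1 : Q.ratio (F r) p = Q.ratio (F (s (Q.π p))) p * a ^ n := by
      refine Q.ratio_eq ?_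
      rw [← Q.smul_smul, ← hF.map_smul, ha, Q.ratio_smul (by rw [hF.map_π, hsp])]
    have h2 : χ.toFun i k (s (Q.π p)) = a ^ n * χ.toFun i k r := by
      rw [← ha, χ.map_smul _ _ _ _ (hpR hr (hpQ hp))]
      rfl
    simp only [f]
    rw [h1, h2, mul_assoc]
  refine ⟨⟨f, fun i k p hp => ?_, fun i k l p p' hp hp' hc => ?_, fun a i k p hp => ?_⟩⟩
  · obtain ⟨V, σ, hV, hpV, hσ, h1⟩ := R.exists_smooth_section (Q.π p)
    have hW : IsOpen (Q.π ⁻¹' V ∩ Q.R.piece U (i, k)) :=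
      (hV.preimage Q.smooth_π.continuous).inter (Q.R.piece U (i, k)).isOpen
    have e1 : ContMDiffOn Q.R.arr.I R.R.arr.I ∞ (fun q => σ (Q.π q))
        (Q.π ⁻¹' V ∩ Q.R.piece U (i, k)) := hσ.comp Q.smooth_π.contMDiffOn fun _ h => h.1
    have e2 : ContMDiffOn Q.R.arr.I (𝓡 1) ∞ (fun q => Q.ratio (F (σ (Q.π q))) q)
        (Q.π ⁻¹' V ∩ Q.R.piece U (i, k)) :=
      fun y hy => Q.smooth_ratio hy (hF.smooth.comp_contMDiffOn e1 y hy) contMDiffWithinAt_id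
        fun z hz => by rw [hF.map_π, h1 _ hz.1]
    have e3 : ContMDiffOn Q.R.arr.I (𝓡 1) ∞ (fun q => χ.toFun i k (σ (Q.π q)))
        (Q.π ⁻¹' V ∩ Q.R.piece U (i, k)) :=
      (χ.smooth i k).comp e1 fun q hq => hpR (h1 _ hq.1) (hpQ hq.2)
    exact (((e2.mul e3).congr fun q hq => key hq.2 (h1 _ hq.1)).contMDiffAt
      (hW.mem_nhds ⟨hpV, hp⟩)).contMDiffWithinAt
  · have h1 := hs (Q.π p)
    have h2 := hs (Q.π p')
    have hc' : R.R.s (s (Q.π p)) = R.R.t (s (Q.π p')) := by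
      rw [← R.s_π, ← R.t_π, h1, h2, Q.s_π, Q.t_π, hc]
    rw [key hp h1, key hp' h2, key (LieGroupoid.val_mul_mem hp hp' hc)
      (r := R.R.mul (s (Q.π p)) (s (Q.π p'))) (by rw [R.π_mul _ _ hc', Q.π_mul _ _ hc, h1, h2]),
      χ.map_mul i k l _ _ (hpR h1 (hpQ hp)) (hpR h2 (hpQ hp')) hc', mul_mul_mul_comm]
    congr 1
    refine Q.ratio_eq ?_
    rw [hF.map_mul _ _ hc', ← Q.smul_mul_smul _ _ _ _ (by rw [hF.s_map, hF.t_map, hc']),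
      Q.ratio_smul (by rw [hF.map_π, h1]), Q.ratio_smul (by rw [hF.map_π, h2])]
  · have h1 := hs (Q.π p)
    rw [key hp h1, key (Q.smul_mem_piece a hp) (h1.trans (Q.π_smul a p).symm), ← mul_assoc]
    congr 1
    refine Q.ratio_eq ?_
    rw [MonoidHom.id_apply, ← Q.smul_smul, Q.ratio_smul (by rw [hF.map_π, h1])]

end CentralExtension.IsPowerMap

/-- Both directions go along the map `r ↦ r ⊗ ⋯ ⊗ r`, by restriction and by equivariant extension,
and keep the cover. -/
theorem hasLocalCharacter_pow_iff {M : SmoothMfd.{u}} {Γ : LieGroupoid M}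
    (R : CentralExtension (𝓡 1) Circle Γ) (n : ℕ) [NeZero n] :
    HasLocalCharacter (R.pow n) (𝓡 1) (MonoidHom.id Circle) ↔
      HasLocalCharacter R (𝓡 1) (powMonoidHom n : Circle →* Circle) := by
  obtain ⟨m, rfl⟩ : ∃ m, n = m + 1 := Nat.exists_eq_succ_of_ne_zero (NeZero.ne n)
  obtain ⟨F, hF⟩ := R.exists_isPowerMap_pow m
  refine exists_congr fun ι => exists_congr fun U => and_congr_right fun _ => ?_
  exact ⟨fun ⟨χ⟩ => ⟨hF.pullback χ⟩, fun ⟨χ⟩ => hF.nonempty_pushforward χ⟩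

end PowerTransfer

/-! ### Kernels of characters and extensions by roots of unity. -/

section RootsOfUnity

variable {M : SmoothMfd.{u}} {Γ : LieGroupoid M} {n : ℕ}

/-- Continuity into a discrete space means local constancy on `S`. -/
theorem contMDiffOn_of_continuousOn_of_discrete {EX HX X EG HG G : Type*}
    [NormedAddCommGroup EX] [NormedSpace ℝ EX] [TopologicalSpace HX]
    {IX : ModelWithCorners ℝ EX HX} [TopologicalSpace X] [ChartedSpace HX X]
    [NormedAddCommGroup EG] [NormedSpace ℝ EG] [TopologicalSpace HG]
    {IG : ModelWithCorners ℝ EG HG} [TopologicalSpace G] [ChartedSpace HG G] [DiscreteTopology G]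
    {f : X → G} {S : Set X} (hf : ContinuousOn f S) : ContMDiffOn IX IG ∞ f S := fun x hx =>
  (contMDiffWithinAt_const (c := f x)).congr_of_eventuallyEq_of_mem
    (hf x hx ((isOpen_discrete {f x}).mem_nhds rfl)) hx

namespace IsCharacter

section Kernel
variable [NeZero n] {Q : CentralExtension (𝓡 1) Circle Γ} {ψ : Q.R.arr → Circle}
  (hψ : IsCharacter Q (𝓡 1) (powMonoidHom n : Circle →* Circle) ψ)

-- Dividing a local section by a local `n`-th root of its value under `ψ` moves it into the kernel,
-- because `ψ` has weight `n`.
include hψ in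
theorem exists_smooth_section (γ : Γ.arr) : ∃ (U : Set Γ.arr) (τ : Γ.arr → Q.R.arr),
    IsOpen U ∧ γ ∈ U ∧ ContMDiffOn Γ.arr.I Q.R.arr.I ∞ τ U ∧ (∀ x ∈ U, Q.π (τ x) = x) ∧
      ∀ x ∈ U, ψ (τ x) = 1 := by
  obtain ⟨W, σ, hW, hγ, hσ, h1⟩ := Q.exists_smooth_section γ
  obtain ⟨V, ρ, hV, hγV, hρ, hρn⟩ := exists_local_root n (NeZero.ne n) (ψ (σ γ))
  have h2 : ContMDiffOn Γ.arr.I (𝓡 1) ∞ (fun x => ψ (σ x)) W := hψ.smooth.comp_contMDiffOn hσ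
  have h3 : ContMDiffOn Γ.arr.I (𝓡 1) ∞ (fun x => ρ (ψ (σ x)))
      (W ∩ (fun x => ψ (σ x)) ⁻¹' V) :=
    hρ.comp (h2.mono Set.inter_subset_left) fun x hx => hx.2
  refine ⟨W ∩ (fun x => ψ (σ x)) ⁻¹' V, fun x => Q.smul (ρ (ψ (σ x)))⁻¹ (σ x),
    h2.continuousOn.isOpen_inter_preimage hW hV, ⟨hγ, hγV⟩, ?_, fun x hx => ?_, fun x _ => ?_⟩
  · exact Q.smooth_smul.comp_contMDiffOn ((hσ.mono Set.inter_subset_left).prodMk h3.inv)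
  · rw [Q.π_smul, h1 x hx.1]
  · rw [hψ.map_smul, powMonoidHom_apply, inv_pow, hρn, inv_mul_cancel]

open Classical in
/-- The kernel of a character of weight `n`, as an extension by the `n`-th roots of unity. -/
noncomputable def kernelData : ExtensionData (𝓡 0) (MuN n) Γ :=
  let U := fun γ => (hψ.exists_smooth_section γ).choose
  let τ := fun γ => (hψ.exists_smooth_section γ).choose_spec.choose
  have h := fun γ => (hψ.exists_smooth_section γ).choose_spec.choose_spec
  -- A fallback in the kernel is needed where `τ i` leaves it. A unit arrow serves, and is never
  -- used over `U i`.
  let σ : Γ.arr → Γ.arr → {r : Q.R.arr // ψ r = 1} := fun i γ =>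
    if h : ψ (τ i γ) = 1 then ⟨τ i γ, h⟩ else ⟨Q.R.one (Γ.t γ), hψ.map_one _⟩
  let φ : Γ.arr → {r : Q.R.arr // ψ r = 1} → MuN n := fun i p =>
    if h : Q.ratio (τ i (Q.π p.1)) p.1 ∈ MuN n then ⟨_, h⟩ else 1
  have hσ : ∀ i, ∀ γ ∈ U i, (σ i γ).1 = τ i γ := fun i γ hγ =>
    congrArg Subtype.val (dif_pos ((h i).2.2.2.2 γ hγ))
  -- Two elements of the kernel over the same arrow differ by some `ζ`, and comparing their values
  -- under `ψ` gives `ζⁿ = 1`.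
  have hφ : ∀ i p, Q.π p.1 ∈ U i → (φ i p : Circle) = Q.ratio (τ i (Q.π p.1)) p.1 := by
    intro i p hp
    refine congrArg Subtype.val (dif_pos ?_)
    have e1 := Q.ratio_smul ((h i).2.2.2.1 _ hp)
    have e2 := hψ.map_smul (Q.ratio (τ i (Q.π p.1)) p.1) (τ i (Q.π p.1))
    rw [e1, p.2, (h i).2.2.2.2 _ hp, mul_one] at e2
    exact e2.symm
  -- Since `μ_n` is discrete, coordinates need only be continuous, and this can be tested in `S¹`,
  -- where they are smooth ratios. All four smoothness conditions below reduce to this.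
  have hs : ∀ {EX HX X : Type u} [NormedAddCommGroup EX] [NormedSpace ℝ EX] [TopologicalSpace HX]
      {IX : ModelWithCorners ℝ EX HX} [TopologicalSpace X] [ChartedSpace HX X]
      (j : Γ.arr) (f : X → {r : Q.R.arr // ψ r = 1}) (S : Set X),
      ContMDiffOn IX Q.R.arr.I ∞ (fun x => (f x).1) S → (∀ x ∈ S, Q.π (f x).1 ∈ U j) →
      ContMDiffOn IX (𝓡 0) ∞ (fun x => φ j (f x)) S := by
    intro EX HX X _ _ _ IX _ _ j f S hf hS
    refine contMDiffOn_of_continuousOn_of_discrete (Topology.IsInducing.subtypeVal.continuousOn_iff.2 ?_)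
    have e1 : ContMDiffOn IX Q.R.arr.I ∞ (fun x => τ j (Q.π (f x).1)) S :=
      (h j).2.2.1.comp (Q.smooth_π.comp_contMDiffOn hf) hS
    have e2 : ContMDiffOn IX (𝓡 1) ∞ (fun x => Q.ratio (τ j (Q.π (f x).1)) (f x).1) S :=
      fun x hx => Q.smooth_ratio hx (e1 x hx) (hf x hx) fun y hy => (h j).2.2.2.1 _ (hS y hy)
    exact e2.continuousOn.congr fun x hx => hφ j (f x) (hS x hx)
  have hm : ∀ r r' : Q.R.arr, ψ r = 1 → ψ r' = 1 → Q.R.s r = Q.R.t r' →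
      ψ (Q.R.mul r r') = 1 := fun r r' hr hr' hc => by rw [hψ.map_mul r r' hc, hr, hr', mul_one]
  let mul : {r : Q.R.arr // ψ r = 1} → {r : Q.R.arr // ψ r = 1} → {r : Q.R.arr // ψ r = 1} :=
    fun p q => if hc : Q.R.s p.1 = Q.R.t q.1 then ⟨_, hm _ _ p.2 q.2 hc⟩ else p
  have hmul : ∀ p q, Q.R.s p.1 = Q.R.t q.1 → (mul p q).1 = Q.R.mul p.1 q.1 := fun p q hc =>
    congrArg Subtype.val (dif_pos hc)
  have hc : ∀ p q : Q.R.arr, Γ.s (Q.π p) = Γ.t (Q.π q) ↔ Q.R.s p = Q.R.t q := fun p q => by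
    rw [Q.s_π, Q.t_π]
  { P := {r : Q.R.arr // ψ r = 1}
    π := fun p => Q.π p.1
    one := fun x => ⟨Q.R.one x, hψ.map_one x⟩
    inv := fun p => ⟨Q.R.inv p.1, by rw [hψ.map_inv, p.2, inv_one]⟩
    mul := mul
    smul := fun a p => ⟨Q.smul a p.1, by
      rw [hψ.map_smul, p.2, mul_one]
      exact a.2⟩
    π_one := Q.π_one
    π_inv := fun p => Q.π_inv p.1
    π_mul := fun p q hpq => by
      rw [hc] at hpq
      rw [hmul p q hpq, Q.π_mul _ _ hpq]
    π_smul := fun a p => Q.π_smul _ _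
    one_mul := fun p => Subtype.ext ((hmul _ _ (by
      change Q.R.s (Q.R.one _) = _
      rw [Q.R.s_one, Q.t_π])).trans (by
      change Q.R.mul (Q.R.one _) _ = _
      rw [Q.t_π, Q.R.one_mul]))
    mul_one := fun p => Subtype.ext ((hmul _ _ (by
      change _ = Q.R.t (Q.R.one _)
      rw [Q.R.t_one, Q.s_π])).trans (by
      change Q.R.mul _ (Q.R.one _) = _
      rw [Q.s_π, Q.R.mul_one]))
    inv_mul := fun p => Subtype.ext ((hmul _ _ (Q.R.s_inv _)).trans (by
      rw [Q.R.inv_mul, Q.s_π]))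
    mul_inv := fun p => Subtype.ext ((hmul _ _ (Q.R.t_inv _).symm).trans (by
      rw [Q.R.mul_inv, Q.t_π]))
    assoc := fun p q r hpq hqr => by
      rw [hc] at hpq hqr
      refine Subtype.ext ?_
      rw [hmul _ _ (by rw [hmul _ _ hpq, Q.R.s_mul _ _ hpq, hqr]), hmul _ _ hpq,
        hmul _ _ (by rw [hmul _ _ hqr, Q.R.t_mul _ _ hqr, hpq]), hmul _ _ hqr,
        Q.R.assoc _ _ _ hpq hqr]
    one_smul := fun p => Subtype.ext (Q.one_smul _)
    smul_smul := fun a b p => Subtype.ext (Q.smul_smul _ _ _)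
    smul_mul_smul := fun a b p q hpq => by
      rw [hc] at hpq
      refine Subtype.ext ?_
      rw [hmul _ _ (by
        change Q.R.s (Q.smul _ _) = Q.R.t (Q.smul _ _)
        rw [Q.s_smul, Q.t_smul, hpq])]
      change Q.R.mul (Q.smul a p.1) (Q.smul b q.1) = Q.smul (a * b) (mul p q).1
      rw [hmul _ _ hpq, Q.smul_mul_smul _ _ _ _ hpq]
    U := U
    σ := σ
    φ := φ
    isOpen_U := fun i => (h i).1
    mem_U := fun i => (h i).2.1
    π_σ := fun i γ hγ => by rw [hσ i γ hγ, (h i).2.2.2.1 γ hγ]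
    φ_smul_σ := fun i γ hγ a => by
      have e1 : Q.π (Q.smul a (σ i γ).1) = γ := by
        rw [Q.π_smul, hσ i γ hγ, (h i).2.2.2.1 γ hγ]
      refine Subtype.ext ((hφ i _ (by rw [e1]; exact hγ)).trans (Q.ratio_eq ?_))
      change Q.smul a (τ i (Q.π (Q.smul a (σ i γ).1))) = Q.smul a (σ i γ).1
      rw [e1, hσ i γ hγ]
    φ_smul := fun i p hp => Subtype.ext (by
      change Q.smul (φ i p) (σ i (Q.π p.1)).1 = p.1
      rw [hφ i p hp, hσ i _ hp, Q.ratio_smul ((h i).2.2.2.1 _ hp)])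
    smooth_trans := fun i j => hs j _ _
      (((h i).2.2.1.mono Set.inter_subset_left).congr fun x hx => hσ i x hx.1)
      fun x hx => by rw [hσ i x hx.1, (h i).2.2.2.1 x hx.1]; exact hx.2
    smooth_one := fun i => hs i _ _ (ContMDiff.contMDiffOn Q.R.one_smooth)
      fun x hx => by
        change Q.π (Q.R.one x) ∈ U i
        rw [Q.π_one]
        exact hx
    smooth_inv := fun i j => hs j _ _
      (ContMDiff.comp_contMDiffOn (g := Q.R.inv) Q.R.inv_smooth
        (((h i).2.2.1.mono Set.inter_subset_left).congr fun x hx => hσ i x hx.1))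
      fun x hx => by
        change Q.π (Q.R.inv (σ i x).1) ∈ U j
        rw [Q.π_inv, hσ i x hx.1, (h i).2.2.2.1 x hx.1]
        exact hx.2
    smooth_mul := fun i j k => by
      have e0 : ∀ q : Γ.arr × Γ.arr, Γ.s q.1 = Γ.t q.2 ∧ q.1 ∈ U i ∧ q.2 ∈ U j ∧
          Γ.mul q.1 q.2 ∈ U k → Q.R.s (σ i q.1).1 = Q.R.t (σ j q.2).1 := by
        rintro q ⟨h1, h2, h3, -⟩
        rw [← hc, hσ i _ h2, hσ j _ h3, (h i).2.2.2.1 _ h2, (h j).2.2.2.1 _ h3, h1]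
      refine hs k _ _ ?_ fun q hq => ?_
      · refine (ContMDiffOn.comp (g := fun q : Q.R.arr × Q.R.arr => Q.R.mul q.1 q.2)
          (f := fun q : Γ.arr × Γ.arr => ((σ i q.1).1, (σ j q.2).1))
          Q.R.mul_smooth (ContMDiffOn.prodMk ?_ ?_) e0).congr fun q hq => hmul _ _ (e0 q hq)
        · exact ((h i).2.2.1.comp contMDiffOn_fst fun q hq => hq.2.1).congr
            fun q hq => hσ i _ hq.2.1
        · exact ((h j).2.2.1.comp contMDiffOn_snd fun q hq => hq.2.2.1).congr
            fun q hq => hσ j _ hq.2.2.1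
      · rw [hmul _ _ (e0 q hq), Q.π_mul _ _ (e0 q hq), hσ i _ hq.2.1, hσ j _ hq.2.2.1,
          (h i).2.2.2.1 _ hq.2.1, (h j).2.2.2.1 _ hq.2.2.1]
        exact hq.2.2.2 }

/-- The inclusion of the kernel of a character. -/
def kernelVal (p : hψ.kernelData.mfd) : Q.R.arr := Subtype.val (p := fun r => ψ r = 1) p

/-- The kernel carries the manifold structure glued from its trivializations, not a submanifold
structure. In these the inclusion is `(γ, ζ) ↦ ζ τ(γ)`, with `τ` a smooth section of `Q`. -/
theorem smooth_kernelVal : ContMDiff hψ.kernelData.mfd.I Q.R.arr.I ∞ hψ.kernelVal := by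
  intro p
  let K := hψ.kernelData
  let i := K.π p
  have hV := K.isOpen_dom i
  have h0 : ContMDiffOn Γ.arr.I Q.R.arr.I ∞
      (hψ.exists_smooth_section i).choose_spec.choose (K.U i) :=
    (hψ.exists_smooth_section i).choose_spec.choose_spec.2.2.1
  have h1 : ContMDiffOn Γ.arr.I Q.R.arr.I ∞ (fun γ => hψ.kernelVal (K.σ i γ)) (K.U i) :=
    h0.congr fun γ hγ => congrArg Subtype.val
      (dif_pos ((hψ.exists_smooth_section i).choose_spec.choose_spec.2.2.2.2 γ hγ))
  have h2 : ContMDiffOn K.mfd.I Q.R.arr.I ∞ (fun p : K.mfd => hψ.kernelVal (K.σ i (K.π p)))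
      {p : K.mfd | K.π p ∈ K.U i} := h1.comp (ContMDiff.contMDiffOn K.smooth_π) fun _ h => h
  have h3 : ContMDiffOn K.mfd.I (𝓡 1) ∞ (fun p : K.mfd => (MuN n).subtype (K.φ i p))
      {p : K.mfd | K.π p ∈ K.U i} := (contMDiff_MuN_subtype n).comp_contMDiffOn (K.smooth_φ i)
  refine ((Q.smooth_smul.comp_contMDiffOn (h2.prodMk h3)).congr fun q hq => ?_).contMDiffAt
    (hV.mem_nhds (K.mem_U i))
  exact congrArg hψ.kernelVal (K.φ_smul i q hq).symm

/-- The map is `[r, λ] ↦ λ r`, well defined because `[ζ r, λ]` and `[r, ζ λ]` both go to `ζ λ r`.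
Having weight one, it is an isomorphism by `nonempty_iso`. -/
theorem exists_isPowerMap_assocExt : ∃ F, CentralExtension.IsPowerMap Q
    (hψ.kernelData.toCentralExtension.assocExt (MuN n).subtype (contMDiff_MuN_subtype n)) 1 F := by
  let K := hψ.kernelData.toCentralExtension
  let D := K.toData
  let v : D.P → Q.R.arr := hψ.kernelVal
  let B := D.assocExt (MuN n).subtype (contMDiff_MuN_subtype n)
  let F : B.mfd → Q.R.arr := Quotient.lift (fun q : D.P × Circle => Q.smul q.2 (v q.1)) (by
    rintro p q ⟨a, h, h'⟩
    have : v (D.smul a q.1) = Q.smul a (v q.1) := rfl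
    rw [h, h', this, Q.smul_smul, mul_comm]
    rfl)
  have hF : ContMDiff B.mfd.I Q.R.arr.I ∞ F := by
    intro x
    let i := B.π x
    have h1 : ContMDiffOn Γ.arr.I Q.R.arr.I ∞ (fun γ => v (D.σ i γ)) (D.U i) :=
      hψ.smooth_kernelVal.comp_contMDiffOn (K.smooth_toData_σ i)
    have h2 : ContMDiffOn B.mfd.I Q.R.arr.I ∞ (fun y : B.mfd => v (D.σ i (B.π y)))
        {y : B.mfd | B.π y ∈ B.U i} := h1.comp (ContMDiff.contMDiffOn B.smooth_π) fun _ h => h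
    refine ((Q.smooth_smul.comp_contMDiffOn (h2.prodMk (B.smooth_φ i))).congr
      fun y hy => ?_).contMDiffAt ((B.isOpen_dom i).mem_nhds (B.mem_U i))
    refine (congrArg F (B.φ_smul i y hy).symm).trans ?_
    change Q.smul (B.φ i y * 1) (v (D.σ i (B.π y))) = Q.smul (B.φ i y) (v (D.σ i (B.π y)))
    rw [mul_one]
  have hv : ∀ p, Q.π (v p) = D.π p := fun p => rfl
  refine ⟨F, hF, ExtensionData.amk_ind fun p b => ?_, ?_, fun a => ExtensionData.amk_ind
    fun p b => ?_⟩
  · exact Q.π_smul b (v p)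
  · refine ExtensionData.amk_ind fun p b => ExtensionData.amk_ind fun p' b' hc => ?_
    change Γ.s (D.π p) = Γ.t (D.π p') at hc
    have hc' : Q.R.s (v p) = Q.R.t (v p') := by rw [← Q.s_π, ← Q.t_π, hv, hv, hc]
    refine (congrArg F (ExtensionData.assocMul_mk b b' hc)).trans ?_
    change Q.smul (b * b') (v (D.mul p p')) = Q.R.mul (Q.smul b (v p)) (Q.smul b' (v p'))
    rw [Q.smul_mul_smul _ _ _ _ hc']
    exact congrArg _ (congrArg Subtype.val (dif_pos hc'))
  · change Q.smul (a * b) (v p) = Q.smul (a ^ 1) (Q.smul b (v p))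
    rw [pow_one, Q.smul_smul]

end Kernel

/-- The character is `[r, λ] ↦ λⁿ`: the `n`-th power does not see a factor in `μ_n`. -/
theorem exists_assocExt [NeZero n] (R' : CentralExtension (𝓡 0) (MuN n) Γ) :
    ∃ χ, IsCharacter (R'.assocExt (MuN n).subtype (contMDiff_MuN_subtype n)) (𝓡 1)
      (powMonoidHom n : Circle →* Circle) χ := by
  let D := R'.toData
  let B := D.assocExt (MuN n).subtype (contMDiff_MuN_subtype n)
  have hζ : ∀ ζ : MuN n, (ζ : Circle) ^ n = 1 := fun ζ => ζ.2
  let χ : B.mfd → Circle := Quotient.lift (fun q : D.P × Circle => q.2 ^ n) (by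
    rintro p q ⟨a, h, h'⟩
    rw [h', mul_pow, Subgroup.subtype_apply, hζ, one_mul])
  have hχ : ContMDiff B.mfd.I (𝓡 1) ∞ χ := by
    intro x
    refine (((B.smooth_φ (B.π x)).pow n).congr fun y hy => ?_).contMDiffAt
      ((B.isOpen_dom _).mem_nhds (B.mem_U _))
    refine (congrArg χ (B.φ_smul (B.π x) y hy).symm).trans ?_
    change (B.φ (B.π x) y * 1) ^ n = _
    rw [mul_one]
  refine ⟨χ, hχ, ExtensionData.amk_ind fun p b => ExtensionData.amk_ind fun p' b' hc => ?_,
    fun a => ExtensionData.amk_ind fun p b => ?_⟩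
  · exact (congrArg χ (ExtensionData.assocMul_mk b b' hc)).trans (mul_pow b b' n)
  · exact mul_pow a b n

theorem of_iso {EG HG : Type} [NormedAddCommGroup EG] [NormedSpace ℝ EG] [TopologicalSpace HG]
    {IG : ModelWithCorners ℝ EG HG} {G : Type} [TopologicalSpace G] [ChartedSpace HG G] [Group G]
    {R Q : CentralExtension (𝓡 1) Circle Γ} {j : Circle →* G} {χ : R.R.arr → G}
    (hχ : IsCharacter R IG j χ) (f : R.Iso Q) :
    IsCharacter Q IG j (fun q => χ (f.toDiffeomorph.symm q)) := by
  let e := f.toDiffeomorph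
  have hπ : ∀ q, R.π (e.symm q) = Q.π q := fun q => by
    rw [← f.map_π]
    exact congrArg Q.π (e.apply_symm_apply q)
  refine ⟨hχ.smooth.comp e.symm.contMDiff, fun q q' hc => ?_, fun a q => ?_⟩
  · have hc' : R.R.s (e.symm q) = R.R.t (e.symm q') := by
      rw [← R.s_π, ← R.t_π, hπ, hπ, Q.s_π, Q.t_π, hc]
    rw [← hχ.map_mul _ _ hc']
    congr 1
    refine e.injective ((e.apply_symm_apply _).trans (Eq.trans ?_ (f.map_mul _ _ hc').symm))
    exact (congrArg₂ Q.R.mul (e.apply_symm_apply q) (e.apply_symm_apply q')).symm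
  · rw [← hχ.map_smul]
    congr 1
    refine e.injective ((e.apply_symm_apply _).trans (Eq.trans ?_ (f.map_smul _ _).symm))
    exact (congrArg (Q.smul a) (e.apply_symm_apply q)).symm

end IsCharacter

/-- On one and the same cover, an isomorphism transports the character `[r, λ] ↦ λⁿ` to `R[U]`, and
the kernel of a character of weight `n` provides `R'`. -/
theorem locallyFromRootsOfUnity_iff (R : CentralExtension (𝓡 1) Circle Γ) (n : ℕ) [NeZero n] :
    R.LocallyFromRootsOfUnity n ↔
      HasLocalCharacter R (𝓡 1) (powMonoidHom n : Circle →* Circle) := by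
  rw [hasLocalCharacter_iff]
  refine exists_congr fun ι => exists_congr fun U => and_congr_right fun _ => ⟨?_, ?_⟩
  · rintro ⟨R', ⟨f⟩⟩
    obtain ⟨χ, hχ⟩ := IsCharacter.exists_assocExt R'
    exact ⟨_, hχ.of_iso f⟩
  · rintro ⟨ψ, hψ⟩
    obtain ⟨F, hF⟩ := hψ.exists_isPowerMap_assocExt
    exact ⟨_, CentralExtension.nonempty_iso hF⟩

end RootsOfUnity

/-! ### The equivalences assembled. -/

/-- The retraction `z ↦ z / |z|` is a homomorphism fixing `S¹` pointwise, so it and the inclusion of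
`S¹` both preserve the weight `n`. -/
theorem hasPowerCharacter_iff_circle {M : SmoothMfd.{u}} {Γ : LieGroupoid M}
    (R : CentralExtension (𝓡 1) Circle Γ) (n : ℕ) :
    R.HasPowerCharacter n ↔ HasLocalCharacter R (𝓡 1) (powMonoidHom n : Circle →* Circle) := by
  rw [hasPowerCharacter_iff]
  refine ⟨fun h => h.map unitsToCircle contMDiff_unitsToCircle _ fun a => ?_,
    fun h => h.map Circle.toUnits contMDiff_circle_toUnits _ fun a => ?_⟩
  · change unitsToCircle (Circle.toUnits a ^ n) = a ^ n
    rw [map_pow, unitsToCircle_toUnits]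
  · exact map_pow Circle.toUnits a n

/-- A trivialization of `Rⁿ` is a generalized homomorphism to `S¹`, that is, a local character of
weight one on `Rⁿ`; this descends to weight `n` on `R`. -/
theorem isTrivial_pow_iff {M : SmoothMfd.{u}} {Γ : LieGroupoid M}
    (R : CentralExtension (𝓡 1) Circle Γ) (n : ℕ) [NeZero n] :
    (R.pow n).IsTrivial ↔ HasLocalCharacter R (𝓡 1) (powMonoidHom n : Circle →* Circle) :=
  (nonempty_equivariantGenHom_iff (R.pow n) (MonoidHom.id Circle) contMDiff_id
    fun _ _ => mul_comm _ _).trans (hasLocalCharacter_pow_iff R n)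

theorem nonempty_equivariantGenHom_GLn_iff {M : SmoothMfd.{u}} {Γ : LieGroupoid M}
    (R : CentralExtension (𝓡 1) Circle Γ) (n : ℕ) :
    Nonempty (EquivariantGenHom R 𝓘(ℝ, (Fin n → ℂ) →L[ℂ] (Fin n → ℂ)) (GLn n) (scalarGLn n)) ↔
      HasLocalCharacter R 𝓘(ℝ, (Fin n → ℂ) →L[ℂ] (Fin n → ℂ)) (scalarGLn n) :=
  nonempty_equivariantGenHom_iff R (scalarGLn n) (contMDiff_scalarGLn n) (scalarGLn_comm n)

theorem mainTheorem11 {M : SmoothMfd.{u}} {Γ : LieGroupoid M}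
    (R : CentralExtension (𝓡 1) Circle Γ) (n : ℕ) [NeZero n] :
    (Nonempty (TwistedVectorBundle R n) ↔
      Nonempty (EquivariantGenHom R 𝓘(ℝ, (Fin n → ℂ) →L[ℂ] (Fin n → ℂ)) (GLn n)
        (scalarGLn n))) ∧
    (Nonempty (EquivariantGenHom R 𝓘(ℝ, (Fin n → ℂ) →L[ℂ] (Fin n → ℂ)) (GLn n)
        (scalarGLn n)) → R.HasPowerCharacter n) ∧
    (R.HasPowerCharacter n ↔ (R.pow n).IsTrivial) ∧
    ((R.pow n).IsTrivial ↔ R.LocallyFromRootsOfUnity n) ∧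
    (Nonempty (TwistedVectorBundle R n) → R.IsTorsion) := by
  rw [nonempty_twistedVectorBundle_iff, nonempty_equivariantGenHom_GLn_iff]
  -- Composition with the determinant. This is the only one-way implication: a character of weight
  -- `n` need not be a determinant.
  have h1 : HasLocalCharacter R 𝓘(ℝ, (Fin n → ℂ) →L[ℂ] (Fin n → ℂ)) (scalarGLn n) →
      R.HasPowerCharacter n := fun h =>
    (hasPowerCharacter_iff R n).2 (h.map (detGLn n) (contMDiff_detGLn n) _ (detGLn_scalar n))
  have h2 : R.HasPowerCharacter n ↔ (R.pow n).IsTrivial :=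
    (hasPowerCharacter_iff_circle R n).trans (isTrivial_pow_iff R n).symm
  exact ⟨Iff.rfl, h1, h2, (isTrivial_pow_iff R n).trans (locallyFromRootsOfUnity_iff R n).symm,
    fun h => ⟨n, NeZero.pos n, h2.1 (h1 h)⟩⟩
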